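/- Notation. Sc-Banach spaces, sc$^k$-maps, sc-smooth retracts and M-polyfolds (with boundary and corners, i.e. modelled on sc-smooth retracts in partial quadrants of sc-Banach spaces) are those of Hofer, Wysocki and Zehnder. A complex M-polyfold is an even-dimensional (every tangent space at a point of regularity $1$ is infinite-dimensional or of even dimension) M-polyfold $X$ modelled on reflexive sc-Banach spaces, with an sc-smooth fibrewise linear $J\colon TX\to TX$, $J^2=-1$, such that the Lie bracket of two sc-smooth local sections of $T^{1,0}X$ is a section of $T^{1,0}$. A map $\phi$ from $X$ to $\mathbb C^N$ is sc-holomorphic if it is sc$^1$ and $T\phi\circ J=i\,T\phi$. Let $0=\delta_0<\delta_1<\cdots$ be real numbers, let $\beta\colon\mathbb R\to[-1,1]$ be smooth and odd with $\beta(s)=1$ for $s\ge1$, and let $L^2(\mathbb R)$ (real-valued functions) carry the sc-structure $E_m=\{f:\sum_{j\le m}\int|D^jf|^2e^{\delta_m s\beta(s)}\,ds<\infty\}$. Let $\gamma_1,\dots,\gamma_k\in L^2(\mathbb R)$ be smooth, compactly supported and orthonormal, with mutually disjoint supports. Put $\gamma_{j,t}=\gamma_j(\cdot+e^{1/t})$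 and $\rho_{j,t}=\frac{d}{dt}\gamma_{j,t}$ for $t>0$, and let $\Gamma^k_n$ be the image of the sc-smooth retraction $r(x,t,f)=(x,t,\pi_t f)$ of $\mathbb R^n\oplus\mathbb R\oplus L^2(\mathbb R)$, where $\pi_tf=\sum_j\langle f,\gamma_{j,t}\rangle\gamma_{j,t}$ for $t>0$ and $\pi_t=0$ for $t\le0$; it is even-dimensional iff $n$ is odd and $k$ is even. In that case, let $J$ be the integrable almost complex structure on $\Gamma^k_n$ that at $(x,t,f)$ is given by $$J(\delta x_1,\dots,\delta x_n,\delta t,\delta f+\xi_t\delta t)=\Big(-\delta x_2,\delta x_1,\dots,-\delta x_{n-1},\delta x_{n-2},-\delta t,\delta x_n,\ \sum_{j=1}^{k/2}\big(\langle\delta f,\gamma_{2j-1,t}\rangle\gamma_{2j,t}-\langle\delta f,\gamma_{2j,t}\rangle\gamma_{2j-1,t}\big)+\xi_t\delta x_n\Big)$$ for $t>0$, with $\delta f$ in the span of the $\gamma_{j,t}$ and $\xi_t=\sum_j\langle f,\gamma_{j,t}\rangle\rho_{j,t}$, and by the same formula with last component $0$ (on vectors with last component $0$) for $t\le0$. Proposition.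 (i) If $X=\Gamma^k_n$ is even-dimensional, then the sc-holomorphic functions $X\to\mathbb C$ form an infinite-dimensional complex vector space. (ii) Let $\iota\colon\Gamma^2_1\to\mathbb C^2$ be given by $\iota(x,t,f)=(x+it,\langle f,\gamma_{1,t}\rangle+i\langle f,\gamma_{2,t}\rangle)$ for $t>0$ and $\iota(x,t,0)=(x+it,0)$ for $t\le0$. It is injective and sc-holomorphic, and there is an sc-holomorphic function $\phi\colon\Gamma^2_1\to\mathbb C$ such that, for every neighbourhood $U$ of $0$ in $\mathbb C^2$, no holomorphic function $U\to\mathbb C$ coincides with $\phi\circ\iota^{-1}$ on $U\cap\iota(\Gamma^2_1)$. One can take $\phi\circ\iota^{-1}(z,w)=z^2w^2\log z$ for $\operatorname{Im}z>0$ and $0$ for $\operatorname{Im}z\le0$. (iii) An sc-holomorphic function on a complex M-polyfold is not necessarily sc$^2$: there are a complex M-polyfold $X$ (it can be taken to be an sc-smooth retract, with a single global chart) and an sc-holomorphic function $X\to\mathbb C$ that is not sc$^2$. -/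

import Mathlib

open MeasureTheory
open scoped ContDiff

namespace MPolyfold

noncomputable section

universe u v

/-! ### Scales of normed spaces and sc-Banach spaces -/

/-- The data of a scale on a real vector space `E`: the subspaces `E_m` and their norms
(`nrm m x` is meaningful for `x ∈ lev m`). The axioms of an sc-Banach space are `ScScale.IsScBanach`.
The ambient vector space may be larger than `E_0 = lev 0`, so that the shifted scale `E¹` and the
scale of the tangent bundle `TE = E¹ ⊕ E` live on `E` and `E × E`. -/
structure ScScale (E : Type u) [AddCommGroup E] [Module ℝ E] where
  /-- the level `E_m` -/
  lev : ℕ → Submodule ℝ E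
  /-- the norm of `E_m` -/
  nrm : ℕ → E → ℝ

section Scales

variable {E : Type u} [AddCommGroup E] [Module ℝ E] {F : Type v} [AddCommGroup F] [Module ℝ F]

/-- `E` with the levels `E_m` is an sc-Banach space: the `E_m` form a decreasing sequence of Banach
spaces with `E_0 = E`, the inclusions `E_{m+1} → E_m` are compact, and `E_∞ = ⋂ E_i` is dense in
every `E_m`. -/
structure ScScale.IsScBanach (S : ScScale E) : Prop where
  lev_zero : S.lev 0 = ⊤
  lev_succ_le : ∀ m, S.lev (m + 1) ≤ S.lev m
  nrm_nonneg : ∀ m, ∀ x ∈ S.lev m, 0 ≤ S.nrm m x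
  nrm_eq_zero_iff : ∀ m, ∀ x ∈ S.lev m, S.nrm m x = 0 ↔ x = 0
  nrm_add_le : ∀ m, ∀ x ∈ S.lev m, ∀ y ∈ S.lev m, S.nrm m (x + y) ≤ S.nrm m x + S.nrm m y
  nrm_smul : ∀ m, ∀ (c : ℝ), ∀ x ∈ S.lev m, S.nrm m (c • x) = |c| * S.nrm m x
  complete : ∀ m, ∀ a : ℕ → E, (∀ i, a i ∈ S.lev m) →
    (∀ ε > 0, ∃ N, ∀ i ≥ N, ∀ j ≥ N, S.nrm m (a i - a j) < ε) →
    ∃ x ∈ S.lev m, Filter.Tendsto (fun i => S.nrm m (a i - x)) Filter.atTop (nhds 0)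
  compact : ∀ m, ∀ a : ℕ → E, (∀ i, a i ∈ S.lev (m + 1)) →
    (∃ K, ∀ i, S.nrm (m + 1) (a i) ≤ K) →
    ∃ x ∈ S.lev m, ∃ g : ℕ → ℕ, StrictMono g ∧
      Filter.Tendsto (fun i => S.nrm m (a (g i) - x)) Filter.atTop (nhds 0)
  dense : ∀ m, ∀ x ∈ S.lev m, ∀ ε > 0, ∃ y, (∀ i, y ∈ S.lev i) ∧ S.nrm m (x - y) < ε

/-- The topological dual of the level `E_m`. -/
def ScScale.dualLev (S : ScScale E) (m : ℕ) : Set (S.lev m →ₗ[ℝ] ℝ) :=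
  {l | ∃ K : ℝ, ∀ x : S.lev m, |l x| ≤ K * S.nrm m x}

/-- Every level `E_m` is reflexive: every linear functional `Λ` on the dual of `E_m` that is bounded
for the dual norm is the evaluation at a point of `E_m`. -/
def ScScale.IsReflexive (S : ScScale E) : Prop :=
  ∀ m, ∀ Λ : (S.lev m →ₗ[ℝ] ℝ) → ℝ,
    (∀ l ∈ S.dualLev m, ∀ l' ∈ S.dualLev m, Λ (l + l') = Λ l + Λ l') →
    (∀ c : ℝ, ∀ l ∈ S.dualLev m, Λ (c • l) = c * Λ l) →
    (∃ M : ℝ, ∀ l ∈ S.dualLev m, ∀ K : ℝ, 0 ≤ K → (∀ x : S.lev m, |l x| ≤ K * S.nrm m x) →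
      |Λ l| ≤ M * K) →
    ∃ x : S.lev m, ∀ l ∈ S.dualLev m, Λ l = l x

/-- The shifted scale `E^k`, whose level `m` is `E_{m+k}`. -/
def ScScale.shift (S : ScScale E) (k : ℕ) : ScScale E where
  lev m := S.lev (m + k)
  nrm m := S.nrm (m + k)

/-- The direct sum `E ⊕ F`. -/
def ScScale.prod (S : ScScale E) (T : ScScale F) : ScScale (E × F) where
  lev m := (S.lev m).prod (T.lev m)
  nrm m p := max (S.nrm m p.1) (T.nrm m p.2)

/-- The tangent scale `TE = E¹ ⊕ E`. -/
def ScScale.tangent (S : ScScale E) : ScScale (E × E) := (S.shift 1).prod S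

/-- The constant scale; for finite-dimensional spaces it is the only sc-structure. -/
def constScale (G : Type v) [NormedAddCommGroup G] [NormedSpace ℝ G] : ScScale G where
  lev _ := ⊤
  nrm _ x := ‖x‖

/-- sc-operators between scales. -/
def IsScOperator (S : ScScale E) (T : ScScale F) (L : E →ₗ[ℝ] F) : Prop :=
  ∀ m, ∃ K : ℝ, ∀ x ∈ S.lev m, L x ∈ T.lev m ∧ T.nrm m (L x) ≤ K * S.nrm m x

/-- `C` is a partial quadrant: some sc-isomorphism `E ≅ ℝⁿ ⊕ W` maps `C` onto `[0,∞)ⁿ ⊕ W`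
(such a `C` is closed and convex). -/
def IsPartialQuadrant (S : ScScale E) (C : Set E) : Prop :=
  ∃ (n : ℕ) (W : Type u) (_ : AddCommGroup W) (_ : Module ℝ W) (SW : ScScale W),
    SW.IsScBanach ∧ ∃ L : E ≃ₗ[ℝ] (Fin n → ℝ) × W,
      IsScOperator S ((constScale (Fin n → ℝ)).prod SW) L.toLinearMap ∧
      IsScOperator ((constScale (Fin n → ℝ)).prod SW) S L.symm.toLinearMap ∧
      L '' C = {p | ∀ i, 0 ≤ p.1 i}

/-- `U ⊆ C` is relatively open for the topology of `E_0`. -/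
def IsRelOpen (S : ScScale E) (C U : Set E) : Prop :=
  U ⊆ C ∧ ∀ x ∈ U, ∃ d > 0, ∀ y ∈ C, S.nrm 0 (y - x) < d → y ∈ U

/-! ### Scale calculus -/

/-- `f : U → F` is sc⁰: it maps `U_m = U ∩ E_m` into `F_m`, continuously, for every `m`. -/
def ScCont (S : ScScale E) (T : ScScale F) (f : E → F) (U : Set E) : Prop :=
  ∀ m, ∀ x ∈ U, x ∈ S.lev m → f x ∈ T.lev m ∧
    ∀ ε > 0, ∃ d > 0, ∀ y ∈ U, y ∈ S.lev m → S.nrm m (y - x) < d → T.nrm m (f y - f x) < ε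

/-- `A` is the sc-derivative `Df(x)` of `f : U → F` at `x ∈ U_1`: a bounded operator `E_0 → F_0` with
`‖f (x + h) - f x - A h‖₀ / ‖h‖₁ → 0` as `‖h‖₁ → 0`, `h ∈ E_1`, `x + h ∈ U`. As `E_1` is dense in
`E_0`, it is unique (on `E_0`) when `U` is relatively open in a partial quadrant. -/
def HasScDerivAt (S : ScScale E) (T : ScScale F) (f : E → F) (U : Set E) (x : E)
    (A : E →ₗ[ℝ] F) : Prop :=
  (∃ K : ℝ, ∀ h ∈ S.lev 0, A h ∈ T.lev 0 ∧ T.nrm 0 (A h) ≤ K * S.nrm 0 h) ∧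
  ∀ ε > 0, ∃ d > 0, ∀ h ∈ S.lev 1, x + h ∈ U → S.nrm 1 h < d →
    T.nrm 0 (f (x + h) - f x - A h) ≤ ε * S.nrm 1 h

/-- The tangent bundle `TU = U¹ ⊕ E` as a subset of `E × E`. -/
def tangentSet (S : ScScale E) (U : Set E) : Set (E × E) :=
  {q | q.1 ∈ U ∧ q.1 ∈ S.lev 1 ∧ q.2 ∈ S.lev 0}

end Scales

/-- `f : U → F` is of class sc^k: sc⁰ means sc-continuous, and `f` is sc^{k+1} iff it is
sc-continuous, has a derivative `Df(x)` at each `x ∈ U_1`, and its tangent map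
`Tf (x, h) = (f x, Df(x) h)` on `TU` is sc^k (equivalently, `f, Tf, …, T^k f` are all sc¹). -/
def IsSc : ℕ → ∀ {E : Type u} [AddCommGroup E] [Module ℝ E] {F : Type v} [AddCommGroup F]
    [Module ℝ F], ScScale E → ScScale F → (E → F) → Set E → Prop
  | 0, _, _, _, _, _, _, S, T, f, U => ScCont S T f U
  | k + 1, E, _, _, F, _, _, S, T, f, U => ScCont S T f U ∧
      ∃ Df : E → E →ₗ[ℝ] F, (∀ x ∈ U, x ∈ S.lev 1 → HasScDerivAt S T f U x (Df x)) ∧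
        IsSc k S.tangent T.tangent (fun q => (f q.1, Df q.1 q.2)) (tangentSet S U)

section Retracts

variable {E : Type u} [AddCommGroup E] [Module ℝ E] {F : Type v} [AddCommGroup F] [Module ℝ F]

/-- `f : U → F` is sc-smooth. -/
def IsScSmooth (S : ScScale E) (T : ScScale F) (f : E → F) (U : Set E) : Prop :=
  ∀ k, IsSc k S T f U

/-! ### sc-smooth retracts, viewed as M-polyfolds with one global chart

In the following, `r` is a retraction of `U ⊆ E`, and the M-polyfold is `O = r '' U`. -/

/-- `(U, C, E)` is an open tuple in an sc-Banach space and `r : U → U` an sc-smooth retraction. -/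
structure IsScSmoothRetraction (S : ScScale E) (C U : Set E) (r : E → E) : Prop where
  scBanach : S.IsScBanach
  quadrant : IsPartialQuadrant S C
  relOpen : IsRelOpen S C U
  mapsTo : ∀ x ∈ U, r x ∈ U
  smooth : IsScSmooth S S r U
  retract : ∀ x ∈ U, r (r x) = r x

/-- The tangent space `T_p O = im Dr(p)`, for `p ∈ O_1`. -/
def tangentAt (S : ScScale E) (U : Set E) (r : E → E) (p : E) : Set E :=
  {w | ∃ A : E →ₗ[ℝ] E, HasScDerivAt S S r U p A ∧ ∃ h, A h = w}

/-- For every `p ∈ O_1` the tangent space `im Dr(p)` is infinite-dimensional or of even dimension. -/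
def IsEvenDimensional (S : ScScale E) (U : Set E) (r : E → E) : Prop :=
  ∀ p ∈ r '' U, p ∈ S.lev 1 → ∀ A : E →ₗ[ℝ] E, HasScDerivAt S S r U p A →
    ¬ FiniteDimensional ℝ (LinearMap.range A) ∨ Even (Module.finrank ℝ (LinearMap.range A))

/-- The composition `f ∘ r` of a function `f` on `O` with the retraction (the value `0` outside `O`
plays no role on `U`). -/
def pull {G : Type v} [Zero G] (U : Set E) (r : E → E) (f : ↥(r '' U) → G) : E → G :=
  fun x => Function.extend (Subtype.val : ↥(r '' U) → E) f (fun _ => 0) (r x)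

/-- A function `f` on `O` with values in a normed space with the constant scale is of class sc^k,
that is, `f ∘ r` is. -/
def IsScOnRetract {G : Type v} [NormedAddCommGroup G] [NormedSpace ℝ G] (k : ℕ) (S : ScScale E)
    (U : Set E) (r : E → E) (f : ↥(r '' U) → G) : Prop :=
  IsSc k S (constScale G) (pull U r f) U

/-- `f : O → G` is sc-holomorphic for `J`: it is sc¹ and `Tf ∘ J = i • Tf` on `TO`. -/
def IsScHolomorphic {G : Type v} [NormedAddCommGroup G] [NormedSpace ℝ G] [NormedSpace ℂ G]
    (S : ScScale E) (U : Set E) (r : E → E) (J : E → E → E) (f : ↥(r '' U) → G) : Prop :=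
  IsScOnRetract 1 S U r f ∧
  ∀ p ∈ r '' U, p ∈ S.lev 1 → ∃ A : E →ₗ[ℝ] G,
    HasScDerivAt S (constScale G) (pull U r f) U p A ∧
    ∀ w ∈ tangentAt S U r p, A (J p w) = Complex.I • A w

/-- `J` (with `J p` the endomorphism of `T_p O`, `p ∈ O_1`) is an almost complex structure on `O`:
fibrewise linear, `J_p² = -1`, and sc-smooth as a map `TO → TO`, that is, `J ∘ Tr` is sc-smooth
on `TU`. -/
structure IsAlmostComplexStructure (S : ScScale E) (U : Set E) (r : E → E) (J : E → E → E) :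
    Prop where
  mem : ∀ p ∈ r '' U, p ∈ S.lev 1 → ∀ w ∈ tangentAt S U r p, J p w ∈ tangentAt S U r p
  add : ∀ p ∈ r '' U, p ∈ S.lev 1 → ∀ w ∈ tangentAt S U r p, ∀ w' ∈ tangentAt S U r p,
    J p (w + w') = J p w + J p w'
  smul : ∀ p ∈ r '' U, p ∈ S.lev 1 → ∀ c : ℝ, ∀ w ∈ tangentAt S U r p, J p (c • w) = c • J p w
  sq : ∀ p ∈ r '' U, p ∈ S.lev 1 → ∀ w ∈ tangentAt S U r p, J p (J p w) = -w
  smooth : ∃ R : E → E →ₗ[ℝ] E, (∀ x ∈ U, x ∈ S.lev 1 → HasScDerivAt S S r U x (R x)) ∧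
    IsScSmooth S.tangent S.tangent (fun q => (r q.1, J (r q.1) (R q.1 q.2))) (tangentSet S U)

/-- The complexified tangent vector `a + i b` lies in the `i`-eigenspace `T_p^{1,0} O` of `J_p`. -/
def IsOneZero (S : ScScale E) (U : Set E) (r : E → E) (J : E → E → E) (p a b : E) : Prop :=
  a ∈ tangentAt S U r p ∧ b ∈ tangentAt S U r p ∧ J p a = -b ∧ J p b = a

/-- `μ₁ + i μ₂` is an sc-smooth section of `T^{1,0} O` over the open set `O' ⊆ O`: a section of
`TO → O¹`, with values in `T^{1,0}`, such that `μ₁ ∘ r` and `μ₂ ∘ r` are sc-smooth as maps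
from (an open subset of) `U¹` to `E`. -/
def IsOneZeroSection (S : ScScale E) (U : Set E) (r : E → E) (J : E → E → E) (O' : Set E)
    (μ₁ μ₂ : E → E) : Prop :=
  IsScSmooth (S.shift 1) S (μ₁ ∘ r) (U ∩ r ⁻¹' O') ∧
  IsScSmooth (S.shift 1) S (μ₂ ∘ r) (U ∩ r ⁻¹' O') ∧
  ∀ p ∈ O', p ∈ S.lev 1 → IsOneZero S U r J p (μ₁ p) (μ₂ p)

/-- `J` is integrable: the bracket `[μ, ν] = Dμ ν - Dν μ` (extended complex-bilinearly) of two
sc-smooth local sections `μ = μ₁ + i μ₂`, `ν = ν₁ + i ν₂` of `T^{1,0}` is again a section of `T^{1,0}`,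
over the points of regularity 2. Here `A₁, A₂, B₁, B₂` are the derivatives of
`μ₁, μ₂, ν₁, ν₂` at `p`. The bracket of sc-smooth fields is always sc-smooth,
so the condition is the one on its values. -/
def IsIntegrable (S : ScScale E) (U : Set E) (r : E → E) (J : E → E → E) : Prop :=
  ∀ O' : Set E, IsRelOpen S (r '' U) O' → ∀ μ₁ μ₂ ν₁ ν₂ : E → E,
    IsOneZeroSection S U r J O' μ₁ μ₂ → IsOneZeroSection S U r J O' ν₁ ν₂ →
    ∀ p ∈ O', p ∈ S.lev 2 → ∀ A₁ A₂ B₁ B₂ : E →ₗ[ℝ] E,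
      HasScDerivAt (S.shift 1) S (μ₁ ∘ r) (U ∩ r ⁻¹' O') p A₁ →
      HasScDerivAt (S.shift 1) S (μ₂ ∘ r) (U ∩ r ⁻¹' O') p A₂ →
      HasScDerivAt (S.shift 1) S (ν₁ ∘ r) (U ∩ r ⁻¹' O') p B₁ →
      HasScDerivAt (S.shift 1) S (ν₂ ∘ r) (U ∩ r ⁻¹' O') p B₂ →
      IsOneZero S U r J p
        ((A₁ (ν₁ p) - B₁ (μ₁ p)) - (A₂ (ν₂ p) - B₂ (μ₂ p)))
        ((A₁ (ν₂ p) - B₂ (μ₁ p)) + (A₂ (ν₁ p) - B₁ (μ₂ p)))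

/-- The retract `O = r '' U` with `J` is a complex M-polyfold: an even-dimensional M-polyfold
modelled on a reflexive sc-Banach space, with an integrable almost complex structure. (Its topology,
that of a subset of `E_0`, is metrizable.) -/
structure IsComplexMPolyfold (S : ScScale E) (C U : Set E) (r : E → E) (J : E → E → E) : Prop where
  retraction : IsScSmoothRetraction S C U r
  reflexive : S.IsReflexive
  even : IsEvenDimensional S U r
  almostComplex : IsAlmostComplexStructure S U r J
  integrable : IsIntegrable S U r J

end Retracts

/-! ### The M-polyfolds of class `Γ` -/

/-- The Hilbert space `L²(ℝ)` of real-valued functions. -/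
abbrev L2R : Type := Lp ℝ 2 (volume : Measure ℝ)

/-- The class in `L²(ℝ)` of a square-integrable function. -/
def toL2 (g : ℝ → ℝ) : L2R :=
  open Classical in if h : MemLp g 2 (volume : Measure ℝ) then h.toLp g else 0

/-- `g` is the `j`-th weak derivative of `f`. -/
def HasWeakDeriv (j : ℕ) (f g : L2R) : Prop :=
  ∀ ψ : ℝ → ℝ, ContDiff ℝ ∞ ψ → HasCompactSupport ψ →
    ∫ s, f s * iteratedDeriv j ψ s = (-1) ^ j * ∫ s, g s * ψ s

/-- The `j`-th weak derivative `D^j f` (if it exists in `L²`). -/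
def weakDeriv (j : ℕ) (f : L2R) : L2R :=
  open Classical in if h : ∃ g, HasWeakDeriv j f g then h.choose else 0

theorem integrable_mul_of_test {ψ : ℝ → ℝ} (hψ : ContDiff ℝ ∞ ψ) (hc : HasCompactSupport ψ)
    (f : L2R) : Integrable (fun s => f s * ψ s) :=
  (Lp.memLp f).integrable_mul (hψ.continuous.memLp_of_hasCompactSupport (p := 2) hc)

theorem HasWeakDeriv.add {j : ℕ} {f g f' g' : L2R} (h : HasWeakDeriv j f g)
    (h' : HasWeakDeriv j f' g') : HasWeakDeriv j (f + f') (g + g') := by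
  intro ψ hψ hc
  have hd : ContDiff ℝ ∞ (iteratedDeriv j ψ) := by
    rw [iteratedDeriv_eq_iterate]
    clear h h'
    induction j with
    | zero => simpa using hψ
    | succ j ih =>
      rw [Function.iterate_succ_apply']
      exact (contDiff_infty_iff_deriv.1 ih).2
  have hdc : HasCompactSupport (iteratedDeriv j ψ) := by
    rw [iteratedDeriv_eq_iterate]
    clear h h' hd
    induction j with
    | zero => simpa using hc
    | succ j ih =>
      rw [Function.iterate_succ_apply']
      exact ih.deriv
  have e1 : ∫ s, (f + f' : L2R) s * iteratedDeriv j ψ s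
      = ∫ s, (f s * iteratedDeriv j ψ s + f' s * iteratedDeriv j ψ s) := by
    refine integral_congr_ae ?_
    filter_upwards [Lp.coeFn_add f f'] with s hs
    rw [hs, Pi.add_apply, add_mul]
  have e2 : ∫ s, (g + g' : L2R) s * ψ s = ∫ s, (g s * ψ s + g' s * ψ s) := by
    refine integral_congr_ae ?_
    filter_upwards [Lp.coeFn_add g g'] with s hs
    rw [hs, Pi.add_apply, add_mul]
  rw [e1, e2, integral_add (integrable_mul_of_test hd hdc f) (integrable_mul_of_test hd hdc f'),
    integral_add (integrable_mul_of_test hψ hc g) (integrable_mul_of_test hψ hc g'),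
    h ψ hψ hc, h' ψ hψ hc, mul_add]

theorem HasWeakDeriv.smul {j : ℕ} {f g : L2R} (c : ℝ) (h : HasWeakDeriv j f g) :
    HasWeakDeriv j (c • f) (c • g) := by
  intro ψ hψ hc
  have e1 : ∫ s, (c • f : L2R) s * iteratedDeriv j ψ s
      = ∫ s, c * (f s * iteratedDeriv j ψ s) := by
    refine integral_congr_ae ?_
    filter_upwards [Lp.coeFn_smul c f] with s hs
    rw [hs, Pi.smul_apply, smul_eq_mul, mul_assoc]
  have e2 : ∫ s, (c • g : L2R) s * ψ s = ∫ s, c * (g s * ψ s) := by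
    refine integral_congr_ae ?_
    filter_upwards [Lp.coeFn_smul c g] with s hs
    rw [hs, Pi.smul_apply, smul_eq_mul, mul_assoc]
  rw [e1, e2, integral_const_mul, integral_const_mul, h ψ hψ hc]
  ring

/-- The choices in the construction of the M-polyfolds `Γ_n^k` and of their complex structure: the
exponents `δ_m`, the cut-off function `β`, and the orthonormal functions `γ_1, …, γ_k`
(indexed from `0`) with mutually disjoint supports. -/
structure GammaData (k : ℕ) where
  δ : ℕ → ℝ
  δ_strictMono : StrictMono δ
  δ_zero : δ 0 = 0
  β : ℝ → ℝ
  β_smooth : ContDiff ℝ ∞ β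
  β_odd : ∀ s, β (-s) = -β s
  β_mem : ∀ s, β s ∈ Set.Icc (-1 : ℝ) 1
  β_one : ∀ s, 1 ≤ s → β s = 1
  γ : Fin k → ℝ → ℝ
  γ_smooth : ∀ j, ContDiff ℝ ∞ (γ j)
  γ_compact : ∀ j, HasCompactSupport (γ j)
  γ_orthonormal : ∀ i j, ∫ s, γ i s * γ j s = if i = j then 1 else 0
  γ_disjoint : ∀ i j, i ≠ j → Disjoint (tsupport (γ i)) (tsupport (γ j))

namespace GammaData

variable {k : ℕ} (D : GammaData k)

/-- The weight `e^{δ_m s β(s)}`. -/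
def weight (m : ℕ) (s : ℝ) : ℝ := Real.exp (D.δ m * s * D.β s)

/-- `∫ |g(s)|² e^{δ_m s β(s)} ds < ∞`. -/
def WeightedInt (m : ℕ) (g : L2R) : Prop :=
  Integrable (fun s => (g s) ^ 2 * D.weight m s) (volume : Measure ℝ)

theorem weight_continuous (m : ℕ) : Continuous (D.weight m) := by
  have := D.β_smooth.continuous
  unfold weight
  fun_prop

theorem WeightedInt.add {D : GammaData k} {m : ℕ} {g g' : L2R} (h : D.WeightedInt m g)
    (h' : D.WeightedInt m g') : D.WeightedInt m (g + g') := by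
  unfold WeightedInt at *
  refine Integrable.mono' ((h.const_mul 2).add (h'.const_mul 2)) ?_ ?_
  · exact ((Lp.aestronglyMeasurable _).pow 2).mul (D.weight_continuous m).aestronglyMeasurable
  · filter_upwards [Lp.coeFn_add g g'] with s hs
    have hw : 0 ≤ D.weight m s := (Real.exp_pos _).le
    rw [hs, Real.norm_of_nonneg (by positivity)]
    simp only [Pi.add_apply]
    nlinarith [mul_nonneg (sq_nonneg (g s - g' s)) hw]

theorem WeightedInt.smul {D : GammaData k} {m : ℕ} {g : L2R} (c : ℝ) (h : D.WeightedInt m g) :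
    D.WeightedInt m (c • g) := by
  unfold WeightedInt at *
  refine (h.const_mul (c ^ 2)).congr ?_
  filter_upwards [Lp.coeFn_smul c g] with s hs
  rw [hs, Pi.smul_apply, smul_eq_mul]
  ring

/-- The weighted Sobolev space `E_m = W^{m,δ_m} ⊆ L²(ℝ)`. -/
def sobolev (m : ℕ) : Submodule ℝ L2R where
  carrier := {f : L2R | ∀ j ≤ m, ∃ g, HasWeakDeriv j f g ∧ D.WeightedInt m g}
  add_mem' := by
    intro a b ha hb j hj
    obtain ⟨g, h1, h2⟩ := ha j hj
    obtain ⟨g', h1', h2'⟩ := hb j hj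
    exact ⟨g + g', h1.add h1', h2.add h2'⟩
  zero_mem' := by
    intro j _
    refine ⟨(0 : ℝ) • 0, ?_, WeightedInt.smul 0 ?_⟩
    · intro ψ _ _
      have h0 : ∀ θ : ℝ → ℝ, ∫ s, (0 : L2R) s * θ s = 0 := fun θ => by
        rw [← integral_zero ℝ ℝ]
        refine integral_congr_ae ?_
        filter_upwards [Lp.coeFn_zero ℝ 2 (volume : Measure ℝ)] with s hs
        rw [hs, Pi.zero_apply, zero_mul]
      rw [smul_zero, h0, h0, mul_zero]
    · unfold WeightedInt
      refine (integrable_zero ℝ ℝ volume).congr ?_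
      filter_upwards [Lp.coeFn_zero ℝ 2 (volume : Measure ℝ)] with s hs
      rw [hs]
      simp
  smul_mem' := by
    intro c a ha j hj
    obtain ⟨g, h1, h2⟩ := ha j hj
    exact ⟨c • g, h1.smul c, h2.smul c⟩

/-- The sc-structure of `L²(ℝ)` given by the weighted Sobolev spaces, with
`‖f‖_m² = ∑_{j ≤ m} ∫ |D^j f|² e^{δ_m s β(s)} ds`. -/
def l2Scale : ScScale L2R where
  lev m := D.sobolev m
  nrm m f := Real.sqrt (∑ j ∈ Finset.range (m + 1), ∫ s, (weakDeriv j f s) ^ 2 * D.weight m s)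

/-- The scale of `ℝⁿ ⊕ ℝ ⊕ L²(ℝ)`. -/
def scale (n : ℕ) : ScScale ((Fin n → ℝ) × ℝ × L2R) :=
  (constScale (Fin n → ℝ)).prod ((constScale ℝ).prod D.l2Scale)

/-- The translate `γ_j(· + e^{1/t})`. -/
def shifted (j : Fin k) (t : ℝ) : L2R := toL2 (fun s => D.γ j (s + Real.exp (1 / t)))

/-- The derivative `ρ_{j,t} = d/dt γ_j(· + e^{1/t})`. -/
def rho (j : Fin k) (t : ℝ) : L2R :=
  toL2 (fun s => deriv (fun τ => D.γ j (s + Real.exp (1 / τ))) t)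

/-- The projection `π_t^k`. -/
def proj (t : ℝ) (f : L2R) : L2R :=
  open Classical in
  if 0 < t then ∑ j, (inner ℝ f (D.shifted j t)) • D.shifted j t else 0

/-- The retraction `r (x, t, f) = (x, t, π_t f)` of `ℝⁿ ⊕ ℝ ⊕ L²(ℝ)`. -/
def retr (n : ℕ) (p : (Fin n → ℝ) × ℝ × L2R) : (Fin n → ℝ) × ℝ × L2R :=
  (p.1, p.2.1, D.proj p.2.1 p.2.2)

/-- The M-polyfold `Γ_n^k`, the image of the retraction. -/
abbrev Gam (n : ℕ) : Type := ↥(D.retr n '' Set.univ)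

/-- `ξ_t = ∑_j ⟨f, γ_j(· + e^{1/t})⟩ ρ_{j,t}`. -/
def xi (t : ℝ) (f : L2R) : L2R := ∑ j, (inner ℝ f (D.shifted j t)) • D.rho j t

end GammaData

/-- `(a_0, a_1, a_2, a_3, …) ↦ (-a_1, a_0, -a_3, a_2, …)`. -/
def rot (a : ℕ → ℝ) (j : ℕ) : ℝ := if Even j then -a (j + 1) else a (j - 1)

/-- The sequence `(x_1, …, x_n, t, 0, 0, …)`, indexed from `0`. -/
def baseSeq {n : ℕ} (x : Fin n → ℝ) (t : ℝ) (i : ℕ) : ℝ :=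
  if h : i < n then x ⟨i, h⟩ else if i = n then t else 0

namespace GammaData

variable {k : ℕ} (D : GammaData k)

/-- The sequence `⟨g, γ_1(· + e^{1/t})⟩, …, ⟨g, γ_k(· + e^{1/t})⟩, 0, 0, …`, indexed from `0`. -/
def coeffSeq (t : ℝ) (g : L2R) (j : ℕ) : ℝ :=
  if h : j < k then inner ℝ g (D.shifted ⟨j, h⟩ t) else 0

/-- The complex structure of `Γ_n^k` (`n` odd, `k` even): at `p = (x, t, f)` it sends a tangent
vector `(δx_1, …, δx_n, δt, δf + ξ_t δt)`, with `δf` in the span of the `γ_j(· + e^{1/t})`, to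
`(-δx_2, δx_1, …, -δt, δx_n, ∑_j (⟨δf, γ_{2j-1}⟩ γ_{2j} - ⟨δf, γ_{2j}⟩ γ_{2j-1}) + ξ_t δx_n)`
if `t > 0`, and to `(-δx_2, δx_1, …, -δt, δx_n, 0)` if `t ≤ 0`. Since `ξ_t` is
orthogonal to the `γ_j(· + e^{1/t})`, `⟨δf, γ_j⟩` is the inner product of the whole third component
with `γ_j(· + e^{1/t})`. -/
def cplx (n : ℕ) (p w : (Fin n → ℝ) × ℝ × L2R) : (Fin n → ℝ) × ℝ × L2R :=
  (fun i => rot (baseSeq w.1 w.2.1) i,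
   rot (baseSeq w.1 w.2.1) n,
   open Classical in
   if 0 < p.2.1 then
     (∑ j : Fin k, rot (D.coeffSeq p.2.1 w.2.2) j • D.shifted j p.2.1) +
       rot (baseSeq w.1 w.2.1) n • D.xi p.2.1 p.2.2
   else 0)

end GammaData

/-- The map `ι : Γ_1² → ℂ²`, `(x, t, f) ↦ (x + i t, ⟨f, γ_1(· + e^{1/t})⟩ + i ⟨f, γ_2(· + e^{1/t})⟩)`
for `t > 0`, and `(x, t, 0) ↦ (x + i t, 0)` for `t ≤ 0`. -/
def iotaMap (D : GammaData 2) (p : D.Gam 1) : ℂ × ℂ :=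
  (⟨p.1.1 0, p.1.2.1⟩,
   open Classical in
   if 0 < p.1.2.1 then
     ⟨inner ℝ p.1.2.2 (D.shifted 0 p.1.2.1), inner ℝ p.1.2.2 (D.shifted 1 p.1.2.1)⟩
   else 0)

end

end MPolyfold

/-!
**Infinitely many holomorphic functions.** At points with `t < 0` the retract is locally
`ℝⁿ ⊕ ℝ`, so `n` is odd if it is even-dimensional (`GammaData.odd_of_isEvenDimensional`). Then the
last base coordinate and `t` form a complex coordinate `z = x_n + i t`, and every entire function
of `z` is sc-holomorphic (`GammaData.isScHolomorphic_comp_zCoord`). The powers of `z` are linearly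
independent.

**Functions that do not extend holomorphically.** On the part `t > 0` of `Γ_1²`, let `w` be the
fibre coordinate `⟨f, γ_{1,t}⟩ + i ⟨f, γ_{2,t}⟩`. As `f = π_t f` is orthogonal to all `ρ_{j,t}`, the
coordinates `(z, w)` turn `J` into multiplication by `i`, so `a(z) w^{k+1}` is holomorphic there for
holomorphic `a`. Its extension by `0` to `t ≤ 0` is sc-holomorphic if `a` and its derivative are
bounded on bounded sets (`GammaData.isScHolomorphic_extendByZero`). Indeed `γ_{j,t}` lives near
`s = -e^{1/t}`, where the weight of `E_1` is about `e^{δ_1 e^{1/t}}`. So for `f` in `E_1` the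
products `⟨f, γ_{j,t}⟩` and `⟨f, γ_j'(· + e^{1/t})⟩` are `O(e^{-δ_1 e^{1/t} / 2})`, which beats both
the factor `1/t` in a difference quotient and the speed `e^{1/t} / t²` in `ρ_{j,t}`. The components
of `ι` and the function `z² w² log z` are of this kind, or holomorphic in `z`. A holomorphic
extension of the latter to a neighbourhood of `0` would, for a fixed small `w ≠ 0`, extend
`z² log z`; but the second derivative `2 log z + 3` of this function is unbounded
(`not_exists_extension_sq_mul_log`).

**An sc-holomorphic function that is not sc².** Take pairs of complex sequences `(z, u)` in weighted
`ℓ²` spaces, and the function `F = ∑ 2⁻ⁿ χ(D_n z_n) u_n` (`twistSum`), where `D_n = 2^{8n}` and `χ`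
(`twist`) is a non-vanishing smooth function that is `exp` near `0` and `1` near infinity. It is
holomorphic for the complex structure `J` (`twistJ`) that sends `(h_z, h_u)` to
`(i h_z, i h_u + g_n(p) conj h_z)` in the coordinates of index `n`, where
`g_n = D_n u_n · (2 i ∂̄ log χ)(D_n z_n)` compensates the failure of `χ` to be holomorphic
(`twistSumDeriv_twistJ`). The derivative of `g_n` in the directions of type `(1,0)` is a multiple of
the conjugate of the `z`-component (`exists_fderiv_twistCoeff_eq`), and therefore `J` is
integrable.

The weights decide the rest. On `E_1` the numbers `D_n u_n` are `O(2⁻ⁿ)`; this makes `J` continuous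
and `F` sc¹. On `E_2` the numbers `D_n z_n` tend to `0`, uniformly on bounded sets, and `∂̄ log χ`
vanishes near `0`. So near a point of `E_2` only finitely many `g_n` are non-zero; there `J` is a
linear map plus a smooth map that factors through finitely many coordinates, and it is
sc-smooth (`isScSmooth_of_factors`). But `exp` has a non-zero second derivative at `0`, so finitely
many terms do not suffice for `F`: its second derivative at a suitable point, in the direction of
the coordinate `z_n`, is `2^{2n}`, while the `E_1`-norm of this direction is only `2ⁿ`. Hence `F` is
not sc² (`not_isSc_two_twistSum`).
-/

namespace MPolyfold

universe u v w

/-! ### Scales with comparable norms -/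

section Nested

variable {E : Type u} [AddCommGroup E] [Module ℝ E] {F : Type v} [AddCommGroup F] [Module ℝ F]

/-- The levels decrease and the inclusions `E_{m+1} → E_m` are bounded. -/
structure ScScale.IsNested (S : ScScale E) : Prop where
  lev_succ_le : ∀ m, S.lev (m + 1) ≤ S.lev m
  nrm_nonneg : ∀ m, ∀ x ∈ S.lev m, 0 ≤ S.nrm m x
  nrm_le_succ : ∀ m, ∃ K : ℝ, ∀ x ∈ S.lev (m + 1), S.nrm m x ≤ K * S.nrm (m + 1) x

/-- A nested scale of normed spaces in which `E_∞` is dense in every level: an sc-Banach space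
without compactness, completeness and `E_0 = E`. Unlike sc-Banach spaces in the encoding at hand,
these scales are closed under `ScScale.tangent`. -/
structure ScScale.IsTame (S : ScScale E) : Prop extends S.IsNested where
  eq_zero : ∀ m, ∀ x ∈ S.lev m, S.nrm m x = 0 → x = 0
  nrm_add_le : ∀ m, ∀ x ∈ S.lev m, ∀ y ∈ S.lev m, S.nrm m (x + y) ≤ S.nrm m x + S.nrm m y
  nrm_smul : ∀ m, ∀ (c : ℝ), ∀ x ∈ S.lev m, S.nrm m (c • x) = |c| * S.nrm m x
  dense : ∀ m, ∀ x ∈ S.lev m, ∀ ε > 0, ∃ y, (∀ i, y ∈ S.lev i) ∧ S.nrm m (x - y) < ε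

variable {S : ScScale E} {T : ScScale F}

theorem ScScale.IsNested.lev_le (hS : S.IsNested) {i j : ℕ} (h : i ≤ j) : S.lev j ≤ S.lev i := by
  induction h with
  | refl => exact le_rfl
  | step _ ih => exact (hS.lev_succ_le _).trans ih

theorem ScScale.IsNested.nrm_le (hS : S.IsNested) {i j : ℕ} (h : i ≤ j) :
    ∃ K : ℝ, 0 < K ∧ ∀ x ∈ S.lev j, S.nrm i x ≤ K * S.nrm j x := by
  induction h with
  | refl => exact ⟨1, one_pos, fun x _ => by simp⟩
  | @step j hij ih =>
    obtain ⟨K, hK, h⟩ := ih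
    obtain ⟨K', h'⟩ := hS.nrm_le_succ j
    refine ⟨K * (|K'| + 1), by positivity, fun x hx => (h x (hS.lev_succ_le _ hx)).trans ?_⟩
    have h0 := hS.nrm_nonneg _ x hx
    have := h' x hx
    have h2 : K' * S.nrm (j + 1) x ≤ (|K'| + 1) * S.nrm (j + 1) x :=
      mul_le_mul_of_nonneg_right (by linarith [le_abs_self K']) h0
    rw [mul_assoc]
    exact mul_le_mul_of_nonneg_left (this.trans h2) hK.le

theorem ScScale.IsNested.shift (hS : S.IsNested) (k : ℕ) : (S.shift k).IsNested where
  lev_succ_le m := hS.lev_le (by omega)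
  nrm_nonneg m x hx := hS.nrm_nonneg _ x hx
  nrm_le_succ m := by
    obtain ⟨K, -, h⟩ := hS.nrm_le (show m + k ≤ m + 1 + k by omega)
    exact ⟨K, h⟩

theorem ScScale.IsNested.prod (hS : S.IsNested) (hT : T.IsNested) : (S.prod T).IsNested where
  lev_succ_le m := Submodule.prod_mono (hS.lev_succ_le m) (hT.lev_succ_le m)
  nrm_nonneg m x hx := le_max_of_le_left (hS.nrm_nonneg m _ hx.1)
  nrm_le_succ m := by
    obtain ⟨K, hK, h⟩ := hS.nrm_le (Nat.le_succ m)
    obtain ⟨K', hK', h'⟩ := hT.nrm_le (Nat.le_succ m)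
    refine ⟨max K K', fun x hx => max_le ((h _ hx.1).trans ?_) ((h' _ hx.2).trans ?_)⟩
    · exact mul_le_mul (le_max_left _ _) (le_max_left _ _) (hS.nrm_nonneg _ _ hx.1)
        (le_max_of_le_left hK.le)
    · exact mul_le_mul (le_max_right _ _) (le_max_right _ _) (hT.nrm_nonneg _ _ hx.2)
        (le_max_of_le_left hK.le)

theorem ScScale.IsNested.tangent (hS : S.IsNested) : S.tangent.IsNested := (hS.shift 1).prod hS

theorem isNested_constScale (G : Type v) [NormedAddCommGroup G] [NormedSpace ℝ G] :
    (constScale G).IsNested where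
  lev_succ_le _ := le_rfl
  nrm_nonneg _ x _ := norm_nonneg x
  nrm_le_succ _ := ⟨1, fun x _ => by simp [constScale]⟩

theorem isTame_constScale (G : Type v) [NormedAddCommGroup G] [NormedSpace ℝ G] :
    (constScale G).IsTame where
  toIsNested := isNested_constScale G
  eq_zero _ x _ h := norm_eq_zero.1 h
  nrm_add_le _ x _ y _ := norm_add_le x y
  nrm_smul _ c x _ := norm_smul c x
  dense _ x _ ε hε := ⟨x, fun _ => trivial, by simpa [constScale] using hε⟩

theorem ScScale.IsTame.shift (hS : S.IsTame) (k : ℕ) : (S.shift k).IsTame where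
  toIsNested := hS.toIsNested.shift k
  eq_zero m := hS.eq_zero _
  nrm_add_le m := hS.nrm_add_le _
  nrm_smul m := hS.nrm_smul _
  dense m x hx ε hε := by
    obtain ⟨y, hy, h⟩ := hS.dense _ x hx ε hε
    exact ⟨y, fun i => hy _, h⟩

theorem ScScale.IsTame.prod (hS : S.IsTame) (hT : T.IsTame) : (S.prod T).IsTame where
  toIsNested := hS.toIsNested.prod hT.toIsNested
  eq_zero m x hx h := by
    have h1 : S.nrm m x.1 ≤ 0 := (le_max_left _ _).trans h.le
    have h2 : T.nrm m x.2 ≤ 0 := (le_max_right _ _).trans h.le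
    exact Prod.ext (hS.eq_zero m _ hx.1 (h1.antisymm (hS.nrm_nonneg _ _ hx.1)))
      (hT.eq_zero m _ hx.2 (h2.antisymm (hT.nrm_nonneg _ _ hx.2)))
  nrm_add_le m x hx y hy := max_le
    ((hS.nrm_add_le m _ hx.1 _ hy.1).trans (add_le_add (le_max_left _ _) (le_max_left _ _)))
    ((hT.nrm_add_le m _ hx.2 _ hy.2).trans (add_le_add (le_max_right _ _) (le_max_right _ _)))
  nrm_smul m c x hx := by
    change max (S.nrm m (c • x.1)) (T.nrm m (c • x.2)) = _
    rw [hS.nrm_smul m c _ hx.1, hT.nrm_smul m c _ hx.2, ← mul_max_of_nonneg _ _ (abs_nonneg c)]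
    rfl
  dense m x hx ε hε := by
    obtain ⟨y, hy, h⟩ := hS.dense m x.1 hx.1 ε hε
    obtain ⟨z, hz, h'⟩ := hT.dense m x.2 hx.2 ε hε
    exact ⟨(y, z), fun i => ⟨hy i, hz i⟩, max_lt h h'⟩

theorem ScScale.IsTame.tangent (hS : S.IsTame) : S.tangent.IsTame := (hS.shift 1).prod hS

theorem ScScale.IsTame.nrm_zero (hS : S.IsTame) (m : ℕ) : S.nrm m 0 = 0 := by
  simpa using hS.nrm_smul m 0 0 (zero_mem _)

theorem ScScale.IsTame.nrm_neg (hS : S.IsTame) (m : ℕ) {x : E} (hx : x ∈ S.lev m) :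
    S.nrm m (-x) = S.nrm m x := by
  simpa using hS.nrm_smul m (-1) x hx

theorem ScScale.IsTame.nrm_sub_le (hS : S.IsTame) (m : ℕ) {x y : E} (hx : x ∈ S.lev m)
    (hy : y ∈ S.lev m) : S.nrm m (x - y) ≤ S.nrm m x + S.nrm m y := by
  have := hS.nrm_add_le m x hx (-y) (neg_mem hy)
  rwa [hS.nrm_neg m hy, ← sub_eq_add_neg] at this

/-- The tangent bundle of the whole space `E_0` is the whole space `(TE)_0`. -/
theorem tangentSet_lev_zero (hS : S.IsNested) :
    tangentSet S (S.lev 0 : Set E) = (S.tangent.lev 0 : Set (E × E)) := by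
  ext q
  constructor
  · rintro ⟨-, h1, h2⟩
    exact ⟨h1, h2⟩
  · rintro ⟨h1, h2⟩
    exact ⟨hS.lev_le zero_le_one h1, h1, h2⟩

end Nested

/-! ### Uniqueness of the sc-derivative -/

section Deriv

variable {E : Type u} [AddCommGroup E] [Module ℝ E] {F : Type v} [AddCommGroup F] [Module ℝ F]
  {S : ScScale E} {T : ScScale F}

/-- Two bounded operators on `E_m` that agree on `E_∞` agree on `E_m`. -/
theorem eq_on_lev_of_eq_on_smooth (hS : S.IsTame) (hT : T.IsTame) {m : ℕ} {A B : E →ₗ[ℝ] F}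
    {K : ℝ} (hA : ∀ h ∈ S.lev m, A h ∈ T.lev 0 ∧ T.nrm 0 (A h) ≤ K * S.nrm m h) {K' : ℝ}
    (hB : ∀ h ∈ S.lev m, B h ∈ T.lev 0 ∧ T.nrm 0 (B h) ≤ K' * S.nrm m h)
    (h : ∀ v, (∀ i, v ∈ S.lev i) → A v = B v) : ∀ v ∈ S.lev m, A v = B v := by
  intro v hv
  rw [← sub_eq_zero]
  refine hT.eq_zero 0 _ (sub_mem (hA v hv).1 (hB v hv).1) ?_
  refine le_antisymm (le_of_forall_pos_le_add fun ε hε => ?_)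
    (hT.nrm_nonneg _ _ (sub_mem (hA v hv).1 (hB v hv).1))
  obtain ⟨w, hw, hvw⟩ := hS.dense m v hv (ε / (|K| + |K'| + 1)) (by positivity)
  have hm : v - w ∈ S.lev m := sub_mem hv (hw m)
  have e : A v - B v = A (v - w) - B (v - w) := by
    rw [map_sub, map_sub, h w hw]; abel
  rw [e, zero_add]
  refine (hT.nrm_sub_le 0 (hA _ hm).1 (hB _ hm).1).trans ?_
  have h0 := hS.nrm_nonneg m _ hm
  have h1 : K * S.nrm m (v - w) ≤ |K| * S.nrm m (v - w) :=
    mul_le_mul_of_nonneg_right (le_abs_self K) h0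
  have h2 : K' * S.nrm m (v - w) ≤ |K'| * S.nrm m (v - w) :=
    mul_le_mul_of_nonneg_right (le_abs_self K') h0
  rw [lt_div_iff₀ (by positivity)] at hvw
  nlinarith [(hA _ hm).2, (hB _ hm).2]

/-- The derivative along a line of a functional applied to an sc-differentiable map. -/
theorem HasScDerivAt.hasDerivAt_line (hS : S.IsTame) {G : Type*} [NormedAddCommGroup G]
    [NormedSpace ℝ G] {f : E → F} {U : Set E} {x : E} {A : E →ₗ[ℝ] F}
    (hA : HasScDerivAt S T f U x A) (π : F →ₗ[ℝ] G) {K : ℝ} (hK : 0 ≤ K)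
    (hπ : ∀ w ∈ T.lev 0, ‖π w‖ ≤ K * T.nrm 0 w) (hf : ∀ y ∈ U, f y ∈ T.lev 0) (hx : x ∈ U)
    {v : E} (hv : v ∈ S.lev 1) (hU : ∀ᶠ t : ℝ in nhds 0, x + t • v ∈ U) :
    HasDerivAt (fun t : ℝ => π (f (x + t • v))) (π (A v)) 0 := by
  rw [hasDerivAt_iff_isLittleO, Asymptotics.isLittleO_iff]
  intro c hc
  have h0 := hS.nrm_nonneg 1 v hv
  obtain ⟨d, hd, H⟩ := hA.2 (c / ((K + 1) * (S.nrm 1 v + 1))) (by positivity)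
  have hsmall : ∀ᶠ t : ℝ in nhds 0, S.nrm 1 (t • v) < d := by
    have : Filter.Tendsto (fun t : ℝ => |t| * S.nrm 1 v) (nhds 0) (nhds 0) := by
      have h : Continuous fun t : ℝ => |t| * S.nrm 1 v := by fun_prop
      simpa using h.tendsto 0
    filter_upwards [this.eventually (gt_mem_nhds hd)] with t ht
    rwa [hS.nrm_smul 1 t v hv]
  filter_upwards [hU, hsmall] with t hUt hst
  obtain ⟨K₀, hK₀⟩ := hA.1
  have h1 := H (t • v) (Submodule.smul_mem _ _ hv) hUt hst
  have e : π (f (x + t • v)) - π (f (x + (0 : ℝ) • v)) - (t - 0) • π (A v)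
      = π (f (x + t • v) - f x - A (t • v)) := by simp
  have hm : f (x + t • v) - f x - A (t • v) ∈ T.lev 0 :=
    sub_mem (sub_mem (hf _ hUt) (hf _ hx))
      ((hK₀ _ (Submodule.smul_mem _ _ (hS.lev_le zero_le_one hv))).1)
  rw [e, sub_zero, Real.norm_eq_abs]
  refine (hπ _ hm).trans ((mul_le_mul_of_nonneg_left h1 hK).trans ?_)
  rw [hS.nrm_smul 1 t v hv]
  have : K * (c / ((K + 1) * (S.nrm 1 v + 1)) * (|t| * S.nrm 1 v))
      = c * |t| * ((K / (K + 1)) * (S.nrm 1 v / (S.nrm 1 v + 1))) := by field_simp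
  rw [this]
  refine mul_le_of_le_one_right (by positivity) (mul_le_one₀ ?_ (by positivity) ?_)
  · exact (div_le_one (by positivity)).2 (by linarith)
  · exact (div_le_one (by positivity)).2 (by linarith)

/-- The sc-derivative at an interior point is unique on `E_0`. -/
theorem HasScDerivAt.unique (hS : S.IsTame) (hT : T.IsTame) {f : E → F} {U : Set E} {x : E}
    {A B : E →ₗ[ℝ] F} (hA : HasScDerivAt S T f U x A) (hB : HasScDerivAt S T f U x B)
    (hf : ∀ y ∈ U, f y ∈ T.lev 0) (hx : x ∈ U)
    (hU : ∃ d > 0, ∀ h, (∀ i, h ∈ S.lev i) → S.nrm 1 h < d → x + h ∈ U) :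
    ∀ v ∈ S.lev 0, A v = B v := by
  obtain ⟨K, hK⟩ := hA.1
  obtain ⟨K', hK'⟩ := hB.1
  refine eq_on_lev_of_eq_on_smooth hS hT hK hK' fun v hv => ?_
  rw [← sub_eq_zero]
  have hm : ∀ w, (∀ i, w ∈ S.lev i) → A w - B w ∈ T.lev 0 := fun w hw =>
    sub_mem (hK w (hw 0)).1 (hK' w (hw 0)).1
  refine hT.eq_zero 0 _ (hm v hv) (le_antisymm (le_of_forall_pos_le_add fun ε hε => ?_)
    (hT.nrm_nonneg _ _ (hm v hv)))
  have h0 := hS.nrm_nonneg 1 v (hv 1)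
  obtain ⟨d, hd, H⟩ := hA.2 (ε / (2 * (S.nrm 1 v + 1))) (by positivity)
  obtain ⟨d', hd', H'⟩ := hB.2 (ε / (2 * (S.nrm 1 v + 1))) (by positivity)
  obtain ⟨d'', hd'', HU⟩ := hU
  set e := min d (min d' d'')
  have he : 0 < e := lt_min hd (lt_min hd' hd'')
  set t := e / (2 * (S.nrm 1 v + 1))
  have ht : 0 < t := by positivity
  have htv : ∀ i, t • v ∈ S.lev i := fun i => Submodule.smul_mem _ _ (hv i)
  have hn : S.nrm 1 (t • v) = t * S.nrm 1 v := by
    rw [hS.nrm_smul 1 t v (hv 1), abs_of_pos ht]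
  have hlt : S.nrm 1 (t • v) < e := by
    rw [hn]
    have : t * S.nrm 1 v = e * (S.nrm 1 v / (2 * (S.nrm 1 v + 1))) := by
      simp only [t]; field_simp
    rw [this]
    exact mul_lt_of_lt_one_right he ((div_lt_one (by positivity)).2 (by linarith))
  have hxU := HU _ htv (hlt.trans_le ((min_le_right _ _).trans (min_le_right _ _)))
  have h1 := H _ (htv 1) hxU (hlt.trans_le (min_le_left _ _))
  have h2 := H' _ (htv 1) hxU (hlt.trans_le ((min_le_right _ _).trans (min_le_left _ _)))
  have hf' : f (x + t • v) - f x ∈ T.lev 0 := sub_mem (hf _ hxU) (hf _ hx)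
  have e1 : A (t • v) - B (t • v) = (f (x + t • v) - f x - B (t • v))
      - (f (x + t • v) - f x - A (t • v)) := by abel
  have e2 : T.nrm 0 (A (t • v) - B (t • v)) = t * T.nrm 0 (A v - B v) := by
    rw [map_smul, map_smul, ← smul_sub, hT.nrm_smul 0 t _ (hm v hv), abs_of_pos ht]
  have h3 := hT.nrm_sub_le 0 (sub_mem hf' (hK' _ (htv 0)).1) (sub_mem hf' (hK _ (htv 0)).1)
  rw [← e1, e2] at h3
  have h4 : t * T.nrm 0 (A v - B v) ≤ t * ε := by
    refine (h3.trans (add_le_add h2 h1)).trans ?_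
    rw [hn]
    have : ε / (2 * (S.nrm 1 v + 1)) * (t * S.nrm 1 v)
        + ε / (2 * (S.nrm 1 v + 1)) * (t * S.nrm 1 v)
        = t * ε * (S.nrm 1 v / (S.nrm 1 v + 1)) := by field_simp; ring
    rw [this]
    exact mul_le_of_le_one_right (by positivity) ((div_le_one (by positivity)).2 (by linarith))
  rw [zero_add]
  exact le_of_mul_le_mul_left h4 ht

end Deriv

/-! ### A criterion for sc-smoothness -/

section Smooth

variable {E : Type u} [AddCommGroup E] [Module ℝ E] {F : Type v} [AddCommGroup F] [Module ℝ F]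

/-- In an `E_j`-neighbourhood of `x`, the map `f` is the sum of the linear map `A` and of a map that
factors through a smooth map `g` of normed spaces, by operators `l` bounded on `E_0` and `L` bounded
into every `F_m`. -/
def FactorsSmoothlyAt (S : ScScale E) (T : ScScale F) (j : ℕ) (f : E → F) (A : E →ₗ[ℝ] F)
    (x : E) : Prop :=
  ∃ (V V' : Type) (_ : NormedAddCommGroup V) (_ : NormedSpace ℝ V) (_ : NormedAddCommGroup V')
    (_ : NormedSpace ℝ V') (l : E →ₗ[ℝ] V) (g : V → V') (L : V' →ₗ[ℝ] F),
    ContDiff ℝ ∞ g ∧ (∃ K, 0 ≤ K ∧ ∀ h ∈ S.lev 0, ‖l h‖ ≤ K * S.nrm 0 h) ∧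
    (∀ m, ∃ K, 0 ≤ K ∧ ∀ v, L v ∈ T.lev m ∧ T.nrm m (L v) ≤ K * ‖v‖) ∧
    ∃ d > 0, ∀ y ∈ S.lev j, S.nrm j (y - x) < d → f y = A y + L (g (l y))

variable {S : ScScale E} {T : ScScale F} {f : E → F} {A : E →ₗ[ℝ] F}

theorem IsScOperator.exists_nonneg {L : E →ₗ[ℝ] F} (hL : IsScOperator S T L)
    (hS : S.IsNested) (m : ℕ) :
    ∃ K : ℝ, 0 ≤ K ∧ ∀ x ∈ S.lev m, L x ∈ T.lev m ∧ T.nrm m (L x) ≤ K * S.nrm m x := by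
  obtain ⟨K, hK⟩ := hL m
  exact ⟨|K|, abs_nonneg K, fun x hx => ⟨(hK x hx).1, (hK x hx).2.trans
    (mul_le_mul_of_nonneg_right (le_abs_self K) (hS.nrm_nonneg m x hx))⟩⟩

theorem FactorsSmoothlyAt.of_le (hS : S.IsNested) {i j : ℕ} (hij : i ≤ j) {x : E}
    (hx : x ∈ S.lev j) (h : FactorsSmoothlyAt S T i f A x) : FactorsSmoothlyAt S T j f A x := by
  obtain ⟨V, V', _, _, _, _, l, g, L, hg, hl, hL, d, hd, H⟩ := h
  obtain ⟨K, hK, hle⟩ := hS.nrm_le hij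
  refine ⟨V, V', _, _, _, _, l, g, L, hg, hl, hL, d / K, by positivity, fun y hy hyx => ?_⟩
  refine H y (hS.lev_le hij hy) ((hle _ (sub_mem hy hx)).trans_lt ?_)
  rw [lt_div_iff₀ hK] at hyx
  linarith

/-- A map that factors smoothly near `x` in `E_j` is continuous at `x` at every level `m ≥ j`. -/
theorem FactorsSmoothlyAt.continuousAt_lev (hS : S.IsTame) (hT : T.IsTame)
    (hA : IsScOperator S T A) {m : ℕ} {x : E} (hx : x ∈ S.lev m)
    (h : FactorsSmoothlyAt S T m f A x) :
    f x ∈ T.lev m ∧ ∀ ε > 0, ∃ d > 0, ∀ y ∈ S.lev m, S.nrm m (y - x) < d →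
      T.nrm m (f y - f x) < ε := by
  obtain ⟨V, V', _, _, _, _, l, g, L, hg, ⟨K, hK, hl⟩, hL, d, hd, H⟩ := h
  obtain ⟨KA, hKA, hA⟩ := hA.exists_nonneg hS.toIsNested m
  obtain ⟨KL, hKL, hL⟩ := hL m
  obtain ⟨K₀, hK₀, hle⟩ := hS.nrm_le (Nat.zero_le m)
  have hfx : f x = A x + L (g (l x)) := H x hx (by rw [sub_self, hS.nrm_zero]; exact hd)
  refine ⟨hfx ▸ add_mem (hA x hx).1 (hL _).1, fun ε hε => ?_⟩
  obtain ⟨d₁, hd₁, hg₁⟩ := Metric.continuousAt_iff.1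
    (hg.continuous.continuousAt (x := l x)) (ε / (2 * (KL + 1))) (by positivity)
  refine ⟨min d (min (ε / (2 * (KA + 1))) (d₁ / ((K + 1) * K₀))), by positivity,
    fun y hy hyx => ?_⟩
  have h1 := hyx.trans_le (min_le_left _ _)
  have h2 := hyx.trans_le ((min_le_right _ _).trans (min_le_left _ _))
  have h3 := hyx.trans_le ((min_le_right _ _).trans (min_le_right _ _))
  have hm : y - x ∈ S.lev m := sub_mem hy hx
  have h0 := hS.nrm_nonneg m _ hm
  have h00 := hS.nrm_nonneg 0 _ (hS.lev_le (Nat.zero_le m) hm)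
  have hdist : dist (l y) (l x) < d₁ := by
    rw [dist_eq_norm, ← map_sub]
    refine (hl _ (hS.lev_le (Nat.zero_le m) hm)).trans_lt ?_
    rw [lt_div_iff₀ (by positivity)] at h3
    nlinarith [hle _ hm, mul_le_mul_of_nonneg_left (hle _ hm) hK]
  have h4 := hg₁ hdist
  rw [dist_eq_norm, lt_div_iff₀ (by positivity)] at h4
  rw [lt_div_iff₀ (by positivity)] at h2
  have e : f y - f x = A (y - x) + L (g (l y) - g (l x)) := by
    rw [H y hy h1, hfx, map_sub, map_sub]; abel
  rw [e]
  refine (hT.nrm_add_le m _ (hA _ hm).1 _ (hL _).1).trans_lt ?_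
  have h5 := (hL (g (l y) - g (l x))).2
  have h6 := (hA _ hm).2
  nlinarith [norm_nonneg (g (l y) - g (l x))]

/-- The derivative of a map at a point near which it factors smoothly. -/
theorem hasScDerivAt_of_factors (hS : S.IsTame) (hA : IsScOperator S T A)
    (hT : T.IsTame) {V V' : Type} [NormedAddCommGroup V] [NormedSpace ℝ V]
    [NormedAddCommGroup V'] [NormedSpace ℝ V'] {l : E →ₗ[ℝ] V} {g : V → V'} {L : V' →ₗ[ℝ] F}
    (hg : ContDiff ℝ ∞ g) (hl : ∃ K, 0 ≤ K ∧ ∀ h ∈ S.lev 0, ‖l h‖ ≤ K * S.nrm 0 h)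
    (hL : ∀ m, ∃ K, 0 ≤ K ∧ ∀ v, L v ∈ T.lev m ∧ T.nrm m (L v) ≤ K * ‖v‖)
    {x : E} {d : ℝ} (H : ∀ y ∈ S.lev 1, S.nrm 1 (y - x) < d → f y = A y + L (g (l y)))
    (hx : x ∈ S.lev 1) {y : E} (hy : y ∈ S.lev 1) (hyx : S.nrm 1 (y - x) < d) :
    HasScDerivAt S T f (S.lev 0) y
      (A + L ∘ₗ (fderiv ℝ g (l y)).toLinearMap ∘ₗ l) := by
  obtain ⟨K, hK, hl⟩ := hl
  obtain ⟨KA, hKA, hA⟩ := hA.exists_nonneg hS.toIsNested 0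
  obtain ⟨KL, hKL, hL⟩ := hL 0
  refine ⟨⟨KA + KL * (‖fderiv ℝ g (l y)‖ * K), fun h hh => ⟨add_mem (hA h hh).1 (hL _).1, ?_⟩⟩, ?_⟩
  · refine (hT.nrm_add_le 0 _ (hA h hh).1 _ (hL _).1).trans ?_
    rw [add_mul]
    refine add_le_add (hA h hh).2 ((hL _).2.trans ?_)
    rw [mul_assoc, mul_assoc]
    refine mul_le_mul_of_nonneg_left ?_ hKL
    exact (ContinuousLinearMap.le_opNorm _ _).trans
      (mul_le_mul_of_nonneg_left (hl h hh) (norm_nonneg _))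
  · intro ε hε
    obtain ⟨K₀, hK₀, hle⟩ := hS.nrm_le zero_le_one
    have hfd : HasFDerivAt g (fderiv ℝ g (l y)) (l y) :=
      (hg.differentiable (by simp) (l y)).hasFDerivAt
    rw [hasFDerivAt_iff_isLittleO_nhds_zero, Asymptotics.isLittleO_iff] at hfd
    have h1 := hfd (c := ε / ((KL + 1) * (K + 1) * K₀)) (by positivity)
    obtain ⟨d₁, hd₁, h1⟩ := Metric.eventually_nhds_iff.1 h1
    refine ⟨min (d - S.nrm 1 (y - x)) (d₁ / ((K + 1) * K₀)),
      lt_min (by linarith) (by positivity), fun h hh _ hhd => ?_⟩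
    have h0 := hS.nrm_nonneg 1 h hh
    have h00 := hS.nrm_nonneg 0 h (hS.lev_le zero_le_one hh)
    have h2 := hhd.trans_le (min_le_left _ _)
    have h3 := hhd.trans_le (min_le_right _ _)
    have hln := hl h (hS.lev_le zero_le_one hh)
    have hle' := hle h hh
    have hlh : ‖l h‖ ≤ (K + 1) * K₀ * S.nrm 1 h := by
      nlinarith [mul_le_mul_of_nonneg_left hle' hK]
    have h4 := h1 (y := l h) (by
      rw [dist_zero_right]
      rw [lt_div_iff₀ (by positivity)] at h3
      linarith)
    have hyh : f (y + h) = A (y + h) + L (g (l (y + h))) := by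
      refine H _ (add_mem hy hh) ?_
      have : y + h - x = (y - x) + h := by abel
      rw [this]
      exact (hS.nrm_add_le 1 _ (sub_mem hy hx) _ hh).trans_lt (by linarith)
    have e : f (y + h) - f y - (A + L ∘ₗ (fderiv ℝ g (l y)).toLinearMap ∘ₗ l) h
        = L (g (l y + l h) - g (l y) - fderiv ℝ g (l y) (l h)) := by
      rw [hyh, H y hy hyx]
      simp only [map_add, map_sub, LinearMap.add_apply, LinearMap.comp_apply,
        ContinuousLinearMap.coe_coe]
      abel
    rw [e]
    refine (hL _).2.trans ?_
    calc KL * ‖g (l y + l h) - g (l y) - fderiv ℝ g (l y) (l h)‖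
        ≤ KL * (ε / ((KL + 1) * (K + 1) * K₀) * ((K + 1) * K₀ * S.nrm 1 h)) := by
          refine mul_le_mul_of_nonneg_left (h4.trans ?_) hKL
          exact mul_le_mul_of_nonneg_left hlh (by positivity)
      _ = (KL / (KL + 1)) * (ε * S.nrm 1 h) := by field_simp
      _ ≤ ε * S.nrm 1 h := mul_le_of_le_one_left (by positivity)
          ((div_le_one (by positivity)).2 (by linarith))

theorem IsScOperator.prodMap {E' : Type*} [AddCommGroup E'] [Module ℝ E'] {F' : Type*}
    [AddCommGroup F'] [Module ℝ F'] {S' : ScScale E'} {T' : ScScale F'} {B : E' →ₗ[ℝ] F'}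
    (hS : S.IsNested) (hS' : S'.IsNested)
    (hA : IsScOperator S T A) (hB : IsScOperator S' T' B) :
    IsScOperator (S.prod S') (T.prod T') (A.prodMap B) := by
  intro m
  obtain ⟨K, hK, h⟩ := hA.exists_nonneg hS m
  obtain ⟨K', hK', h'⟩ := hB.exists_nonneg hS' m
  refine ⟨max K K', fun x hx => ⟨⟨(h _ hx.1).1, (h' _ hx.2).1⟩, max_le ?_ ?_⟩⟩
  · exact (h _ hx.1).2.trans (mul_le_mul (le_max_left _ _) (le_max_left _ _)
      (hS.nrm_nonneg _ _ hx.1) (le_max_of_le_left hK))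
  · exact (h' _ hx.2).2.trans (mul_le_mul (le_max_right _ _) (le_max_right _ _)
      (hS'.nrm_nonneg _ _ hx.2) (le_max_of_le_left hK))

theorem IsScOperator.tangent (hS : S.IsNested) (hA : IsScOperator S T A) :
    IsScOperator S.tangent T.tangent (A.prodMap A) :=
  IsScOperator.prodMap (hS.shift 1) hS (fun m => hA (m + 1)) hA

/-- If `f` factors smoothly near every point of `E_1`, its tangent map factors smoothly near every
point of `(TE)_0`. -/
theorem FactorsSmoothlyAt.tangent (hS : S.IsTame) (hT : T.IsTame) (hA : IsScOperator S T A)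
    (hf0 : ∀ x ∈ S.lev 0, f x ∈ T.lev 0) {Df : E → E →ₗ[ℝ] F}
    (hDf : ∀ x ∈ S.lev 1, HasScDerivAt S T f (S.lev 0) x (Df x)) {q : E × E}
    (hq : q ∈ S.tangent.lev 0) (h : FactorsSmoothlyAt S T 1 f A q.1) :
    FactorsSmoothlyAt S.tangent T.tangent 0 (fun q => (f q.1, Df q.1 q.2)) (A.prodMap A) q := by
  obtain ⟨V, V', _, _, _, _, l, g, L, hg, hl, hL, d, hd, H⟩ := h
  obtain ⟨K, hK, hl'⟩ := hl
  obtain ⟨K₁, hK₁, hle⟩ := hS.nrm_le zero_le_one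
  refine ⟨V × V, V' × V', _, inferInstance, _, inferInstance, l.prodMap l,
    fun v => (g v.1, fderiv ℝ g v.1 v.2), L.prodMap L, ?_, ⟨K * K₁ + K, by positivity, ?_⟩, ?_,
    d, hd, ?_⟩
  · exact (hg.comp contDiff_fst).prodMk
      (((hg.fderiv_right (m := ∞) (by simp)).comp contDiff_fst).clm_apply contDiff_snd)
  · intro h hh
    have h0 := hS.nrm_nonneg 1 _ hh.1
    have h0' := hS.nrm_nonneg 0 _ hh.2
    have e : S.tangent.nrm 0 h = max (S.nrm 1 h.1) (S.nrm 0 h.2) := rfl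
    have h1 : S.nrm 1 h.1 ≤ S.tangent.nrm 0 h := e ▸ le_max_left _ _
    have h2 : S.nrm 0 h.2 ≤ S.tangent.nrm 0 h := e ▸ le_max_right _ _
    have h3 := hl' h.1 (hS.lev_le zero_le_one hh.1)
    have h4 := hl' h.2 hh.2
    have h5 := mul_le_mul_of_nonneg_left (hle _ hh.1) hK
    have h6 := mul_le_mul_of_nonneg_left h1 (mul_nonneg hK hK₁.le)
    have h7 := mul_le_mul_of_nonneg_left h2 hK
    have h8 : 0 ≤ S.tangent.nrm 0 h := h0.trans h1
    have h9 := mul_nonneg (mul_nonneg hK hK₁.le) h8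
    have h10 := mul_nonneg hK h8
    exact max_le (by change ‖l h.1‖ ≤ _; linarith) (by change ‖l h.2‖ ≤ _; linarith)
  · intro m
    obtain ⟨C, hC, h1⟩ := hL (m + 1)
    obtain ⟨C', hC', h2⟩ := hL m
    refine ⟨max C C', le_max_of_le_left hC, fun v => ⟨⟨(h1 _).1, (h2 _).1⟩, max_le ?_ ?_⟩⟩
    · exact (h1 v.1).2.trans (mul_le_mul (le_max_left _ _) (norm_fst_le v) (norm_nonneg _)
        (le_max_of_le_left hC))
    · exact (h2 v.2).2.trans (mul_le_mul (le_max_right _ _) (norm_snd_le v) (norm_nonneg _)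
        (le_max_of_le_left hC))
  · intro y hy hyq
    have hy1 : S.nrm 1 (y.1 - q.1) < d := (le_max_left _ _).trans_lt hyq
    have hD := hasScDerivAt_of_factors hS hA hT hg ⟨K, hK, hl'⟩ hL H hq.1 hy.1 hy1
    have hu := (hDf y.1 hy.1).unique hS hT hD (fun z hz => hf0 z hz)
      (hS.lev_le zero_le_one hy.1)
      ⟨1, one_pos, fun h hh _ => add_mem (hS.lev_le zero_le_one hy.1) (hh 0)⟩ y.2 hy.2
    refine Prod.ext (H y.1 hy.1 hy1) ?_
    change Df y.1 y.2 = A y.2 + L (fderiv ℝ g (l y.1) (l y.2))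
    rw [hu]
    rfl

/-- A map on `E_0` that is continuous at level `0` and factors smoothly near every point of `E_1`
is sc-smooth. -/
theorem isScSmooth_of_factors (hS : S.IsTame) (hT : T.IsTame) (hA : IsScOperator S T A)
    (h0 : ∀ x ∈ S.lev 0, f x ∈ T.lev 0 ∧ ∀ ε > 0, ∃ d > 0, ∀ y ∈ S.lev 0, S.nrm 0 (y - x) < d →
      T.nrm 0 (f y - f x) < ε)
    (h1 : ∀ x ∈ S.lev 1, FactorsSmoothlyAt S T 1 f A x) : IsScSmooth S T f (S.lev 0) := by
  intro k
  have hcont : ∀ {E : Type u} [AddCommGroup E] [Module ℝ E] {F : Type v} [AddCommGroup F]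
      [Module ℝ F] {S : ScScale E} {T : ScScale F} {f : E → F} {A : E →ₗ[ℝ] F}, S.IsTame →
      T.IsTame → IsScOperator S T A →
      (∀ x ∈ S.lev 0, f x ∈ T.lev 0 ∧ ∀ ε > 0, ∃ d > 0, ∀ y ∈ S.lev 0,
        S.nrm 0 (y - x) < d → T.nrm 0 (f y - f x) < ε) →
      (∀ x ∈ S.lev 1, FactorsSmoothlyAt S T 1 f A x) → ScCont S T f (S.lev 0) := by
    intro E _ _ F _ _ S T f A hS hT hA h0 h1 m x _ hx
    rcases Nat.eq_zero_or_pos m with rfl | hm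
    · obtain ⟨h, h'⟩ := h0 x hx
      refine ⟨h, fun ε hε => ?_⟩
      obtain ⟨d, hd, H⟩ := h' ε hε
      exact ⟨d, hd, fun y hy _ hyx => H y hy hyx⟩
    · have := (h1 x (hS.lev_le hm hx)).of_le hS.toIsNested hm hx
      obtain ⟨h, h'⟩ := this.continuousAt_lev hS hT hA hx
      refine ⟨h, fun ε hε => ?_⟩
      obtain ⟨d, hd, H⟩ := h' ε hε
      exact ⟨d, hd, fun y _ hy hyx => H y hy hyx⟩
  induction k generalizing E F S T f A with
  | zero => exact hcont hS hT hA h0 h1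
  | succ k ih =>
    have hex : ∀ x ∈ S.lev 1, ∃ B, HasScDerivAt S T f (S.lev 0) x B := by
      intro x hx
      obtain ⟨V, V', _, _, _, _, l, g, L, hg, hl, hL, d, hd, H⟩ := h1 x hx
      exact ⟨_, hasScDerivAt_of_factors hS hA hT hg hl hL H hx hx
        (by rw [sub_self, hS.nrm_zero]; exact hd)⟩
    choose! Df hDf using hex
    refine ⟨hcont hS hT hA h0 h1, Df, fun x _ hx => hDf x hx, ?_⟩
    rw [tangentSet_lev_zero hS.toIsNested]
    have hA' := hA.tangent hS.toIsNested
    have hfac : ∀ q ∈ S.tangent.lev 0, FactorsSmoothlyAt S.tangent T.tangent 0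
        (fun q => (f q.1, Df q.1 q.2)) (A.prodMap A) q := fun q hq =>
      FactorsSmoothlyAt.tangent hS hT hA (fun x hx => (h0 x hx).1) hDf hq (h1 q.1 hq.1)
    refine ih hS.tangent hT.tangent hA' (fun q hq => ?_) fun q hq => ?_
    · exact (hfac q hq).continuousAt_lev hS.tangent hT.tangent hA' hq
    · exact (hfac q (hS.tangent.lev_le zero_le_one hq)).of_le hS.tangent.toIsNested zero_le_one hq

/-- sc-operators are sc-smooth. -/
theorem IsScOperator.isScSmooth (hS : S.IsTame) (hT : T.IsTame) (hA : IsScOperator S T A) :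
    IsScSmooth S T A (S.lev 0) := by
  have h : ∀ x, FactorsSmoothlyAt S T 0 A A x := fun x =>
    ⟨ℝ, ℝ, _, inferInstance, _, inferInstance, 0, 0, 0, contDiff_const, ⟨0, le_rfl, by simp⟩,
      fun m => ⟨0, le_rfl, fun v => ⟨by simp, by simp [hT.nrm_zero]⟩⟩, 1, one_pos,
      fun y _ _ => by simp⟩
  exact isScSmooth_of_factors hS hT hA (fun x hx => (h x).continuousAt_lev hS hT hA hx)
    fun x hx => (h x).of_le hS.toIsNested zero_le_one hx

end Smooth

/-! ### Maps into normed spaces with the constant scale -/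

section ConstTarget

variable {E : Type u} [AddCommGroup E] [Module ℝ E]
  {G : Type v} [NormedAddCommGroup G] [NormedSpace ℝ G]
  {G' : Type w} [NormedAddCommGroup G'] [NormedSpace ℝ G']
  {S : ScScale E} {U : Set E}

theorem constScale_tangent (G : Type v) [NormedAddCommGroup G] [NormedSpace ℝ G] :
    (constScale G).tangent = constScale (G × G) := by
  simp only [ScScale.tangent, ScScale.shift, ScScale.prod, constScale, Submodule.prod_top]
  rfl

theorem isSc_one_const_iff {f : E → G} : IsSc 1 S (constScale G) f U ↔
    ScCont S (constScale G) f U ∧ ∃ Df : E → E →ₗ[ℝ] G,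
      (∀ x ∈ U, x ∈ S.lev 1 → HasScDerivAt S (constScale G) f U x (Df x)) ∧
      ScCont S.tangent (constScale (G × G)) (fun q => (f q.1, Df q.1 q.2)) (tangentSet S U) := by
  rw [← constScale_tangent]
  exact Iff.rfl

theorem ScCont.prodMk {f : E → G} {g : E → G'} (hf : ScCont S (constScale G) f U)
    (hg : ScCont S (constScale G') g U) :
    ScCont S (constScale (G × G')) (fun x => (f x, g x)) U := by
  intro m x hx hxm
  refine ⟨trivial, fun ε hε => ?_⟩
  obtain ⟨d, hd, H⟩ := (hf m x hx hxm).2 ε hε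
  obtain ⟨d', hd', H'⟩ := (hg m x hx hxm).2 ε hε
  exact ⟨min d d', lt_min hd hd', fun y hy hym h => max_lt
    (H y hy hym (h.trans_le (min_le_left _ _))) (H' y hy hym (h.trans_le (min_le_right _ _)))⟩

theorem ScCont.continuous_comp {f : E → G} (hf : ScCont S (constScale G) f U) {g : G → G'}
    (hg : Continuous g) : ScCont S (constScale G') (fun x => g (f x)) U := by
  intro m x hx hxm
  refine ⟨trivial, fun ε hε => ?_⟩
  obtain ⟨δ, hδ, h⟩ := Metric.continuousAt_iff.1 (hg.continuousAt (x := f x)) ε hε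
  obtain ⟨d, hd, H⟩ := (hf m x hx hxm).2 δ hδ
  refine ⟨d, hd, fun y hy hym hyx => ?_⟩
  have := h (x := f y) (by rw [dist_eq_norm]; exact H y hy hym hyx)
  rwa [dist_eq_norm] at this

theorem HasScDerivAt.add {f g : E → G} {x : E} {A B : E →ₗ[ℝ] G}
    (hf : HasScDerivAt S (constScale G) f U x A) (hg : HasScDerivAt S (constScale G) g U x B) :
    HasScDerivAt S (constScale G) (fun x => f x + g x) U x (A + B) := by
  obtain ⟨⟨K, hK⟩, hf⟩ := hf
  obtain ⟨⟨K', hK'⟩, hg⟩ := hg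
  refine ⟨⟨K + K', fun h hh => ⟨trivial, ?_⟩⟩, fun ε hε => ?_⟩
  · rw [add_mul]
    exact (norm_add_le _ _).trans (add_le_add (hK h hh).2 (hK' h hh).2)
  · obtain ⟨d, hd, H⟩ := hf (ε / 2) (by positivity)
    obtain ⟨d', hd', H'⟩ := hg (ε / 2) (by positivity)
    refine ⟨min d d', lt_min hd hd', fun h hh hU hlt => ?_⟩
    have h1 := H h hh hU (hlt.trans_le (min_le_left _ _))
    have h2 := H' h hh hU (hlt.trans_le (min_le_right _ _))
    have e : f (x + h) + g (x + h) - (f x + g x) - (A + B) h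
        = (f (x + h) - f x - A h) + (g (x + h) - g x - B h) := by
      rw [LinearMap.add_apply]; abel
    change ‖_‖ ≤ _
    rw [e]
    refine (norm_add_le _ _).trans ((add_le_add h1 h2).trans (le_of_eq ?_))
    ring

theorem HasScDerivAt.clm_comp {f : E → G} {x : E} {A : E →ₗ[ℝ] G} (L : G →L[ℝ] G')
    (hf : HasScDerivAt S (constScale G) f U x A) :
    HasScDerivAt S (constScale G') (fun x => L (f x)) U x (L.toLinearMap ∘ₗ A) := by
  obtain ⟨⟨K, hK⟩, hf⟩ := hf
  refine ⟨⟨‖L‖ * K, fun h hh => ⟨trivial, ?_⟩⟩, fun ε hε => ?_⟩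
  · rw [mul_assoc]
    exact (L.le_opNorm _).trans (mul_le_mul_of_nonneg_left (hK h hh).2 (norm_nonneg _))
  · obtain ⟨d, hd, H⟩ := hf (ε / (‖L‖ + 1)) (by positivity)
    refine ⟨d, hd, fun h hh hU hlt => ?_⟩
    have h1 : ‖f (x + h) - f x - A h‖ ≤ ε / (‖L‖ + 1) * S.nrm 1 h := H h hh hU hlt
    have e : L (f (x + h)) - L (f x) - (L.toLinearMap ∘ₗ A) h = L (f (x + h) - f x - A h) := by
      simp
    change ‖_‖ ≤ _
    rw [e]
    refine (L.le_opNorm _).trans ((mul_le_mul_of_nonneg_left h1 (norm_nonneg _)).trans ?_)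
    have h2 : 0 ≤ ε * S.nrm 1 h := by
      have := (norm_nonneg _).trans h1
      rw [div_mul_eq_mul_div, le_div_iff₀ (by positivity), zero_mul] at this
      exact this
    have : ‖L‖ * (ε / (‖L‖ + 1) * S.nrm 1 h) = (‖L‖ / (‖L‖ + 1)) * (ε * S.nrm 1 h) := by
      field_simp
    rw [this]
    exact mul_le_of_le_one_left h2 ((div_le_one (by positivity)).2 (by linarith))

theorem IsSc.add {f g : E → G} (hf : IsSc 1 S (constScale G) f U)
    (hg : IsSc 1 S (constScale G) g U) : IsSc 1 S (constScale G) (fun x => f x + g x) U := by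
  rw [isSc_one_const_iff] at *
  obtain ⟨hf, Df, hDf, hTf⟩ := hf
  obtain ⟨hg, Dg, hDg, hTg⟩ := hg
  refine ⟨(hf.prodMk hg).continuous_comp continuous_add, fun x => Df x + Dg x,
    fun x hx h1 => (hDf x hx h1).add (hDg x hx h1), ?_⟩
  exact (hTf.prodMk hTg).continuous_comp continuous_add

theorem IsSc.clm_comp {f : E → G} (L : G →L[ℝ] G') (hf : IsSc 1 S (constScale G) f U) :
    IsSc 1 S (constScale G') (fun x => L (f x)) U := by
  rw [isSc_one_const_iff] at *
  obtain ⟨hf, Df, hDf, hTf⟩ := hf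
  exact ⟨hf.continuous_comp L.continuous, fun x => L.toLinearMap ∘ₗ Df x,
    fun x hx h1 => (hDf x hx h1).clm_comp L, hTf.continuous_comp (L.prodMap L).continuous⟩

/-- The norms of the higher levels dominate those of the lower ones, so a map into a constant scale
has to be examined only at the lowest level. -/
theorem scCont_of_level_zero (hS : S.IsNested) {f : E → G}
    (h : ∀ x ∈ U, x ∈ S.lev 0 → ∀ ε > 0, ∃ d > 0, ∀ y ∈ U, y ∈ S.lev 0 → S.nrm 0 (y - x) < d →
      ‖f y - f x‖ < ε) : ScCont S (constScale G) f U := by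
  intro m x hx hxm
  refine ⟨trivial, fun ε hε => ?_⟩
  obtain ⟨d, hd, H⟩ := h x hx (hS.lev_le (Nat.zero_le m) hxm) ε hε
  obtain ⟨K, hK, hle⟩ := hS.nrm_le (Nat.zero_le m)
  refine ⟨d / K, by positivity, fun y hy hym hyx => H y hy (hS.lev_le (Nat.zero_le m) hym)
    ((hle _ (sub_mem hym hxm)).trans_lt ?_)⟩
  rw [lt_div_iff₀ hK] at hyx
  linarith

theorem isSc_one_of_level_zero (hS : S.IsNested) {f : E → G} {Df : E → E →ₗ[ℝ] G}
    (hc : ∀ x ∈ U, x ∈ S.lev 0 → ∀ ε > 0, ∃ d > 0, ∀ y ∈ U, y ∈ S.lev 0 → S.nrm 0 (y - x) < d →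
      ‖f y - f x‖ < ε)
    (hD : ∀ x ∈ U, x ∈ S.lev 1 → HasScDerivAt S (constScale G) f U x (Df x))
    (hT : ∀ q ∈ tangentSet S U, ∀ ε > 0, ∃ d > 0, ∀ q' ∈ tangentSet S U,
      S.nrm 1 (q'.1 - q.1) < d → S.nrm 0 (q'.2 - q.2) < d →
      ‖Df q'.1 q'.2 - Df q.1 q.2‖ < ε) : IsSc 1 S (constScale G) f U := by
  rw [isSc_one_const_iff]
  refine ⟨scCont_of_level_zero hS hc, Df, hD, ScCont.prodMk ?_ ?_⟩
  · refine scCont_of_level_zero hS.tangent fun q hq hq0 ε hε => ?_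
    obtain ⟨d, hd, H⟩ := hc q.1 hq.1 (hS.lev_le zero_le_one hq.2.1) ε hε
    obtain ⟨K, hK, hle⟩ := hS.nrm_le zero_le_one
    refine ⟨d / K, by positivity, fun y hy hy0 hyq => H _ hy.1 (hS.lev_le zero_le_one hy.2.1)
      ((hle _ (sub_mem hy.2.1 hq.2.1)).trans_lt ?_)⟩
    have h1 : S.nrm 1 (y.1 - q.1) < d / K := (le_max_left _ _).trans_lt hyq
    rw [lt_div_iff₀ hK] at h1
    linarith
  · refine scCont_of_level_zero hS.tangent fun q hq hq0 ε hε => ?_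
    obtain ⟨d, hd, H⟩ := hT q hq ε hε
    exact ⟨d, hd, fun y hy _ hyq => H y hy ((le_max_left _ _).trans_lt hyq)
      ((le_max_right _ _).trans_lt hyq)⟩

end ConstTarget

/-! ### sc-holomorphic maps -/

section Pull

variable {E : Type u} {U : Set E} {r : E → E}

theorem pull_apply {G : Type v} [Zero G] (g : E → G) {x : E} (hx : x ∈ U) :
    pull U r (fun p : ↥(r '' U) => g p.1) x = g (r x) :=
  Subtype.val_injective.extend_apply (fun p : ↥(r '' U) => g p.1) _ ⟨r x, x, hx, rfl⟩

theorem pull_comp {G : Type v} {G' : Type w} [Zero G] [Zero G'] (f : ↥(r '' U) → G) {L : G → G'}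
    (hL : L 0 = 0) : pull U r (fun p => L (f p)) = fun x => L (pull U r f x) := by
  funext x
  by_cases h : ∃ p : ↥(r '' U), p.1 = r x
  · obtain ⟨p, hp⟩ := h
    simp only [pull, ← hp, Subtype.val_injective.extend_apply]
  · simp only [pull, Function.extend_apply' _ _ _ h, hL]

theorem pull_add {G : Type v} [AddZeroClass G] (f g : ↥(r '' U) → G) :
    pull U r (fun p => f p + g p) = fun x => pull U r f x + pull U r g x := by
  funext x
  by_cases h : ∃ p : ↥(r '' U), p.1 = r x
  · obtain ⟨p, hp⟩ := h
    simp only [pull, ← hp, Subtype.val_injective.extend_apply]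
  · simp only [pull, Function.extend_apply' _ _ _ h, add_zero]

end Pull

section Holomorphic

variable {E : Type u} [AddCommGroup E] [Module ℝ E] {S : ScScale E} {U : Set E} {r : E → E}
  {J : E → E → E}

variable {G : Type v} [NormedAddCommGroup G] [NormedSpace ℝ G] [NormedSpace ℂ G]
  {G' : Type w} [NormedAddCommGroup G'] [NormedSpace ℝ G'] [NormedSpace ℂ G']

theorem IsScHolomorphic.add {f g : ↥(r '' U) → G} (hf : IsScHolomorphic S U r J f)
    (hg : IsScHolomorphic S U r J g) : IsScHolomorphic S U r J (fun p => f p + g p) := by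
  refine ⟨?_, fun p hp h1 => ?_⟩
  · rw [IsScOnRetract, pull_add]
    exact hf.1.add hg.1
  · obtain ⟨A, hA, hA'⟩ := hf.2 p hp h1
    obtain ⟨B, hB, hB'⟩ := hg.2 p hp h1
    refine ⟨A + B, ?_, fun w hw => ?_⟩
    · rw [pull_add]
      exact hA.add hB
    · rw [LinearMap.add_apply, LinearMap.add_apply, hA' w hw, hB' w hw, smul_add]

theorem IsScHolomorphic.clm_comp [IsScalarTower ℝ ℂ G] [IsScalarTower ℝ ℂ G']
    {f : ↥(r '' U) → G} (L : G →L[ℂ] G') (hf : IsScHolomorphic S U r J f) :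
    IsScHolomorphic S U r J (fun p => L (f p)) := by
  refine ⟨?_, fun p hp h1 => ?_⟩
  · rw [IsScOnRetract, pull_comp f (map_zero L)]
    exact IsSc.clm_comp (L.restrictScalars ℝ) hf.1
  · obtain ⟨A, hA, hA'⟩ := hf.2 p hp h1
    refine ⟨(L.restrictScalars ℝ).toLinearMap ∘ₗ A, ?_, fun w hw => ?_⟩
    · rw [pull_comp f (map_zero L)]
      exact hA.clm_comp (L.restrictScalars ℝ)
    · simp [hA' w hw]

/-- The complex vector space of sc-holomorphic functions. -/
def holomorphicFunctions (S : ScScale E) (U : Set E) (r : E → E) (J : E → E → E)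
    (h0 : IsScHolomorphic S U r J (fun _ : ↥(r '' U) => (0 : ℂ))) :
    Submodule ℂ (↥(r '' U) → ℂ) where
  carrier := {f | IsScHolomorphic S U r J f}
  add_mem' hf hg := IsScHolomorphic.add hf hg
  zero_mem' := h0
  smul_mem' c _ hf := IsScHolomorphic.clm_comp (c • ContinuousLinearMap.id ℂ ℂ) hf

end Holomorphic

/-! ### The weighted Sobolev scale of `L²(ℝ)` -/

section WeakDeriv

theorem HasWeakDeriv.unique {j : ℕ} {f g g' : L2R} (h : HasWeakDeriv j f g)
    (h' : HasWeakDeriv j f g') : g = g' := by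
  rw [← sub_eq_zero]
  have h0 : ∀ᵐ s, (g - g' : L2R) s = 0 := by
    refine ae_eq_zero_of_integral_contDiff_smul_eq_zero
      ((Lp.memLp (g - g')).locallyIntegrable (by norm_num)) fun ψ hψ hc => ?_
    have e : ∫ s, ψ s • (g - g' : L2R) s = ∫ s, (g s * ψ s - g' s * ψ s) := by
      refine integral_congr_ae ?_
      filter_upwards [Lp.coeFn_sub g g'] with s hs
      rw [hs, Pi.sub_apply, smul_eq_mul]
      ring
    rw [e, integral_sub (integrable_mul_of_test hψ hc g) (integrable_mul_of_test hψ hc g')]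
    have e2 := (h ψ hψ hc).symm.trans (h' ψ hψ hc)
    have h1 : ((-1 : ℝ) ^ j) ≠ 0 := pow_ne_zero _ (by norm_num)
    rw [mul_left_cancel₀ h1 e2, sub_self]
  exact (Lp.eq_zero_iff_ae_eq_zero).2 h0

theorem HasWeakDeriv.weakDeriv_eq {j : ℕ} {f g : L2R} (h : HasWeakDeriv j f g) :
    weakDeriv j f = g := by
  have hex : ∃ g, HasWeakDeriv j f g := ⟨g, h⟩
  rw [weakDeriv, dif_pos hex]
  exact hex.choose_spec.unique h

theorem hasWeakDeriv_zero (f : L2R) : HasWeakDeriv 0 f f := by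
  intro ψ _ _
  simp

@[simp] theorem weakDeriv_zero (f : L2R) : weakDeriv 0 f = f := (hasWeakDeriv_zero f).weakDeriv_eq

theorem integrable_sq_L2R (f : L2R) : Integrable (fun s => f s ^ 2) := (Lp.memLp f).integrable_sq

theorem norm_sq_L2R (f : L2R) : ‖f‖ ^ 2 = ∫ s, f s ^ 2 := by
  rw [← real_inner_self_eq_norm_sq, L2.inner_def]
  refine integral_congr_ae (Filter.Eventually.of_forall fun s => ?_)
  simp [pow_two]

end WeakDeriv

namespace GammaData

variable {k : ℕ} (D : GammaData k)

theorem weight_pos (m : ℕ) (s : ℝ) : 0 < D.weight m s := Real.exp_pos _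

@[simp] theorem weight_zero (s : ℝ) : D.weight 0 s = 1 := by
  simp [weight, D.δ_zero]

theorem δ_nonneg (m : ℕ) : 0 ≤ D.δ m := by
  rw [← D.δ_zero]
  exact D.δ_strictMono.monotone (Nat.zero_le m)

/-- `s β(s)` may be negative on `(-1, 1)`, but not less than `-1`. -/
theorem neg_one_le_mul_β (s : ℝ) : -1 ≤ s * D.β s := by
  rcases le_total 1 s with h | h
  · rw [D.β_one s h]; linarith
  rcases le_total s (-1) with h' | h'
  · have := D.β_odd (-s)
    rw [neg_neg, D.β_one (-s) (by linarith)] at this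
    rw [this]; linarith
  · obtain ⟨h1, h2⟩ := D.β_mem s
    rcases le_total 0 s with hs | hs <;> nlinarith

theorem weight_le {i j : ℕ} (h : i ≤ j) (s : ℝ) :
    D.weight i s ≤ Real.exp (D.δ j - D.δ i) * D.weight j s := by
  rw [weight, weight, ← Real.exp_add, Real.exp_le_exp]
  have := D.δ_strictMono.monotone h
  nlinarith [D.neg_one_le_mul_β s]

variable {D} in
theorem WeightedInt.of_le {i j : ℕ} (h : i ≤ j) {g : L2R} (hg : D.WeightedInt j g) :
    D.WeightedInt i g := by
  refine Integrable.mono' (hg.const_mul (Real.exp (D.δ j - D.δ i))) ?_ ?_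
  · exact ((Lp.aestronglyMeasurable _).pow 2).mul (D.weight_continuous i).aestronglyMeasurable
  · refine Filter.Eventually.of_forall fun s => ?_
    have h1 := D.weight_le h s
    have h2 := D.weight_pos i s
    rw [Real.norm_of_nonneg (by positivity)]
    nlinarith [mul_le_mul_of_nonneg_left h1 (sq_nonneg (g s))]

theorem weightedInt_weakDeriv {m j : ℕ} {f : L2R} (hf : f ∈ D.sobolev m) (hj : j ≤ m) :
    D.WeightedInt m (weakDeriv j f) := by
  obtain ⟨g, hg, hg'⟩ := hf j hj
  rwa [hg.weakDeriv_eq]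

theorem integral_weight_nonneg (m : ℕ) (g : L2R) : 0 ≤ ∫ s, g s ^ 2 * D.weight m s :=
  integral_nonneg fun s => mul_nonneg (sq_nonneg _) (D.weight_pos m s).le

theorem isNested_l2Scale : D.l2Scale.IsNested where
  lev_succ_le m f hf j hj := by
    obtain ⟨g, hg, hg'⟩ := hf j (hj.trans (Nat.le_succ m))
    exact ⟨g, hg, hg'.of_le (Nat.le_succ m)⟩
  nrm_nonneg m f _ := Real.sqrt_nonneg _
  nrm_le_succ m := by
    refine ⟨Real.sqrt (Real.exp (D.δ (m + 1) - D.δ m)), fun f hf => ?_⟩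
    change Real.sqrt _ ≤ _ * Real.sqrt _
    rw [← Real.sqrt_mul (Real.exp_pos _).le]
    refine Real.sqrt_le_sqrt ?_
    rw [Finset.mul_sum, Finset.sum_range_succ _ (m + 1)]
    refine le_add_of_le_of_nonneg (Finset.sum_le_sum fun j hj => ?_)
      (mul_nonneg (Real.exp_pos _).le (D.integral_weight_nonneg _ _))
    have hw := D.weightedInt_weakDeriv hf (j := j) (by have := Finset.mem_range.1 hj; omega)
    rw [← integral_const_mul]
    refine integral_mono (hw.of_le (Nat.le_succ m)) (hw.const_mul _) fun s => ?_
    have h1 := D.weight_le (Nat.le_succ m) s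
    change _ * _ ≤ _ * (_ * _)
    nlinarith [mul_le_mul_of_nonneg_left h1 (sq_nonneg (weakDeriv j f s))]

theorem l2Scale_nrm_zero (f : L2R) : D.l2Scale.nrm 0 f = ‖f‖ := by
  change Real.sqrt _ = _
  simp [← norm_sq_L2R]

theorem l2Scale_lev_zero : D.l2Scale.lev 0 = ⊤ := by
  refine eq_top_iff.2 fun f _ j hj => ?_
  obtain rfl := Nat.le_zero.1 hj
  exact ⟨f, hasWeakDeriv_zero f, by simpa [WeightedInt] using integrable_sq_L2R f⟩

/-- The weighted `L²`-norm without derivatives is dominated by the norm of `E_1`. -/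
theorem sqrt_integral_le_nrm_one (f : L2R) :
    Real.sqrt (∫ s, f s ^ 2 * D.weight 1 s) ≤ D.l2Scale.nrm 1 f := by
  refine Real.sqrt_le_sqrt ?_
  rw [Finset.sum_range_succ, Finset.sum_range_one, weakDeriv_zero]
  exact le_add_of_nonneg_right (D.integral_weight_nonneg _ _)

theorem weightedInt_of_mem {m : ℕ} {f : L2R} (hf : f ∈ D.sobolev m) : D.WeightedInt m f := by
  simpa using D.weightedInt_weakDeriv hf (Nat.zero_le m)

theorem isNested_scale (n : ℕ) : (D.scale n).IsNested :=
  (isNested_constScale _).prod ((isNested_constScale _).prod D.isNested_l2Scale)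

theorem scale_lev_zero (n : ℕ) : (D.scale n).lev 0 = ⊤ := by
  simp [scale, ScScale.prod, constScale, l2Scale_lev_zero]

theorem scale_nrm_zero (n : ℕ) (p : (Fin n → ℝ) × ℝ × L2R) : (D.scale n).nrm 0 p = ‖p‖ := by
  change max ‖p.1‖ (max ‖p.2.1‖ (D.l2Scale.nrm 0 p.2.2)) = _
  rw [l2Scale_nrm_zero]
  rfl

/-- The norm of `E_1` dominates the norm of the finite-dimensional factor. -/
theorem norm_le_scale_nrm (n m : ℕ) (p : (Fin n → ℝ) × ℝ × L2R) :
    ‖(p.1, p.2.1)‖ ≤ (D.scale n).nrm m p :=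
  max_le (le_max_left _ _) ((le_max_left _ _).trans (le_max_right _ _))

theorem l2_nrm_le_scale_nrm (n m : ℕ) (p : (Fin n → ℝ) × ℝ × L2R) :
    D.l2Scale.nrm m p.2.2 ≤ (D.scale n).nrm m p :=
  (le_max_right _ _).trans (le_max_right _ _)

theorem scale_nrm_nonneg (n m : ℕ) (p : (Fin n → ℝ) × ℝ × L2R) : 0 ≤ (D.scale n).nrm m p :=
  (norm_nonneg _).trans (D.norm_le_scale_nrm n m p)

end GammaData

/-! ### Holomorphic functions of the base coordinate of `Γ_n^k` -/

namespace GammaData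

variable {k : ℕ} (D : GammaData k) {n : ℕ} {G : Type*} [NormedAddCommGroup G]

/-- Classically differentiable maps are sc-differentiable. -/
theorem hasScDerivAt_of_hasFDerivAt [NormedSpace ℝ G] {f : (Fin n → ℝ) × ℝ × L2R → G}
    {x : (Fin n → ℝ) × ℝ × L2R} {A : (Fin n → ℝ) × ℝ × L2R →L[ℝ] G} (h : HasFDerivAt f A x) :
    HasScDerivAt (D.scale n) (constScale G) f Set.univ x A.toLinearMap := by
  refine ⟨⟨‖A‖, fun h _ => ⟨trivial, ?_⟩⟩, fun ε hε => ?_⟩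
  · rw [D.scale_nrm_zero]
    exact A.le_opNorm h
  · obtain ⟨K, hK, hle⟩ := (D.isNested_scale n).nrm_le zero_le_one
    rw [hasFDerivAt_iff_isLittleO_nhds_zero, Asymptotics.isLittleO_iff] at h
    obtain ⟨d, hd, H⟩ := Metric.eventually_nhds_iff.1 (h (c := ε / K) (by positivity))
    refine ⟨d / K, by positivity, fun h hh _ hlt => ?_⟩
    have h1 := hle h hh
    rw [D.scale_nrm_zero] at h1
    rw [lt_div_iff₀ hK] at hlt
    refine (H (y := h) (by rw [dist_zero_right]; linarith)).trans ?_
    rw [div_mul_eq_mul_div, div_le_iff₀ hK]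
    nlinarith

/-- Continuity for the norm of `E_0` in the form used for sc-continuity. -/
theorem exists_nrm_zero_lt {f : (Fin n → ℝ) × ℝ × L2R → G} {x : (Fin n → ℝ) × ℝ × L2R}
    (h : ContinuousAt f x) (ε : ℝ) (hε : 0 < ε) :
    ∃ d > 0, ∀ y, (D.scale n).nrm 0 (y - x) < d → ‖f y - f x‖ < ε := by
  obtain ⟨d, hd, H⟩ := Metric.continuousAt_iff.1 h ε hε
  refine ⟨d, hd, fun y hy => ?_⟩
  rw [D.scale_nrm_zero] at hy
  rw [← dist_eq_norm]
  exact H (by rwa [dist_eq_norm])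

/-- Continuity for the norm of `E_0 ⊕ E_0` implies continuity on the tangent bundle `E_1 ⊕ E_0`. -/
theorem exists_nrm_tangent_lt
    {f : ((Fin n → ℝ) × ℝ × L2R) × ((Fin n → ℝ) × ℝ × L2R) → G}
    {q : ((Fin n → ℝ) × ℝ × L2R) × ((Fin n → ℝ) × ℝ × L2R)} (hq : q.1 ∈ (D.scale n).lev 1)
    (h : ContinuousAt f q) (ε : ℝ) (hε : 0 < ε) :
    ∃ d > 0, ∀ q' ∈ tangentSet (D.scale n) Set.univ, (D.scale n).nrm 1 (q'.1 - q.1) < d →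
      (D.scale n).nrm 0 (q'.2 - q.2) < d → ‖f q' - f q‖ < ε := by
  obtain ⟨d, hd, H⟩ := Metric.continuousAt_iff.1 h ε hε
  obtain ⟨K, hK, hle⟩ := (D.isNested_scale n).nrm_le zero_le_one
  refine ⟨min d (d / K), by positivity, fun q' hq' h1 h2 => ?_⟩
  have h3 := hle _ (sub_mem hq'.2.1 hq)
  have h1 := h1.trans_le (min_le_right _ _)
  rw [D.scale_nrm_zero] at h2 h3
  rw [lt_div_iff₀ hK] at h1
  rw [← dist_eq_norm]
  refine H ?_
  rw [dist_eq_norm]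
  exact max_lt (by change ‖q'.1 - q.1‖ < d; linarith) (h2.trans_le (min_le_left _ _))

/-- The complex coordinate `x_n + i t`, where `n = m + 1`. -/
noncomputable def zCoord (m : ℕ) : (Fin (m + 1) → ℝ) × ℝ × L2R →L[ℝ] ℂ :=
  Complex.ofRealCLM ∘L (ContinuousLinearMap.proj (Fin.last m)) ∘L
      (ContinuousLinearMap.fst ℝ (Fin (m + 1) → ℝ) (ℝ × L2R)) +
    Complex.I • (Complex.ofRealCLM ∘L (ContinuousLinearMap.fst ℝ ℝ L2R) ∘L
      (ContinuousLinearMap.snd ℝ (Fin (m + 1) → ℝ) (ℝ × L2R)))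

theorem zCoord_apply (m : ℕ) (p : (Fin (m + 1) → ℝ) × ℝ × L2R) :
    zCoord m p = ⟨p.1 (Fin.last m), p.2.1⟩ := by
  apply Complex.ext <;> simp [zCoord]

@[simp] theorem zCoord_retr (m : ℕ) (p : (Fin (m + 1) → ℝ) × ℝ × L2R) :
    zCoord m (D.retr (m + 1) p) = zCoord m p := by
  simp [zCoord_apply, retr]

/-- As `n = m + 1` is odd, the last pair of base coordinates is `(x_n, t)`. -/
theorem zCoord_cplx {m : ℕ} (hm : Even m) (p w : (Fin (m + 1) → ℝ) × ℝ × L2R) :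
    zCoord m (D.cplx (m + 1) p w) = Complex.I * zCoord m w := by
  have h1 : ¬ Even (m + 1) := Nat.not_even_iff_odd.2 hm.add_one
  apply Complex.ext <;> simp [zCoord_apply, cplx, rot, hm, h1, baseSeq, Fin.last]

theorem isScHolomorphic_comp_zCoord {m : ℕ} (hm : Even m) {F : ℂ → ℂ} (hF : Differentiable ℂ F) :
    IsScHolomorphic (D.scale (m + 1)) Set.univ (D.retr (m + 1)) (D.cplx (m + 1))
      (fun p => F (zCoord m p.1)) := by
  have hpull : pull Set.univ (D.retr (m + 1))
      (fun p : ↥(D.retr (m + 1) '' Set.univ) => F (zCoord m p.1)) = fun x => F (zCoord m x) := by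
    funext x
    rw [pull_apply (fun x => F (zCoord m x)) (Set.mem_univ x), zCoord_retr]
  have hD : ∀ x, HasScDerivAt (D.scale (m + 1)) (constScale ℂ) (fun x => F (zCoord m x))
      Set.univ x (deriv F (zCoord m x) • zCoord m).toLinearMap := fun x =>
    D.hasScDerivAt_of_hasFDerivAt
      ((hF (zCoord m x)).hasDerivAt.comp_hasFDerivAt x (zCoord m).hasFDerivAt)
  refine ⟨?_, fun p _ _ => ⟨_, hpull ▸ hD p, fun w _ => ?_⟩⟩
  · rw [IsScOnRetract, hpull]
    refine isSc_one_of_level_zero (D.isNested_scale _) (fun x _ _ ε hε => ?_)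
      (fun x _ _ => hD x) (fun q hq ε hε => ?_)
    · obtain ⟨d, hd, H⟩ := D.exists_nrm_zero_lt (f := fun x => F (zCoord m x)) (x := x)
        (hF.continuous.comp (zCoord m).continuous).continuousAt ε hε
      exact ⟨d, hd, fun y _ _ hy => H y hy⟩
    · have hc : Continuous (deriv F) := (hF.contDiff (n := 1)).continuous_deriv le_rfl
      exact D.exists_nrm_tangent_lt
        (f := fun q => (deriv F (zCoord m q.1) • zCoord m) q.2) hq.2.1
        (((hc.comp ((zCoord m).continuous.comp continuous_fst)).smul
          ((zCoord m).continuous.comp continuous_snd)).continuousAt) ε hε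
  · simp only [ContinuousLinearMap.coe_coe, smul_apply, D.zCoord_cplx hm,
      smul_eq_mul]
    ring

/-- Near a point with `t < 0`, the retract is the `(n + 1)`-dimensional space `ℝⁿ ⊕ ℝ`. -/
theorem odd_of_isEvenDimensional
    (h : IsEvenDimensional (D.scale n) Set.univ (D.retr n)) : Odd n := by
  let B : (Fin n → ℝ) × ℝ →ₗ[ℝ] (Fin n → ℝ) × ℝ × L2R :=
    LinearMap.prodMap LinearMap.id (LinearMap.inl ℝ ℝ L2R)
  let C : (Fin n → ℝ) × ℝ × L2R →ₗ[ℝ] (Fin n → ℝ) × ℝ :=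
    LinearMap.prodMap LinearMap.id (LinearMap.fst ℝ ℝ L2R)
  have hB : Function.Injective B := fun a b hab => by
    have h1 : (a.1, a.2, (0 : L2R)) = (b.1, b.2, 0) := hab
    simp only [Prod.mk.injEq] at h1
    exact Prod.ext h1.1 h1.2.1
  have hC : LinearMap.range C = ⊤ := LinearMap.range_eq_top.2 fun a => ⟨(a.1, a.2, 0), rfl⟩
  have hp : D.retr n (0, -1, 0) = (0, -1, 0) := by simp [retr, proj]
  have hr : ∀ y : (Fin n → ℝ) × ℝ × L2R, y.2.1 < 0 → D.retr n y = (y.1, y.2.1, 0) := fun y hy => by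
    simp [retr, proj, not_lt.2 hy.le]
  have hd : HasScDerivAt (D.scale n) (D.scale n) (D.retr n) Set.univ (0, -1, 0) (B ∘ₗ C) := by
    refine ⟨⟨1, fun h _ => ⟨D.scale_lev_zero n ▸ trivial, ?_⟩⟩, fun ε hε => ⟨1, one_pos,
      fun h _ _ hlt => ?_⟩⟩
    · rw [D.scale_nrm_zero, D.scale_nrm_zero, one_mul]
      change max ‖h.1‖ (max ‖h.2.1‖ ‖(0 : L2R)‖) ≤ max ‖h.1‖ (max ‖h.2.1‖ ‖h.2.2‖)
      rw [norm_zero]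
      exact max_le_max le_rfl (max_le_max le_rfl (norm_nonneg _))
    · have h1 : |h.2.1| < 1 :=
        ((le_max_right ‖h.1‖ _).trans (D.norm_le_scale_nrm n 1 h)).trans_lt hlt
      have h2 := abs_lt.1 h1
      rw [hr _ (by change (-1 : ℝ) + h.2.1 < 0; linarith), hp, D.scale_nrm_zero]
      have e : (((0, -1, 0) + h : (Fin n → ℝ) × ℝ × L2R).1,
          ((0, -1, 0) + h : (Fin n → ℝ) × ℝ × L2R).2.1, (0 : L2R)) - (0, -1, 0)
          - (B ∘ₗ C) h = 0 := by
        change (_ - _ - h.1, _ - _ - h.2.1, _ - _ - (0 : L2R)) = _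
        simp
      rw [e, norm_zero]
      exact mul_nonneg hε.le (D.scale_nrm_nonneg n 1 h)
  have hrange : LinearMap.range (B ∘ₗ C) = LinearMap.range B :=
    LinearMap.range_comp_of_range_eq_top _ hC
  have hmem : ((0, -1, 0) : (Fin n → ℝ) × ℝ × L2R) ∈ (D.scale n).lev 1 :=
    ⟨trivial, trivial, zero_mem _⟩
  rcases h (0, -1, 0) ⟨_, trivial, hp⟩ hmem _ hd with h | h
  · exact absurd (hrange ▸ inferInstance) h
  · rw [hrange, LinearMap.finrank_range_of_inj hB] at h
    simp only [Module.finrank_prod, Module.finrank_fintype_fun_eq_card, Fintype.card_fin,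
      Module.finrank_self] at h
    exact Nat.not_even_iff_odd.1 fun h' => by
      have := h'.add_one
      exact (Nat.not_even_iff_odd.2 this) h

/-- The polynomials in `x_n + i t` are linearly independent sc-holomorphic functions. -/
theorem exists_holomorphicFunctions (n k : ℕ) (D : GammaData k)
    (h : IsEvenDimensional (D.scale n) Set.univ (D.retr n)) :
    ∃ V : Submodule ℂ (D.Gam n → ℂ),
      (∀ φ : D.Gam n → ℂ, φ ∈ V ↔
        IsScHolomorphic (D.scale n) Set.univ (D.retr n) (D.cplx n) φ) ∧
      ¬ FiniteDimensional ℂ V := by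
  obtain ⟨m, rfl⟩ : ∃ m, n = m + 1 := ⟨n - 1, by have := (D.odd_of_isEvenDimensional h).pos; omega⟩
  have hm : Even m := by
    have := D.odd_of_isEvenDimensional h
    exact Nat.not_odd_iff_even.1 fun h' => Nat.not_odd_iff_even.2 h'.add_one this
  refine ⟨holomorphicFunctions _ _ _ _ (D.isScHolomorphic_comp_zCoord hm
    (differentiable_const (0 : ℂ))), fun φ => Iff.rfl, fun hfin => ?_⟩
  let Φ : Polynomial ℂ →ₗ[ℂ] holomorphicFunctions (D.scale (m + 1)) Set.univ (D.retr (m + 1))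
      (D.cplx (m + 1)) (D.isScHolomorphic_comp_zCoord hm (differentiable_const (0 : ℂ))) :=
    { toFun := fun P => ⟨fun p => P.eval (zCoord m p.1),
        D.isScHolomorphic_comp_zCoord hm P.differentiable⟩
      map_add' := fun P Q => by ext p; simp
      map_smul' := fun c P => by ext p; simp }
  have hΦ : Function.Injective Φ := by
    rw [injective_iff_map_eq_zero]
    intro P hP
    refine Polynomial.funext fun z => ?_
    have hr : D.retr (m + 1) (fun _ => z.re, z.im, 0) = (fun _ => z.re, z.im, 0) := by
      simp [retr, proj]
    have h1 := congrFun (congrArg Subtype.val hP)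
      ⟨(fun _ => z.re, z.im, 0), _, Set.mem_univ _, hr⟩
    have h2 : P.eval (zCoord m ((fun _ => z.re, z.im, 0) : (Fin (m + 1) → ℝ) × ℝ × L2R)) = 0 := h1
    rw [zCoord_apply] at h2
    simpa using h2
  exact Polynomial.not_finite (R := ℂ) (Module.Finite.of_injective Φ hΦ)

end GammaData

/-! ### Translation of test functions in `L²(ℝ)` -/

section Translate

open Filter Topology

theorem toL2_coeFn {g : ℝ → ℝ} (h : MemLp g 2 (volume : Measure ℝ)) : toL2 g =ᵐ[volume] g := by
  rw [toL2, dif_pos h]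
  exact h.coeFn_toLp

theorem inner_toL2 (f : L2R) {g : ℝ → ℝ} (h : MemLp g 2 (volume : Measure ℝ)) :
    inner ℝ f (toL2 g) = ∫ s, f s * g s := by
  rw [L2.inner_def]
  refine integral_congr_ae ?_
  filter_upwards [toL2_coeFn h] with s hs
  simp [hs, mul_comm]

theorem inner_toL2_toL2 {f g : ℝ → ℝ} (hf : MemLp f 2 (volume : Measure ℝ))
    (hg : MemLp g 2 (volume : Measure ℝ)) : inner ℝ (toL2 f) (toL2 g) = ∫ s, f s * g s := by
  rw [inner_toL2 _ hg]
  refine integral_congr_ae ?_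
  filter_upwards [toL2_coeFn hf] with s hs
  rw [hs]

theorem norm_toL2_le {g : ℝ → ℝ} (h : MemLp g 2 (volume : Measure ℝ)) {c R s₀ : ℝ} (hR : 0 ≤ R)
    (hc : 0 ≤ c) (hb : ∀ s, |g s| ≤ c) (h0 : ∀ s, R < |s - s₀| → g s = 0) :
    ‖toL2 g‖ ≤ c * Real.sqrt (2 * R) := by
  rw [← abs_of_nonneg (norm_nonneg (toL2 g)), ← Real.sqrt_sq hc, ← Real.sqrt_mul (sq_nonneg c)]
  refine Real.abs_le_sqrt ?_
  rw [norm_sq_L2R]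
  have e : ∫ s, (toL2 g) s ^ 2 = ∫ s in Set.Icc (s₀ - R) (s₀ + R), g s ^ 2 := by
    rw [← integral_indicator measurableSet_Icc]
    refine integral_congr_ae ?_
    filter_upwards [toL2_coeFn h] with s hs
    rw [hs]
    by_cases hm : s ∈ Set.Icc (s₀ - R) (s₀ + R)
    · rw [Set.indicator_of_mem hm]
    · rw [Set.indicator_of_notMem hm, h0 s, zero_pow two_ne_zero]
      by_contra hle
      have := abs_le.1 (not_lt.1 hle)
      exact hm ⟨by linarith [this.1], by linarith [this.2]⟩
  rw [e]
  have hle : ∫ s in Set.Icc (s₀ - R) (s₀ + R), g s ^ 2 ≤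
      ∫ s in Set.Icc (s₀ - R) (s₀ + R), c ^ 2 := by
    refine setIntegral_mono_on h.integrable_sq.integrableOn (by simp) measurableSet_Icc
      fun s _ => ?_
    rw [← sq_abs]
    exact pow_le_pow_left₀ (abs_nonneg _) (hb s) 2
  refine hle.trans (le_of_eq ?_)
  rw [setIntegral_const, smul_eq_mul, Measure.real, Real.volume_Icc,
    ENNReal.toReal_ofReal (by linarith)]
  ring

/-- The translate `g(· + a)` in `L²(ℝ)`. -/
noncomputable def translate (g : ℝ → ℝ) (a : ℝ) : L2R := toL2 (fun s => g (s + a))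

variable {g : ℝ → ℝ}

theorem memLp_translate (hg : Continuous g) (hc : HasCompactSupport g) (a : ℝ) :
    MemLp (fun s => g (s + a)) 2 (volume : Measure ℝ) :=
  (hg.comp (continuous_id.add continuous_const)).memLp_of_hasCompactSupport
    (hc.comp_homeomorph (Homeomorph.addRight a))

theorem exists_support_bound (hc : HasCompactSupport g) : ∃ R > 0, ∀ s, R < |s| → g s = 0 := by
  obtain ⟨R, hR⟩ := hc.isCompact.isBounded.exists_norm_le
  refine ⟨max R 1, by positivity, fun s hs => ?_⟩
  by_contra h
  have := hR s (subset_tsupport _ h)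
  rw [Real.norm_eq_abs] at this
  exact absurd (hs.trans_le this) (not_lt.2 (le_max_left _ _))

theorem abs_taylor_le {K : ℝ} (hg : ContDiff ℝ ∞ g)
    (hK : ∀ s s', |deriv g s - deriv g s'| ≤ K * |s - s'|) (hK0 : 0 ≤ K) (s h : ℝ) :
    |g (s + h) - g s - h * deriv g s| ≤ K * h ^ 2 := by
  have hd : ∀ u ∈ Set.uIcc (0 : ℝ) h, HasDerivWithinAt (fun u => g (s + u) - u * deriv g s)
      (deriv g (s + u) - deriv g s) (Set.uIcc 0 h) u := by
    intro u _
    have h1 : HasDerivAt (fun u => g (s + u)) (deriv g (s + u)) u := by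
      have := (hg.differentiable (by simp) (s + u)).hasDerivAt
      exact this.comp_const_add s u
    have h2 : HasDerivAt (fun u => u * deriv g s) (deriv g s) u := by
      simpa using (hasDerivAt_id u).mul_const (deriv g s)
    exact (h1.sub h2).hasDerivWithinAt
  have := (convex_uIcc (0 : ℝ) h).norm_image_sub_le_of_norm_hasDerivWithin_le
    (C := K * |h|) hd (fun u hu => ?_) Set.left_mem_uIcc Set.right_mem_uIcc
  · simp only [add_zero, zero_mul, sub_zero, Real.norm_eq_abs] at this
    have e : g (s + h) - g s - h * deriv g s = g (s + h) - h * deriv g s - g s := by ring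
    rw [e]
    refine this.trans (le_of_eq ?_)
    rw [mul_assoc, ← pow_two, sq_abs]
  · rw [Real.norm_eq_abs]
    refine (hK _ _).trans (mul_le_mul_of_nonneg_left ?_ hK0)
    rw [add_sub_cancel_left]
    simpa using Set.abs_sub_left_of_mem_uIcc hu

theorem contDiff_deriv (hg : ContDiff ℝ ∞ g) : ContDiff ℝ ∞ (deriv g) :=
  (contDiff_infty_iff_deriv.1 hg).2

/-- Translation is differentiable in the translation parameter. -/
theorem hasDerivAt_translate (hg : ContDiff ℝ ∞ g) (hc : HasCompactSupport g) (a : ℝ) :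
    HasDerivAt (translate g) (translate (deriv g) a) a := by
  obtain ⟨K, hK⟩ := ((contDiff_deriv hg).of_le (by simp : (1 : WithTop ℕ∞) ≤ ∞)
    ).lipschitzWith_of_hasCompactSupport hc.deriv one_ne_zero
  have hK' : ∀ s s', |deriv g s - deriv g s'| ≤ K * |s - s'| := fun s s' => by
    simpa [Real.dist_eq] using hK.dist_le_mul s s'
  obtain ⟨R, hR, hR0⟩ := exists_support_bound hc
  obtain ⟨R', hR', hR0'⟩ := exists_support_bound hc.deriv
  set Q := R + R' + 1
  have hbound : ∀ h : ℝ, |h| ≤ 1 → ‖translate g (a + h) - translate g a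
      - h • translate (deriv g) a‖ ≤ (K * h ^ 2) * Real.sqrt (2 * Q) := by
    intro h hh
    have m1 := memLp_translate hg.continuous hc (a + h)
    have m2 := memLp_translate hg.continuous hc a
    have m3 := memLp_translate (contDiff_deriv hg).continuous hc.deriv a
    have m : MemLp (fun s => g (s + a + h) - g (s + a) - h * deriv g (s + a)) 2 volume := by
      have := (m1.sub m2).sub (m3.const_mul h)
      refine this.congr_norm ?_ (Eventually.of_forall fun s => ?_)
      · have h1 := hg.continuous
        have h2 := (contDiff_deriv hg).continuous
        exact (by fun_prop : Continuous fun s => g (s + a + h) - g (s + a) - h * deriv g (s + a)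
          ).aestronglyMeasurable
      · simp [add_assoc]
    have e : translate g (a + h) - translate g a - h • translate (deriv g) a
        = toL2 (fun s => g (s + a + h) - g (s + a) - h * deriv g (s + a)) := by
      refine Lp.ext ?_
      filter_upwards [Lp.coeFn_sub (translate g (a + h) - translate g a)
        (h • translate (deriv g) a), Lp.coeFn_sub (translate g (a + h)) (translate g a),
        Lp.coeFn_smul h (translate (deriv g) a), toL2_coeFn m1, toL2_coeFn m2, toL2_coeFn m3,
        toL2_coeFn m] with s h1 h2 h3 h4 h5 h6 h7
      rw [h1, Pi.sub_apply, h2, Pi.sub_apply, h3, Pi.smul_apply, translate, translate, translate,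
        h4, h5, h6, h7, smul_eq_mul, add_assoc]
    rw [e]
    refine norm_toL2_le m (s₀ := -a) (by positivity) (by positivity)
      (fun s => abs_taylor_le hg hK' K.2 (s + a) h) fun s hs => ?_
    rw [sub_neg_eq_add] at hs
    have h1 : |s + a| - |h| ≤ |s + a + h| := by
      have := abs_sub_abs_le_abs_sub (s + a) (-h)
      rwa [abs_neg, sub_neg_eq_add] at this
    rw [hR0 (s + a + h) (by simp only [Q] at hs; linarith),
      hR0 (s + a) (by simp only [Q] at hs; linarith),
      hR0' (s + a) (by simp only [Q] at hs; linarith)]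
    simp
  rw [hasDerivAt_iff_isLittleO_nhds_zero, Asymptotics.isLittleO_iff]
  intro c hc'
  have hC : 0 ≤ K * Real.sqrt (2 * Q) := by positivity
  filter_upwards [Metric.ball_mem_nhds (0 : ℝ)
    (show 0 < min 1 (c / (K * Real.sqrt (2 * Q) + 1)) by positivity)] with h hh
  rw [mem_ball_zero_iff, Real.norm_eq_abs, lt_min_iff, lt_div_iff₀ (by positivity)] at hh
  refine (hbound h hh.1.le).trans ?_
  rw [Real.norm_eq_abs, ← sq_abs]
  nlinarith [abs_nonneg h]

theorem inner_translate_translate {g' : ℝ → ℝ} (hg : Continuous g) (hc : HasCompactSupport g)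
    (hg' : Continuous g') (hc' : HasCompactSupport g') (a : ℝ) :
    inner ℝ (translate g a) (translate g' a) = ∫ s, g s * g' s := by
  rw [translate, translate, inner_toL2_toL2 (memLp_translate hg hc a) (memLp_translate hg' hc' a)]
  exact integral_add_right_eq_self (fun s => g s * g' s) a

theorem norm_translate (hg : Continuous g) (hc : HasCompactSupport g) (a : ℝ) :
    ‖translate g a‖ = Real.sqrt (∫ s, g s ^ 2) := by
  rw [← Real.sqrt_sq (norm_nonneg (translate g a)), ← real_inner_self_eq_norm_sq,
    inner_translate_translate hg hc hg hc]
  simp only [pow_two]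

theorem inner_translate_eq_inner_indicator (hg : Continuous g) (hc : HasCompactSupport g) {R : ℝ}
    (hR0 : ∀ s, R < |s| → g s = 0) (f : L2R) (a : ℝ) :
    inner ℝ f (translate g a) =
      inner ℝ (toL2 (Set.indicator (Set.Iic (R - a)) f)) (translate g a) := by
  have hm : MemLp (Set.indicator (Set.Iic (R - a)) f) 2 volume :=
    (Lp.memLp f).indicator measurableSet_Iic
  rw [translate, inner_toL2 _ (memLp_translate hg hc a),
    inner_toL2_toL2 hm (memLp_translate hg hc a)]
  refine integral_congr_ae (Eventually.of_forall fun s => ?_)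
  by_cases hs : s ∈ Set.Iic (R - a)
  · simp only [Set.indicator_of_mem hs]
  · have hs' : R - a < s := not_le.1 hs
    have : g (s + a) = 0 := hR0 _ (lt_of_lt_of_le (by linarith) (le_abs_self _))
    simp only [this, mul_zero]

/-- Translates to infinity converge weakly to zero. -/
theorem tendsto_inner_translate (hg : Continuous g) (hc : HasCompactSupport g) (f : L2R) :
    Tendsto (fun a => inner ℝ f (translate g a)) atTop (𝓝 0) := by
  obtain ⟨R, hR, hR0⟩ := exists_support_bound hc
  have htail : Tendsto (fun a : ℝ => ∫ s, Set.indicator (Set.Iic (R - a)) (fun s => f s ^ 2) s)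
      atTop (𝓝 0) := by
    rw [← integral_zero ℝ ℝ (μ := volume)]
    refine tendsto_integral_filter_of_dominated_convergence (fun s => f s ^ 2) ?_ ?_
      (integrable_sq_L2R f) ?_
    · exact Eventually.of_forall fun a =>
        ((Lp.aestronglyMeasurable f).pow 2).indicator measurableSet_Iic
    · refine Eventually.of_forall fun a => Eventually.of_forall fun s => ?_
      refine (norm_indicator_le_norm_self _ _).trans ?_
      rw [Real.norm_of_nonneg (sq_nonneg _)]
    · refine Eventually.of_forall fun s => tendsto_const_nhds.congr' ?_
      filter_upwards [eventually_gt_atTop (R - s)] with a ha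
      rw [Set.indicator_of_notMem]
      simp only [Set.mem_Iic, not_le]
      linarith
  have hle : ∀ a, |inner ℝ f (translate g a)| ≤ Real.sqrt (∫ s, g s ^ 2) *
      Real.sqrt (∫ s, Set.indicator (Set.Iic (R - a)) (fun s => f s ^ 2) s) := by
    intro a
    have hm : MemLp (Set.indicator (Set.Iic (R - a)) f) 2 volume :=
      (Lp.memLp f).indicator measurableSet_Iic
    have e := inner_translate_eq_inner_indicator hg hc hR0 f a
    have hn : ‖toL2 (Set.indicator (Set.Iic (R - a)) f)‖
        = Real.sqrt (∫ s, Set.indicator (Set.Iic (R - a)) (fun s => f s ^ 2) s) := by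
      rw [← Real.sqrt_sq (norm_nonneg (toL2 _)), norm_sq_L2R]
      congr 1
      refine integral_congr_ae ?_
      filter_upwards [toL2_coeFn hm] with s hs
      rw [hs]
      by_cases hs : s ∈ Set.Iic (R - a)
      · simp only [Set.indicator_of_mem hs]
      · simp only [Set.indicator_of_notMem hs, zero_pow two_ne_zero]
    rw [e, ← hn, ← norm_translate hg hc a, mul_comm]
    exact abs_real_inner_le_norm _ _
  refine squeeze_zero_norm hle ?_
  have := (Real.continuous_sqrt.tendsto 0).comp htail
  rw [Real.sqrt_zero] at this
  simpa using this.const_mul (Real.sqrt (∫ s, g s ^ 2))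

/-- Functions in `E_1` pair with translates to `-∞` with exponential decay, since on the support of
`g(· + a)` the weight of level `1` is of the size `e^{δ_1 a}`. -/
theorem GammaData.exists_abs_inner_translate_le {k : ℕ} (D : GammaData k) (hg : Continuous g)
    (hc : HasCompactSupport g) : ∃ C R : ℝ, 0 ≤ C ∧ ∀ a, R ≤ a → ∀ f : L2R, D.WeightedInt 1 f →
      |inner ℝ f (translate g a)| ≤ C * Real.exp (-(D.δ 1 / 2 * a)) *
        Real.sqrt (∫ s, f s ^ 2 * D.weight 1 s) := by
  obtain ⟨R, hR, hR0⟩ := exists_support_bound hc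
  refine ⟨Real.exp (D.δ 1 / 2 * R) * Real.sqrt (∫ s, g s ^ 2), R + 1, by positivity,
    fun a ha f hf => ?_⟩
  have hm : MemLp (Set.indicator (Set.Iic (R - a)) f) 2 volume :=
    (Lp.memLp f).indicator measurableSet_Iic
  have e := inner_translate_eq_inner_indicator hg hc hR0 f a
  have hn : ‖toL2 (Set.indicator (Set.Iic (R - a)) f)‖
      ≤ Real.exp (-(D.δ 1 / 2 * (a - R))) * Real.sqrt (∫ s, f s ^ 2 * D.weight 1 s) := by
    have h1 : (0 : ℝ) ≤ Real.exp (-(D.δ 1 / 2 * (a - R))) := (Real.exp_pos _).le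
    rw [← Real.sqrt_sq h1, ← Real.sqrt_mul (sq_nonneg _)]
    refine (le_abs_self _).trans (Real.abs_le_sqrt ?_)
    rw [norm_sq_L2R, ← integral_const_mul]
    refine integral_mono_ae (integrable_sq_L2R _) (hf.const_mul _) ?_
    filter_upwards [toL2_coeFn hm] with s hs
    rw [hs]
    have hw := D.weight_pos 1 s
    by_cases hs : s ∈ Set.Iic (R - a)
    · simp only [Set.indicator_of_mem hs]
      have hs' : s ≤ R - a := hs
      -- `s ≤ -1` because `R + 1 ≤ a`
      have hβ : D.β s = -1 := by
        have := D.β_odd (-s)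
        rwa [neg_neg, D.β_one (-s) (by linarith)] at this
      have h2 : 1 ≤ Real.exp (-(D.δ 1 / 2 * (a - R))) ^ 2 * D.weight 1 s := by
        rw [GammaData.weight, hβ, ← Real.exp_nat_mul, ← Real.exp_add, Real.one_le_exp_iff]
        push_cast
        nlinarith [D.δ_nonneg 1]
      nlinarith [mul_le_mul_of_nonneg_left h2 (sq_nonneg (f s))]
    · simp only [Set.indicator_of_notMem hs, zero_pow two_ne_zero]
      positivity
  rw [e]
  refine (abs_real_inner_le_norm _ _).trans ?_
  rw [norm_translate hg hc]
  refine (mul_le_mul_of_nonneg_right hn (Real.sqrt_nonneg _)).trans (le_of_eq ?_)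
  have : Real.exp (-(D.δ 1 / 2 * (a - R)))
      = Real.exp (D.δ 1 / 2 * R) * Real.exp (-(D.δ 1 / 2 * a)) := by
    rw [← Real.exp_add]; congr 1; ring
  rw [this]
  ring

end Translate

open Filter Topology

namespace GammaData

/-! ### The moving frame `γ_{j,t}` -/

section Frame

variable {k : ℕ} (D : GammaData k)

theorem shifted_eq (j : Fin k) (t : ℝ) : D.shifted j t = translate (D.γ j) (Real.exp (1 / t)) := rfl

theorem hasDerivAt_exp_one_div {t : ℝ} (ht : t ≠ 0) :
    HasDerivAt (fun τ : ℝ => Real.exp (1 / τ)) (-(Real.exp (1 / t) / t ^ 2)) t := by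
  have := ((hasDerivAt_inv ht).exp)
  simp only [one_div]
  convert this using 1
  ring

theorem rho_eq (j : Fin k) {t : ℝ} (ht : t ≠ 0) :
    D.rho j t = (-(Real.exp (1 / t) / t ^ 2)) • translate (deriv (D.γ j)) (Real.exp (1 / t)) := by
  have hm := memLp_translate (contDiff_deriv (D.γ_smooth j)).continuous (D.γ_compact j).deriv
    (Real.exp (1 / t))
  have e : (fun s => deriv (fun τ => D.γ j (s + Real.exp (1 / τ))) t)
      = fun s => (-(Real.exp (1 / t) / t ^ 2)) * deriv (D.γ j) (s + Real.exp (1 / t)) := by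
    funext s
    have h1 := ((D.γ_smooth j).differentiable (by simp) (s + Real.exp (1 / t))).hasDerivAt
    have h2 := (hasDerivAt_exp_one_div ht).const_add s
    have h3 : HasDerivAt (fun τ => D.γ j (s + Real.exp (1 / τ))) _ t := h1.comp t h2
    rw [h3.deriv, mul_comm]
  rw [rho, e]
  refine Lp.ext ?_
  filter_upwards [toL2_coeFn (hm.const_mul (-(Real.exp (1 / t) / t ^ 2))), toL2_coeFn hm,
    Lp.coeFn_smul (-(Real.exp (1 / t) / t ^ 2)) (translate (deriv (D.γ j)) (Real.exp (1 / t)))]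
    with s h1 h2 h3
  rw [h1, h3, Pi.smul_apply, translate, h2, smul_eq_mul]

theorem hasDerivAt_shifted (j : Fin k) {t : ℝ} (ht : t ≠ 0) :
    HasDerivAt (D.shifted j) (D.rho j t) t := by
  rw [D.rho_eq j ht]
  exact (hasDerivAt_translate (D.γ_smooth j) (D.γ_compact j) (Real.exp (1 / t))).scomp t
    (hasDerivAt_exp_one_div ht)

theorem continuousAt_rho (j : Fin k) {t : ℝ} (ht : t ≠ 0) : ContinuousAt (D.rho j) t := by
  have h1 : ContinuousAt (fun t : ℝ => Real.exp (1 / t)) t :=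
    (hasDerivAt_exp_one_div ht).continuousAt
  have h2 : ContinuousAt (fun t : ℝ => (-(Real.exp (1 / t) / t ^ 2)) •
      translate (deriv (D.γ j)) (Real.exp (1 / t))) t := by
    refine ContinuousAt.smul (h1.div (continuousAt_id.pow 2) (pow_ne_zero 2 ht)).neg ?_
    exact ContinuousAt.comp (f := fun t : ℝ => Real.exp (1 / t))
      (hasDerivAt_translate (contDiff_deriv (D.γ_smooth j)) (D.γ_compact j).deriv
        (Real.exp (1 / t))).continuousAt h1
  refine h2.congr ?_
  filter_upwards [isOpen_ne.mem_nhds ht] with τ hτ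
  exact (D.rho_eq j hτ).symm

theorem inner_shifted_shifted (i j : Fin k) (t : ℝ) :
    inner ℝ (D.shifted i t) (D.shifted j t) = if i = j then (1 : ℝ) else 0 := by
  rw [shifted_eq, shifted_eq, inner_translate_translate (D.γ_smooth i).continuous (D.γ_compact i)
    (D.γ_smooth j).continuous (D.γ_compact j), D.γ_orthonormal]

theorem norm_shifted (j : Fin k) (t : ℝ) : ‖D.shifted j t‖ = 1 := by
  have := D.inner_shifted_shifted j j t
  rw [if_pos rfl, real_inner_self_eq_norm_sq] at this
  exact (pow_eq_one_iff_of_nonneg (norm_nonneg _) two_ne_zero).1 this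

/-- `γ_i` and `γ_j'` have disjoint supports for `i ≠ j`, and `‖γ_{j,t}‖` is constant. -/
theorem inner_shifted_rho (i j : Fin k) {t : ℝ} (ht : t ≠ 0) :
    inner ℝ (D.shifted i t) (D.rho j t) = (0 : ℝ) := by
  by_cases hij : i = j
  · subst hij
    have h1 := (D.hasDerivAt_shifted i ht).inner ℝ (D.hasDerivAt_shifted i ht)
    have h2 : HasDerivAt (fun t => inner ℝ (D.shifted i t) (D.shifted i t)) (0 : ℝ) t := by
      simp only [D.inner_shifted_shifted, if_true]
      exact hasDerivAt_const t 1
    have h3 := h1.unique h2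
    rw [real_inner_comm (D.shifted i t) (D.rho i t)] at h3
    linarith
  · rw [D.rho_eq j ht, real_inner_smul_right, shifted_eq,
      inner_translate_translate (D.γ_smooth i).continuous (D.γ_compact i)
        (contDiff_deriv (D.γ_smooth j)).continuous (D.γ_compact j).deriv]
    have : ∀ s, D.γ i s * deriv (D.γ j) s = 0 := by
      intro s
      by_cases hs : s ∈ tsupport (D.γ i)
      · have h1 : s ∉ tsupport (D.γ j) := fun h => (D.γ_disjoint i j hij).le_bot ⟨hs, h⟩
        have h2 : deriv (D.γ j) s = 0 := by
          by_contra h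
          exact h1 (support_deriv_subset h)
        rw [h2, mul_zero]
      · rw [image_eq_zero_of_notMem_tsupport hs, zero_mul]
    simp [this]

theorem inner_proj_shifted (j : Fin k) {t : ℝ} (ht : 0 < t) (f : L2R) :
    inner ℝ (D.proj t f) (D.shifted j t) = inner ℝ f (D.shifted j t) := by
  rw [proj, if_pos ht, sum_inner]
  simp [real_inner_smul_left, D.inner_shifted_shifted]

theorem inner_proj_rho (j : Fin k) {t : ℝ} (ht : 0 < t) (f : L2R) :
    inner ℝ (D.proj t f) (D.rho j t) = (0 : ℝ) := by
  rw [proj, if_pos ht, sum_inner]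
  simp [real_inner_smul_left, D.inner_shifted_rho _ _ ht.ne']

theorem inner_xi_shifted (j : Fin k) {t : ℝ} (ht : 0 < t) (f : L2R) :
    inner ℝ (D.xi t f) (D.shifted j t) = (0 : ℝ) := by
  rw [xi, sum_inner]
  refine Finset.sum_eq_zero fun i _ => ?_
  rw [real_inner_smul_left, real_inner_comm (D.shifted j t), D.inner_shifted_rho _ _ ht.ne',
    mul_zero]

end Frame

/-! ### Decay of the frame as `t → 0` -/

section Decay

theorem tendsto_one_div_nhdsGT : Tendsto (fun t : ℝ => 1 / t) (𝓝[>] 0) atTop := by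
  simpa only [one_div] using tendsto_inv_nhdsGT_zero (𝕜 := ℝ)

theorem tendsto_exp_one_div_nhdsGT : Tendsto (fun t : ℝ => Real.exp (1 / t)) (𝓝[>] 0) atTop :=
  Real.tendsto_exp_atTop.comp tendsto_one_div_nhdsGT

/-- The doubly exponential decay beats the derivative of `e^{1/t}`. -/
theorem tendsto_speed_mul_exp {c : ℝ} (hc : 0 < c) :
    Tendsto (fun t : ℝ => Real.exp (1 / t) / t ^ 2 * Real.exp (-(c * Real.exp (1 / t))))
      (𝓝[>] 0) (𝓝 0) := by
  have h := ((Real.tendsto_pow_mul_exp_neg_atTop_nhds_zero 2).comp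
    ((tendsto_exp_one_div_nhdsGT).const_mul_atTop hc)).const_mul (2 / c ^ 2)
  rw [mul_zero] at h
  refine squeeze_zero' ?_ ?_ h
  · exact Eventually.of_forall fun t => by positivity
  · filter_upwards [self_mem_nhdsWithin] with t ht
    have ht' : (0 : ℝ) < t := ht
    have h1 : (1 / t) ^ 2 / 2 ≤ Real.exp (1 / t) := by
      have := Real.quadratic_le_exp_of_nonneg (x := 1 / t) (by positivity)
      have : 0 < 1 / t := by positivity
      linarith
    have h2 : Real.exp (1 / t) / t ^ 2 ≤ 2 * Real.exp (1 / t) ^ 2 := by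
      have e : Real.exp (1 / t) / t ^ 2 = Real.exp (1 / t) * (1 / t) ^ 2 := by
        rw [one_div, inv_pow]; rfl
      rw [e]
      nlinarith [Real.exp_pos (1 / t)]
    have e2 : 2 / c ^ 2 * ((fun x => x ^ 2 * Real.exp (-x)) ∘ fun t => c * Real.exp (1 / t)) t
        = 2 * Real.exp (1 / t) ^ 2 * Real.exp (-(c * Real.exp (1 / t))) := by
      simp only [Function.comp_apply]
      field_simp
    rw [e2]
    exact mul_le_mul_of_nonneg_right h2 (Real.exp_pos _).le

theorem tendsto_inv_mul_exp {c : ℝ} (hc : 0 < c) :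
    Tendsto (fun t : ℝ => t⁻¹ * Real.exp (-(c * Real.exp (1 / t)))) (𝓝[>] 0) (𝓝 0) := by
  refine squeeze_zero' ?_ ?_ (tendsto_speed_mul_exp hc)
  · filter_upwards [self_mem_nhdsWithin] with t ht
    have ht' : (0 : ℝ) < t := ht
    positivity
  · filter_upwards [self_mem_nhdsWithin, Ioo_mem_nhdsGT (zero_lt_one' ℝ)] with t ht ht1
    have ht' : (0 : ℝ) < t := ht
    refine mul_le_mul_of_nonneg_right ?_ (Real.exp_pos _).le
    rw [le_div_iff₀ (by positivity)]
    have : t⁻¹ * t ^ 2 = t := by field_simp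
    rw [this]
    have := Real.add_one_le_exp (1 / t)
    have : 0 < 1 / t := by positivity
    linarith [ht1.2]

variable {k : ℕ} (D : GammaData k) {ι : Type*} {l : Filter ι} {t : ι → ℝ} {F : ι → L2R}

theorem tendsto_mul_inner_translate {g : ℝ → ℝ} (hg : Continuous g) (hc : HasCompactSupport g)
    {κ : ℝ → ℝ} (hκ : Tendsto (fun t : ℝ => κ t * Real.exp (-(D.δ 1 / 2 * Real.exp (1 / t))))
      (𝓝[>] 0) (𝓝 0)) (ht : Tendsto t l (𝓝[>] 0)) {M : ℝ}
    (hF : ∀ᶠ i in l, F i ∈ D.l2Scale.lev 1 ∧ D.l2Scale.nrm 1 (F i) ≤ M) :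
    Tendsto (fun i => κ (t i) * inner ℝ (F i) (translate g (Real.exp (1 / t i)))) l (𝓝 0) := by
  obtain ⟨C, R, hC, H⟩ := D.exists_abs_inner_translate_le hg hc
  have h1 := ((hκ.comp ht).norm.mul_const (C * M))
  rw [norm_zero, zero_mul] at h1
  refine squeeze_zero_norm' ?_ h1
  filter_upwards [hF, (tendsto_exp_one_div_nhdsGT.comp ht).eventually_ge_atTop R] with i hi hR
  have h2 := H _ hR (F i) (D.weightedInt_of_mem hi.1)
  have h3 := (D.sqrt_integral_le_nrm_one (F i)).trans hi.2
  rw [norm_mul, Real.norm_eq_abs (inner ℝ _ _), Function.comp_apply, norm_mul, mul_assoc,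
    Real.norm_of_nonneg (Real.exp_pos _).le]
  refine mul_le_mul_of_nonneg_left (h2.trans ?_) (norm_nonneg _)
  have h4 : 0 ≤ C * Real.exp (-(D.δ 1 / 2 * Real.exp (1 / t i))) := by positivity
  refine (mul_le_mul_of_nonneg_left h3 h4).trans (le_of_eq ?_)
  ring

theorem δ_one_pos : 0 < D.δ 1 / 2 := by
  have := D.δ_strictMono zero_lt_one
  rw [D.δ_zero] at this
  linarith

theorem tendsto_inv_mul_inner_shifted (j : Fin k) (ht : Tendsto t l (𝓝[>] 0)) {M : ℝ}
    (hF : ∀ᶠ i in l, F i ∈ D.l2Scale.lev 1 ∧ D.l2Scale.nrm 1 (F i) ≤ M) :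
    Tendsto (fun i => (t i)⁻¹ * inner ℝ (F i) (D.shifted j (t i))) l (𝓝 0) :=
  D.tendsto_mul_inner_translate (D.γ_smooth j).continuous (D.γ_compact j)
    (tendsto_inv_mul_exp D.δ_one_pos) ht hF

theorem tendsto_inner_rho (j : Fin k) (ht : Tendsto t l (𝓝[>] 0)) {M : ℝ}
    (hF : ∀ᶠ i in l, F i ∈ D.l2Scale.lev 1 ∧ D.l2Scale.nrm 1 (F i) ≤ M) :
    Tendsto (fun i => inner ℝ (F i) (D.rho j (t i))) l (𝓝 0) := by
  have h := D.tendsto_mul_inner_translate (contDiff_deriv (D.γ_smooth j)).continuous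
    (D.γ_compact j).deriv (κ := fun t => -(Real.exp (1 / t) / t ^ 2))
    (by simpa [neg_mul] using (tendsto_speed_mul_exp D.δ_one_pos).neg) ht hF
  refine h.congr' ?_
  filter_upwards [ht self_mem_nhdsWithin] with i hi
  rw [D.rho_eq j (ne_of_gt hi), real_inner_smul_right]

theorem tendsto_inner_shifted (j : Fin k) (ht : Tendsto t l (𝓝[>] 0)) {f : L2R}
    (hF : Tendsto F l (𝓝 f)) :
    Tendsto (fun i => inner ℝ (F i) (D.shifted j (t i))) l (𝓝 0) := by
  have h1 : Tendsto (fun i => inner ℝ f (D.shifted j (t i))) l (𝓝 0) :=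
    (tendsto_inner_translate (D.γ_smooth j).continuous (D.γ_compact j) f).comp
      (tendsto_exp_one_div_nhdsGT.comp ht)
  have h2 : Tendsto (fun i => inner ℝ (F i - f) (D.shifted j (t i))) l (𝓝 0) := by
    have h3 : Tendsto (fun i => ‖F i - f‖) l (𝓝 0) := tendsto_iff_norm_sub_tendsto_zero.1 hF
    refine squeeze_zero_norm (fun i => ?_) h3
    refine (abs_real_inner_le_norm _ _).trans (le_of_eq ?_)
    rw [D.norm_shifted, mul_one]
  have := h2.add h1
  rw [add_zero] at this
  refine this.congr fun i => ?_
  rw [inner_sub_left, sub_add_cancel]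

end Decay

end GammaData

/-! ### Holomorphic functions on `Γ_1²` vanishing for `t ≤ 0` -/

namespace GammaData

section Coord

variable {k n : ℕ} (D : GammaData k)

/-- The derivative of `(x, t, f) ↦ ⟨f, γ_{j,t}⟩` at a point with `t > 0`. -/
noncomputable def coordDeriv (j : Fin k) (p : (Fin n → ℝ) × ℝ × L2R) :
    (Fin n → ℝ) × ℝ × L2R →L[ℝ] ℝ :=
  (innerSL ℝ (D.shifted j p.2.1)) ∘L (ContinuousLinearMap.snd ℝ ℝ L2R) ∘L
      (ContinuousLinearMap.snd ℝ (Fin n → ℝ) (ℝ × L2R)) +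
    (inner ℝ p.2.2 (D.rho j p.2.1)) • ((ContinuousLinearMap.fst ℝ ℝ L2R) ∘L
      (ContinuousLinearMap.snd ℝ (Fin n → ℝ) (ℝ × L2R)))

theorem coordDeriv_apply (j : Fin k) (p h : (Fin n → ℝ) × ℝ × L2R) :
    D.coordDeriv j p h = inner ℝ h.2.2 (D.shifted j p.2.1)
      + inner ℝ p.2.2 (D.rho j p.2.1) * h.2.1 := by
  simp [coordDeriv, real_inner_comm]

theorem hasFDerivAt_coord (j : Fin k) {p : (Fin n → ℝ) × ℝ × L2R} (ht : 0 < p.2.1) :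
    HasFDerivAt (fun p : (Fin n → ℝ) × ℝ × L2R => inner ℝ p.2.2 (D.shifted j p.2.1))
      (D.coordDeriv j p) p := by
  have h1 : HasFDerivAt (fun p : (Fin n → ℝ) × ℝ × L2R => p.2.1)
      ((ContinuousLinearMap.fst ℝ ℝ L2R) ∘L
        (ContinuousLinearMap.snd ℝ (Fin n → ℝ) (ℝ × L2R))) p :=
    ((ContinuousLinearMap.fst ℝ ℝ L2R) ∘L
      (ContinuousLinearMap.snd ℝ (Fin n → ℝ) (ℝ × L2R))).hasFDerivAt
  have h2 : HasFDerivAt (fun p : (Fin n → ℝ) × ℝ × L2R => p.2.2)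
      ((ContinuousLinearMap.snd ℝ ℝ L2R) ∘L
        (ContinuousLinearMap.snd ℝ (Fin n → ℝ) (ℝ × L2R))) p :=
    ((ContinuousLinearMap.snd ℝ ℝ L2R) ∘L
      (ContinuousLinearMap.snd ℝ (Fin n → ℝ) (ℝ × L2R))).hasFDerivAt
  have h3 := h2.inner ℝ ((D.hasDerivAt_shifted j ht.ne').hasFDerivAt.comp p h1)
  refine h3.congr_fderiv ?_
  ext h <;> simp [coordDeriv, real_inner_comm, mul_comm]

end Coord

variable (D : GammaData 2)

/-- The complex fibre coordinate `⟨f, γ_{1,t}⟩ + i ⟨f, γ_{2,t}⟩` (for `t > 0`). -/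
noncomputable def wCoord (p : (Fin 1 → ℝ) × ℝ × L2R) : ℂ :=
  ⟨inner ℝ p.2.2 (D.shifted 0 p.2.1), inner ℝ p.2.2 (D.shifted 1 p.2.1)⟩

/-- The derivative of the fibre coordinate at a point with `t > 0`. -/
noncomputable def wDeriv (p : (Fin 1 → ℝ) × ℝ × L2R) : (Fin 1 → ℝ) × ℝ × L2R →L[ℝ] ℂ :=
  Complex.ofRealCLM ∘L D.coordDeriv 0 p + Complex.I • (Complex.ofRealCLM ∘L D.coordDeriv 1 p)

theorem wDeriv_apply (p h : (Fin 1 → ℝ) × ℝ × L2R) :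
    D.wDeriv p h = D.coordDeriv 0 p h + Complex.I * D.coordDeriv 1 p h := by
  simp [wDeriv]

theorem wCoord_eq (p : (Fin 1 → ℝ) × ℝ × L2R) :
    D.wCoord p = ((inner ℝ p.2.2 (D.shifted 0 p.2.1) : ℝ) : ℂ)
      + Complex.I * ((inner ℝ p.2.2 (D.shifted 1 p.2.1) : ℝ) : ℂ) := by
  apply Complex.ext <;> simp [wCoord]

theorem hasFDerivAt_wCoord {p : (Fin 1 → ℝ) × ℝ × L2R} (ht : 0 < p.2.1) :
    HasFDerivAt D.wCoord (D.wDeriv p) p := by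
  have h0 := Complex.ofRealCLM.hasFDerivAt.comp p (D.hasFDerivAt_coord 0 ht)
  have h1 := Complex.ofRealCLM.hasFDerivAt.comp p (D.hasFDerivAt_coord 1 ht)
  refine (h0.add (h1.const_smul Complex.I)).congr_of_eventuallyEq
    (Eventually.of_forall fun q => ?_)
  rw [D.wCoord_eq]
  rfl

theorem wCoord_retr {p : (Fin 1 → ℝ) × ℝ × L2R} (ht : 0 < p.2.1) :
    D.wCoord (D.retr 1 p) = D.wCoord p := by
  simp only [wCoord, retr, D.inner_proj_shifted _ ht]

/-- On `TΓ_1²`, the fibre coordinate is complex linear, as `⟨f, ρ_{j,t}⟩ = 0` for `f` in the span of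
the `γ_{j,t}`. -/
theorem wDeriv_cplx {p : (Fin 1 → ℝ) × ℝ × L2R} (ht : 0 < p.2.1) (hp : D.retr 1 p = p)
    (w : (Fin 1 → ℝ) × ℝ × L2R) :
    D.wDeriv p (D.cplx 1 p w) = Complex.I * D.wDeriv p w := by
  have hf : D.proj p.2.1 p.2.2 = p.2.2 := congrArg (fun q => q.2.2) hp
  have hρ : ∀ j, inner ℝ p.2.2 (D.rho j p.2.1) = (0 : ℝ) := fun j => by
    rw [← hf, D.inner_proj_rho j ht]
  have h0 : inner ℝ (D.cplx 1 p w).2.2 (D.shifted 0 p.2.1)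
      = -(inner ℝ w.2.2 (D.shifted 1 p.2.1) : ℝ) := by
    simp [cplx, ht, Fin.sum_univ_two, inner_add_left, real_inner_smul_left,
      D.inner_shifted_shifted, D.inner_xi_shifted _ ht, rot, coeffSeq, D.norm_shifted]
  have h1 : inner ℝ (D.cplx 1 p w).2.2 (D.shifted 1 p.2.1)
      = (inner ℝ w.2.2 (D.shifted 0 p.2.1) : ℝ) := by
    simp [cplx, ht, Fin.sum_univ_two, inner_add_left, real_inner_smul_left,
      D.inner_shifted_shifted, D.inner_xi_shifted _ ht, rot, coeffSeq, D.norm_shifted]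
  simp only [D.wDeriv_apply, D.coordDeriv_apply, hρ, h0, h1]
  apply Complex.ext <;> simp

/-- Coefficients `a` for which `a(z) w^{k+1}` extends by zero to an sc-holomorphic function: those
holomorphic on the upper half plane and, together with the derivative, bounded on its bounded
subsets. -/
structure IsBoundedCoefficient (a : ℂ → ℂ) : Prop where
  differentiableOn : DifferentiableOn ℂ a {z | 0 < z.im}
  bounded : ∀ M : ℝ, ∃ C : ℝ, ∀ z : ℂ, 0 < z.im → ‖z‖ ≤ M → ‖a z‖ ≤ C ∧ ‖deriv a z‖ ≤ C

/-- The function `a(z) w^{k+1}` for `t > 0`, extended by `0`. -/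
noncomputable def extendByZero (a : ℂ → ℂ) (k : ℕ) (p : (Fin 1 → ℝ) × ℝ × L2R) : ℂ :=
  if 0 < p.2.1 then a (zCoord 0 p) * D.wCoord p ^ (k + 1) else 0

/-- The derivative of `extendByZero`. -/
noncomputable def extendByZeroDeriv (a : ℂ → ℂ) (k : ℕ) (p : (Fin 1 → ℝ) × ℝ × L2R) :
    (Fin 1 → ℝ) × ℝ × L2R →L[ℝ] ℂ :=
  if 0 < p.2.1 then
    (D.wCoord p ^ (k + 1) * deriv a (zCoord 0 p)) • zCoord 0 +
      (a (zCoord 0 p) * ((k + 1) * D.wCoord p ^ k)) • D.wDeriv p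
  else 0

variable {a : ℂ → ℂ} (k : ℕ)

theorem zCoord_im (p : (Fin 1 → ℝ) × ℝ × L2R) : (zCoord 0 p).im = p.2.1 := by
  rw [zCoord_apply]

theorem isOpen_upper : IsOpen {z : ℂ | 0 < z.im} := isOpen_lt continuous_const Complex.continuous_im

theorem eventually_pos {p : (Fin 1 → ℝ) × ℝ × L2R} (ht : 0 < p.2.1) :
    ∀ᶠ q : (Fin 1 → ℝ) × ℝ × L2R in 𝓝 p, 0 < q.2.1 :=
  (isOpen_lt continuous_const (continuous_fst.comp continuous_snd)).mem_nhds ht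

theorem hasFDerivAt_extendByZero (ha : IsBoundedCoefficient a) {p : (Fin 1 → ℝ) × ℝ × L2R}
    (ht : 0 < p.2.1) :
    HasFDerivAt (D.extendByZero a k) (D.extendByZeroDeriv a k p) p := by
  have hz : 0 < (zCoord 0 p).im := by rwa [zCoord_im]
  have h1 := ((ha.differentiableOn.differentiableAt (isOpen_upper.mem_nhds hz)).hasDerivAt
    ).comp_hasFDerivAt p (zCoord 0).hasFDerivAt
  have h2 := (hasDerivAt_pow (k + 1) (D.wCoord p)).comp_hasFDerivAt p (D.hasFDerivAt_wCoord ht)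
  have h3 := h1.mul h2
  have e : D.extendByZeroDeriv a k p = (a ∘ ⇑(zCoord 0)) p •
      (((k + 1 : ℕ) : ℂ) * D.wCoord p ^ (k + 1 - 1)) • D.wDeriv p +
      ((fun x => x ^ (k + 1)) ∘ D.wCoord) p • deriv a (zCoord 0 p) • zCoord 0 := by
    rw [extendByZeroDeriv, if_pos ht, smul_smul, smul_smul, add_comm]
    simp
  rw [e]
  refine h3.congr_of_eventuallyEq ?_
  filter_upwards [eventually_pos ht] with q hq
  simp [extendByZero, hq]

section Boundary

variable {D} {ι : Type*} {l : Filter ι} {q : ι → (Fin 1 → ℝ) × ℝ × L2R}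
  {p : (Fin 1 → ℝ) × ℝ × L2R}

/-- `t → 0` from above along a filter on which the points with `t > 0` converge to a point with
`t ≤ 0`. -/
theorem tendsto_nhdsGT (hq : Tendsto q l (𝓝 p)) (ht : p.2.1 ≤ 0) (hpos : ∀ᶠ i in l, 0 < (q i).2.1) :
    Tendsto (fun i => (q i).2.1) l (𝓝[>] 0) := by
  have h1 : Tendsto (fun i => (q i).2.1) l (𝓝 p.2.1) :=
    ((continuous_fst.comp continuous_snd).tendsto p).comp hq
  refine tendsto_nhdsWithin_iff.2 ⟨?_, hpos⟩
  rcases eq_or_neBot l with rfl | hl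
  · exact tendsto_bot
  · have h2 : (0 : ℝ) ≤ p.2.1 := ge_of_tendsto h1 (hpos.mono fun i hi => hi.le)
    rwa [← ht.antisymm h2]

theorem tendsto_wCoord (hq : Tendsto q l (𝓝 p)) (ht : p.2.1 ≤ 0)
    (hpos : ∀ᶠ i in l, 0 < (q i).2.1) : Tendsto (fun i => D.wCoord (q i)) l (𝓝 0) := by
  have h2 : Tendsto (fun i => (q i).2.2) l (𝓝 p.2.2) :=
    ((continuous_snd.comp continuous_snd).tendsto p).comp hq
  have h3 := fun j => D.tendsto_inner_shifted j (tendsto_nhdsGT hq ht hpos) h2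
  have h4 := ((Complex.continuous_ofReal.tendsto 0).comp (h3 0)).add
    (((Complex.continuous_ofReal.tendsto 0).comp (h3 1)).const_mul Complex.I)
  simp only [Complex.ofReal_zero, mul_zero, add_zero] at h4
  exact h4.congr fun i => (D.wCoord_eq _).symm

theorem eventually_coefficient_le (ha : IsBoundedCoefficient a) (hq : Tendsto q l (𝓝 p))
    (hpos : ∀ᶠ i in l, 0 < (q i).2.1) : ∃ C : ℝ, ∀ᶠ i in l,
      ‖a (zCoord 0 (q i))‖ ≤ C ∧ ‖deriv a (zCoord 0 (q i))‖ ≤ C := by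
  obtain ⟨C, hC⟩ := ha.bounded (‖zCoord 0 p‖ + 1)
  refine ⟨C, ?_⟩
  have h1 : Tendsto (fun i => ‖zCoord 0 (q i)‖) l (𝓝 ‖zCoord 0 p‖) :=
    (((zCoord 0).continuous.tendsto p).comp hq).norm
  filter_upwards [hpos, h1.eventually (ge_mem_nhds (lt_add_one _))] with i hi h2
  exact hC _ (by rwa [zCoord_im]) h2

theorem tendsto_mul_of_bounded {u v : ι → ℂ} {C : ℝ} (hu : ∀ᶠ i in l, ‖u i‖ ≤ C)
    (hv : Tendsto v l (𝓝 0)) : Tendsto (fun i => u i * v i) l (𝓝 0) := by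
  have h := hv.norm.const_mul C
  rw [norm_zero, mul_zero] at h
  refine squeeze_zero_norm' ?_ h
  filter_upwards [hu] with i hi
  rw [norm_mul]
  exact mul_le_mul_of_nonneg_right hi (norm_nonneg _)

end Boundary

theorem continuous_extendByZero (ha : IsBoundedCoefficient a) :
    Continuous (D.extendByZero a k) := by
  refine continuous_iff_continuousAt.2 fun p => ?_
  rcases lt_or_ge 0 p.2.1 with ht | ht
  · exact (D.hasFDerivAt_extendByZero k ha ht).continuousAt
  · have h0 : D.extendByZero a k p = 0 := if_neg (not_lt.2 ht)
    rw [ContinuousAt, h0]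
    refine Tendsto.if ?_ tendsto_const_nhds
    have hq : Tendsto (fun q : (Fin 1 → ℝ) × ℝ × L2R => q) (𝓝 p ⊓ 𝓟 {q | 0 < q.2.1}) (𝓝 p) :=
      inf_le_left
    have hpos : ∀ᶠ q in 𝓝 p ⊓ 𝓟 {q : (Fin 1 → ℝ) × ℝ × L2R | 0 < q.2.1}, 0 < q.2.1 :=
      mem_inf_of_right (mem_principal_self _)
    obtain ⟨C, hC⟩ := eventually_coefficient_le ha hq hpos
    refine tendsto_mul_of_bounded (hC.mono fun i hi => hi.1) ?_
    simpa using (tendsto_wCoord (D := D) hq ht hpos).pow (k + 1)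

/-- The extension by zero is flat at `t ≤ 0`: at level `1` the fibre coordinate `w` is `o(t)`, and
`t ≤ ‖h‖_1` at a point `p + h` with `t > 0`, as `p` has `t ≤ 0`. -/
theorem hasScDerivAt_extendByZero_zero (ha : IsBoundedCoefficient a)
    {p : (Fin 1 → ℝ) × ℝ × L2R} (hp : p ∈ (D.scale 1).lev 1) (ht : p.2.1 ≤ 0) :
    HasScDerivAt (D.scale 1) (constScale ℂ) (D.extendByZero a k) Set.univ p 0 := by
  refine ⟨⟨0, fun h _ => ⟨trivial, by simp [constScale]⟩⟩, fun ε hε => ?_⟩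
  set N : (Fin 1 → ℝ) × ℝ × L2R → ℝ := (D.scale 1).nrm 1
  -- the filter of increments `h` that tend to `0` in `E_1` and lead to points with `t > 0`
  set l : Filter ((Fin 1 → ℝ) × ℝ × L2R) :=
    comap N (𝓝 0) ⊓ 𝓟 {h | h ∈ (D.scale 1).lev 1 ∧ 0 < (p + h).2.1} with hl
  have hmem : ∀ᶠ h in l, h ∈ (D.scale 1).lev 1 ∧ 0 < (p + h).2.1 :=
    mem_inf_of_right (mem_principal_self _)
  have hN : Tendsto N l (𝓝 0) := tendsto_comap.mono_left inf_le_left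
  obtain ⟨K, hK, hle⟩ := (D.isNested_scale 1).nrm_le zero_le_one
  have hq : Tendsto (fun h => p + h) l (𝓝 p) := by
    have : Tendsto (fun h : (Fin 1 → ℝ) × ℝ × L2R => h) l (𝓝 0) := by
      refine squeeze_zero_norm' ?_ (by simpa using hN.const_mul K)
      filter_upwards [hmem] with h hh
      rw [← D.scale_nrm_zero]
      exact hle h hh.1
    simpa using this.const_add p
  have hpos := hmem.mono fun h hh => hh.2
  have htt := tendsto_nhdsGT hq ht hpos
  have hsmall : ∀ᶠ h in l, h.2.2 ∈ D.l2Scale.lev 1 ∧ D.l2Scale.nrm 1 h.2.2 ≤ 1 := by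
    filter_upwards [hmem, hN.eventually (ge_mem_nhds one_pos)] with h hh h1
    exact ⟨hh.1.2.2, (D.l2_nrm_le_scale_nrm 1 1 h).trans h1⟩
  have hw : Tendsto (fun h => ((p + h).2.1⁻¹ : ℂ) * D.wCoord (p + h)) l (𝓝 0) := by
    have h3 : ∀ j, Tendsto (fun h : (Fin 1 → ℝ) × ℝ × L2R => (p + h).2.1⁻¹ *
        inner ℝ (p + h).2.2 (D.shifted j (p + h).2.1)) l (𝓝 0) := fun j => by
      have h1 := D.tendsto_inv_mul_inner_shifted j htt (F := fun _ => p.2.2)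
        (M := D.l2Scale.nrm 1 p.2.2) (Eventually.of_forall fun _ => ⟨hp.2.2, le_rfl⟩)
      have h2 := (h1.add (D.tendsto_inv_mul_inner_shifted j htt hsmall))
      rw [add_zero] at h2
      refine h2.congr fun h => ?_
      rw [← mul_add, ← inner_add_left]
      rfl
    have h4 := ((Complex.continuous_ofReal.tendsto 0).comp (h3 0)).add
      (((Complex.continuous_ofReal.tendsto 0).comp (h3 1)).const_mul Complex.I)
    simp only [Complex.ofReal_zero, mul_zero, add_zero] at h4
    refine h4.congr fun h => ?_
    rw [D.wCoord_eq]
    simp only [Function.comp_apply, Complex.ofReal_mul, Complex.ofReal_inv]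
    ring
  obtain ⟨C, hC⟩ := eventually_coefficient_le ha hq hpos
  have hfin : Tendsto (fun h => (a (zCoord 0 (p + h)) * D.wCoord (p + h) ^ k) *
      (((p + h).2.1⁻¹ : ℂ) * D.wCoord (p + h))) l (𝓝 0) := by
    have h1 : ∀ᶠ h in l, ‖D.wCoord (p + h) ^ k‖ ≤ 1 := by
      have := (tendsto_wCoord (D := D) hq ht hpos).norm
      rw [norm_zero] at this
      filter_upwards [this.eventually (ge_mem_nhds one_pos)] with h hh
      rw [norm_pow]
      exact pow_le_one₀ (norm_nonneg _) hh
    refine tendsto_mul_of_bounded (C := C) ?_ hw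
    filter_upwards [h1, hC] with h h1 h2
    rw [norm_mul]
    exact (mul_le_of_le_one_right (norm_nonneg _) h1).trans h2.1
  have hev : ∀ᶠ h in l, ‖D.extendByZero a k (p + h)‖ ≤ ε * N h := by
    have := hfin.norm
    rw [norm_zero] at this
    filter_upwards [this.eventually (ge_mem_nhds hε), hmem] with h h1 h2
    have h3 : 0 < (p + h).2.1 := h2.2
    have h4 : (p + h).2.1 ≤ N h := by
      have h5 : (p + h).2.1 ≤ |h.2.1| := by
        change p.2.1 + h.2.1 ≤ _
        linarith [le_abs_self h.2.1]
      exact h5.trans ((le_max_right ‖h.1‖ _).trans (D.norm_le_scale_nrm 1 1 h))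
    have e : D.extendByZero a k (p + h) = ((p + h).2.1 : ℂ) *
        ((a (zCoord 0 (p + h)) * D.wCoord (p + h) ^ k) *
          (((p + h).2.1⁻¹ : ℂ) * D.wCoord (p + h))) := by
      have h6 : ((p + h).2.1 : ℂ) ≠ 0 := by exact_mod_cast h3.ne'
      rw [extendByZero, if_pos h3, pow_succ]
      field_simp
    rw [e, norm_mul, Complex.norm_real, Real.norm_of_nonneg h3.le, mul_comm]
    exact mul_le_mul h1 h4 h3.le hε.le
  rw [hl, eventually_inf_principal, eventually_comap] at hev
  obtain ⟨d, hd, H⟩ := Metric.eventually_nhds_iff.1 hev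
  refine ⟨d, hd, fun h hh _ hlt => ?_⟩
  have h0 : D.extendByZero a k p = 0 := if_neg (not_lt.2 ht)
  rw [h0, LinearMap.zero_apply, sub_zero, sub_zero]
  change ‖_‖ ≤ _
  by_cases hp' : 0 < (p + h).2.1
  · refine H (y := N h) ?_ h rfl ⟨hh, hp'⟩
    rw [Real.dist_0_eq_abs, abs_of_nonneg (D.scale_nrm_nonneg 1 1 h)]
    exact hlt
  · rw [extendByZero, if_neg hp', norm_zero]
    exact mul_nonneg hε.le (D.scale_nrm_nonneg 1 1 h)

theorem continuousAt_wDeriv {q : ((Fin 1 → ℝ) × ℝ × L2R) × ((Fin 1 → ℝ) × ℝ × L2R)}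
    (ht : 0 < q.1.2.1) :
    ContinuousAt (fun q : ((Fin 1 → ℝ) × ℝ × L2R) × ((Fin 1 → ℝ) × ℝ × L2R) =>
      D.wDeriv q.1 q.2) q := by
  have h : ∀ j, ContinuousAt (fun q : ((Fin 1 → ℝ) × ℝ × L2R) × ((Fin 1 → ℝ) × ℝ × L2R) =>
      D.coordDeriv j q.1 q.2) q := fun j => by
    simp only [D.coordDeriv_apply]
    have ht1 : ContinuousAt (fun q : ((Fin 1 → ℝ) × ℝ × L2R) × ((Fin 1 → ℝ) × ℝ × L2R) =>
      q.1.2.1) q := by fun_prop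
    have h1 := ContinuousAt.comp (f := fun q : ((Fin 1 → ℝ) × ℝ × L2R) ×
      ((Fin 1 → ℝ) × ℝ × L2R) => q.1.2.1) (D.hasDerivAt_shifted j ht.ne').continuousAt ht1
    have h2 := ContinuousAt.comp (f := fun q : ((Fin 1 → ℝ) × ℝ × L2R) ×
      ((Fin 1 → ℝ) × ℝ × L2R) => q.1.2.1) (D.continuousAt_rho j ht.ne') ht1
    refine ContinuousAt.add (ContinuousAt.inner ?_ h1)
      (ContinuousAt.mul (ContinuousAt.inner ?_ h2) ?_) <;> fun_prop
  simp only [D.wDeriv_apply]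
  exact (Complex.continuous_ofReal.continuousAt.comp (h 0)).add
    (continuousAt_const.mul (Complex.continuous_ofReal.continuousAt.comp (h 1)))

theorem continuousAt_extendByZeroDeriv (ha : IsBoundedCoefficient a)
    {q : ((Fin 1 → ℝ) × ℝ × L2R) × ((Fin 1 → ℝ) × ℝ × L2R)} (ht : 0 < q.1.2.1) :
    ContinuousAt (fun q : ((Fin 1 → ℝ) × ℝ × L2R) × ((Fin 1 → ℝ) × ℝ × L2R) =>
      D.extendByZeroDeriv a k q.1 q.2) q := by
  have hz : 0 < (zCoord 0 q.1).im := by rwa [zCoord_im]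
  have hzc : ContinuousAt (fun q : ((Fin 1 → ℝ) × ℝ × L2R) × ((Fin 1 → ℝ) × ℝ × L2R) =>
    zCoord 0 q.1) q := ((zCoord 0).continuous.comp continuous_fst).continuousAt
  have h1 := ContinuousAt.comp (f := fun q : ((Fin 1 → ℝ) × ℝ × L2R) × ((Fin 1 → ℝ) × ℝ × L2R) =>
    zCoord 0 q.1) (ha.differentiableOn.differentiableAt (isOpen_upper.mem_nhds hz)).continuousAt hzc
  have h2 := ContinuousAt.comp (f := fun q : ((Fin 1 → ℝ) × ℝ × L2R) × ((Fin 1 → ℝ) × ℝ × L2R) =>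
    zCoord 0 q.1) (((ha.differentiableOn.deriv isOpen_upper).differentiableAt
      (isOpen_upper.mem_nhds hz)).continuousAt) hzc
  have h3 := ContinuousAt.comp (f := fun q : ((Fin 1 → ℝ) × ℝ × L2R) × ((Fin 1 → ℝ) × ℝ × L2R) =>
    q.1) (D.hasFDerivAt_wCoord ht).continuousAt continuousAt_fst
  have h4 := D.continuousAt_wDeriv ht
  have h5 : ContinuousAt (fun q : ((Fin 1 → ℝ) × ℝ × L2R) × ((Fin 1 → ℝ) × ℝ × L2R) =>
    zCoord 0 q.2) q := ((zCoord 0).continuous.comp continuous_snd).continuousAt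
  have h6 := (((h3.pow (k + 1)).mul h2).mul h5).add
    ((h1.mul (continuousAt_const (y := (k + 1 : ℂ)) |>.mul (h3.pow k))).mul h4)
  refine h6.congr ?_
  filter_upwards [continuousAt_fst.eventually (eventually_pos ht)] with q hq
  simp [extendByZeroDeriv, hq]

/-- The derivative tends to `0` at points with `t ≤ 0`, for the norm of `E_1` in the base point and
of `E_0` in the direction: the derivative of `w` involves `⟨f, ρ_{j,t}⟩`, which is controlled by the
base point, and `⟨δf, γ_{j,t}⟩`, which tends to `0` for `δf` in `E_0`. -/
theorem exists_extendByZeroDeriv_lt (ha : IsBoundedCoefficient a)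
    {q : ((Fin 1 → ℝ) × ℝ × L2R) × ((Fin 1 → ℝ) × ℝ × L2R)} (hq1 : q.1 ∈ (D.scale 1).lev 1)
    (ht : q.1.2.1 ≤ 0) {ε : ℝ} (hε : 0 < ε) :
    ∃ d > 0, ∀ q' ∈ tangentSet (D.scale 1) Set.univ, (D.scale 1).nrm 1 (q'.1 - q.1) < d →
      (D.scale 1).nrm 0 (q'.2 - q.2) < d → ‖D.extendByZeroDeriv a k q'.1 q'.2‖ < ε := by
  set N : ((Fin 1 → ℝ) × ℝ × L2R) × ((Fin 1 → ℝ) × ℝ × L2R) → ℝ := fun q' =>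
    max ((D.scale 1).nrm 1 (q'.1 - q.1)) ((D.scale 1).nrm 0 (q'.2 - q.2)) with hNdef
  set l : Filter (((Fin 1 → ℝ) × ℝ × L2R) × ((Fin 1 → ℝ) × ℝ × L2R)) :=
    comap N (𝓝 0) ⊓ 𝓟 {q' | q'.1 ∈ (D.scale 1).lev 1 ∧ 0 < q'.1.2.1} with hl
  have hmem : ∀ᶠ q' in l, q'.1 ∈ (D.scale 1).lev 1 ∧ 0 < q'.1.2.1 :=
    mem_inf_of_right (mem_principal_self _)
  have hN : Tendsto N l (𝓝 0) := tendsto_comap.mono_left inf_le_left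
  obtain ⟨K, hK, hle⟩ := (D.isNested_scale 1).nrm_le zero_le_one
  have hfst : Tendsto (fun q' => q'.1) l (𝓝 q.1) := by
    refine tendsto_iff_norm_sub_tendsto_zero.2
      (squeeze_zero' (Eventually.of_forall fun _ => norm_nonneg _) ?_
        (by simpa using hN.const_mul K))
    filter_upwards [hmem] with q' hq'
    rw [← D.scale_nrm_zero]
    exact (hle _ (sub_mem hq'.1 hq1)).trans
      (mul_le_mul_of_nonneg_left (le_max_left _ _) hK.le)
  have hsnd : Tendsto (fun q' => q'.2) l (𝓝 q.2) := by
    refine tendsto_iff_norm_sub_tendsto_zero.2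
      (squeeze_zero (fun _ => norm_nonneg _) (fun q' => ?_) hN)
    rw [← D.scale_nrm_zero]
    exact le_max_right _ _
  have hpos := hmem.mono fun h hh => hh.2
  have htt := tendsto_nhdsGT hfst ht hpos
  have hsmall : ∀ᶠ q' in l, (q'.1 - q.1).2.2 ∈ D.l2Scale.lev 1 ∧
      D.l2Scale.nrm 1 (q'.1 - q.1).2.2 ≤ 1 := by
    filter_upwards [hmem, hN.eventually (ge_mem_nhds one_pos)] with q' hh h1
    exact ⟨(sub_mem hh.1 hq1).2.2,
      (D.l2_nrm_le_scale_nrm 1 1 _).trans ((le_max_left _ _).trans h1)⟩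
  have hw := tendsto_wCoord (D := D) hfst ht hpos
  have hdw : Tendsto (fun q' => D.wDeriv q'.1 q'.2) l (𝓝 0) := by
    have h3 : ∀ j, Tendsto (fun q' => D.coordDeriv j q'.1 q'.2) l (𝓝 0) := fun j => by
      simp only [D.coordDeriv_apply]
      have h1 := D.tendsto_inner_shifted j htt
        (((continuous_snd.comp continuous_snd).tendsto q.2).comp hsnd)
      have h2 := D.tendsto_inner_rho j htt (F := fun _ => q.1.2.2)
        (M := D.l2Scale.nrm 1 q.1.2.2) (Eventually.of_forall fun _ => ⟨hq1.2.2, le_rfl⟩)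
      have h4 := (h2.add (D.tendsto_inner_rho j htt hsmall)).mul
        (((continuous_fst.comp continuous_snd).tendsto q.2).comp hsnd)
      rw [add_zero, zero_mul] at h4
      have h5 := h1.add h4
      rw [add_zero] at h5
      refine h5.congr fun q' => ?_
      rw [← inner_add_left]
      have : q.1.2.2 + (q'.1 - q.1).2.2 = q'.1.2.2 := add_sub_cancel _ _
      rw [this]
      rfl
    have h4 := ((Complex.continuous_ofReal.tendsto 0).comp (h3 0)).add
      (((Complex.continuous_ofReal.tendsto 0).comp (h3 1)).const_mul Complex.I)
    simp only [Complex.ofReal_zero, mul_zero, add_zero] at h4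
    exact h4.congr fun q' => (D.wDeriv_apply _ _).symm
  obtain ⟨C, hC⟩ := eventually_coefficient_le ha hfst hpos
  have hz : Tendsto (fun q' => zCoord 0 q'.2) l (𝓝 (zCoord 0 q.2)) :=
    ((zCoord 0).continuous.tendsto _).comp hsnd
  have h1 : Tendsto (fun q' => deriv a (zCoord 0 q'.1) *
      (D.wCoord q'.1 ^ (k + 1) * zCoord 0 q'.2)) l (𝓝 0) := by
    refine tendsto_mul_of_bounded (hC.mono fun i hi => hi.2) ?_
    simpa using (hw.pow (k + 1)).mul hz
  have h2 : Tendsto (fun q' => a (zCoord 0 q'.1) *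
      (((k + 1 : ℂ) * D.wCoord q'.1 ^ k) * D.wDeriv q'.1 q'.2)) l (𝓝 0) := by
    refine tendsto_mul_of_bounded (hC.mono fun i hi => hi.1) ?_
    simpa using ((hw.pow k).const_mul (k + 1 : ℂ)).mul hdw
  have h3 := (h1.add h2).norm
  rw [add_zero, norm_zero] at h3
  have hev := h3.eventually (gt_mem_nhds hε)
  rw [hl, eventually_inf_principal, eventually_comap] at hev
  obtain ⟨d, hd, H⟩ := Metric.eventually_nhds_iff.1 hev
  refine ⟨d, hd, fun q' hq' hlt hlt' => ?_⟩
  by_cases hp' : 0 < q'.1.2.1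
  · have := H (y := N q') (by
      rw [Real.dist_0_eq_abs, abs_of_nonneg (le_max_of_le_left (D.scale_nrm_nonneg 1 1 _))]
      exact max_lt hlt hlt') q' rfl ⟨hq'.2.1, hp'⟩
    refine lt_of_eq_of_lt (congrArg norm ?_) this
    simp only [extendByZeroDeriv, if_pos hp', add_apply, smul_apply, smul_eq_mul]
    ring
  · rw [extendByZeroDeriv, if_neg hp', zero_apply, norm_zero]
    exact hε

theorem pull_extendByZero (a : ℂ → ℂ) :
    pull Set.univ (D.retr 1) (fun p : D.Gam 1 => D.extendByZero a k p.1) = D.extendByZero a k := by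
  funext x
  rw [pull_apply (D.extendByZero a k) (Set.mem_univ x)]
  by_cases ht : 0 < x.2.1
  · have ht' : 0 < (D.retr 1 x).2.1 := ht
    rw [extendByZero, extendByZero, if_pos ht, if_pos ht', D.wCoord_retr ht]
    rw [D.zCoord_retr 0]
  · have ht' : ¬ 0 < (D.retr 1 x).2.1 := ht
    rw [extendByZero, extendByZero, if_neg ht, if_neg ht']

/-- The functions `a(z) w^{k+1}`, extended by zero, are sc-holomorphic on `Γ_1²`. -/
theorem isScHolomorphic_extendByZero (ha : IsBoundedCoefficient a) :
    IsScHolomorphic (D.scale 1) Set.univ (D.retr 1) (D.cplx 1)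
      (fun p => D.extendByZero a k p.1) := by
  have hD : ∀ x ∈ (D.scale 1).lev 1, HasScDerivAt (D.scale 1) (constScale ℂ) (D.extendByZero a k)
      Set.univ x (D.extendByZeroDeriv a k x).toLinearMap := fun x hx => by
    rcases lt_or_ge 0 x.2.1 with ht | ht
    · exact D.hasScDerivAt_of_hasFDerivAt (D.hasFDerivAt_extendByZero k ha ht)
    · rw [extendByZeroDeriv, if_neg (not_lt.2 ht)]
      exact D.hasScDerivAt_extendByZero_zero k ha hx ht
  refine ⟨?_, fun p hp hp1 => ⟨_, D.pull_extendByZero k a ▸ hD p hp1, fun w _ => ?_⟩⟩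
  · rw [IsScOnRetract, pull_extendByZero]
    refine isSc_one_of_level_zero (D.isNested_scale _) (fun x _ _ ε hε => ?_)
      (fun x _ hx => hD x hx) (fun q hq ε hε => ?_)
    · obtain ⟨d, hd, H⟩ := D.exists_nrm_zero_lt
        (D.continuous_extendByZero k ha).continuousAt (x := x) ε hε
      exact ⟨d, hd, fun y _ _ hy => H y hy⟩
    · rcases lt_or_ge 0 q.1.2.1 with ht | ht
      · exact D.exists_nrm_tangent_lt hq.2.1 (D.continuousAt_extendByZeroDeriv k ha ht) ε hε
      · have h0 : D.extendByZeroDeriv a k q.1 = 0 := if_neg (not_lt.2 ht)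
        simpa [h0] using D.exists_extendByZeroDeriv_lt k ha hq.2.1 ht hε
  · by_cases ht : 0 < p.2.1
    · have hp' : D.retr 1 p = p := by
        obtain ⟨x, -, rfl⟩ := hp
        have ht' : 0 < x.2.1 := ht
        refine Prod.ext rfl (Prod.ext rfl ?_)
        change D.proj x.2.1 (D.proj x.2.1 x.2.2) = D.proj x.2.1 x.2.2
        conv_lhs => rw [proj, if_pos ht']
        simp only [D.inner_proj_shifted _ ht']
        rw [proj, if_pos ht']
      simp only [ContinuousLinearMap.coe_coe, extendByZeroDeriv, if_pos ht, add_apply, smul_apply,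
        smul_eq_mul, D.wDeriv_cplx ht hp', D.zCoord_cplx (m := 0) Even.zero]
      ring
    · simp [extendByZeroDeriv, ht]

end GammaData

namespace GammaData

/-! ### The map `ι` and the function `z² w² log z` -/

theorem isBoundedCoefficient_one : IsBoundedCoefficient (fun _ => 1) where
  differentiableOn := differentiableOn_const _
  bounded M := ⟨1, fun z _ _ => by simp⟩

theorem hasDerivAt_sq_mul_log {z : ℂ} (hz : 0 < z.im) :
    HasDerivAt (fun z => z ^ 2 * Complex.log z) (2 * (z * Complex.log z) + z) z := by
  have hs : z ∈ Complex.slitPlane := Complex.mem_slitPlane_iff.2 (Or.inr hz.ne')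
  have hz0 : z ≠ 0 := Complex.slitPlane_ne_zero hs
  refine ((hasDerivAt_pow 2 z).mul (Complex.hasDerivAt_log hs)).congr_deriv ?_
  field_simp
  ring

theorem norm_mul_log_le {z : ℂ} {M : ℝ} (hz0 : z ≠ 0) (hM : ‖z‖ ≤ M) :
    ‖z * Complex.log z‖ ≤ 1 + M ^ 2 + M * Real.pi := by
  have h0 : 0 < ‖z‖ := norm_pos_iff.2 hz0
  have h1 : ‖z‖ * |Real.log ‖z‖| ≤ 1 + M ^ 2 := by
    rcases le_total ‖z‖ 1 with h | h
    · have := (Real.abs_log_mul_self_lt ‖z‖ h0 h).le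
      rw [abs_mul, abs_of_pos h0, mul_comm] at this
      nlinarith [sq_nonneg M]
    · rw [abs_of_nonneg (Real.log_nonneg h)]
      have := Real.log_le_sub_one_of_pos h0
      nlinarith
  have h2 : ‖Complex.log z‖ ≤ |Real.log ‖z‖| + Real.pi := by
    refine (Complex.norm_le_abs_re_add_abs_im _).trans ?_
    rw [Complex.log_re, Complex.log_im]
    exact add_le_add le_rfl (Complex.abs_arg_le_pi z)
  rw [norm_mul]
  nlinarith [mul_le_mul_of_nonneg_left h2 h0.le, Real.pi_pos]

theorem isBoundedCoefficient_sq_mul_log :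
    IsBoundedCoefficient (fun z => z ^ 2 * Complex.log z) where
  differentiableOn z hz := (hasDerivAt_sq_mul_log hz).differentiableAt.differentiableWithinAt
  bounded M := by
    set B := 1 + M ^ 2 + M * Real.pi
    refine ⟨max (M * B) (2 * B + M), fun z hz hM => ?_⟩
    have hz0 : z ≠ 0 := fun h => by simp [h] at hz
    have h1 := norm_mul_log_le hz0 hM
    constructor
    · refine le_max_of_le_left ?_
      rw [pow_two, mul_assoc, norm_mul]
      exact mul_le_mul hM h1 (norm_nonneg _) ((norm_nonneg z).trans hM)
    · refine le_max_of_le_right ?_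
      rw [(hasDerivAt_sq_mul_log hz).deriv]
      refine (norm_add_le _ _).trans (add_le_add ?_ hM)
      rw [norm_mul, Complex.norm_ofNat]
      linarith

variable (D : GammaData 2)

theorem iotaMap_eq (p : D.Gam 1) :
    iotaMap D p = (zCoord 0 p.1, D.extendByZero (fun _ => 1) 0 p.1) := by
  rw [zCoord_apply, extendByZero]
  simp only [iotaMap, zero_add, pow_one, one_mul]
  rfl

theorem isScHolomorphic_iotaMap :
    IsScHolomorphic (D.scale 1) Set.univ (D.retr 1) (D.cplx 1) (iotaMap D) := by
  have h1 := (D.isScHolomorphic_comp_zCoord (m := 0) Even.zero differentiable_id).clm_comp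
    (ContinuousLinearMap.inl ℂ ℂ ℂ)
  have h2 := (D.isScHolomorphic_extendByZero 0 isBoundedCoefficient_one).clm_comp
    (ContinuousLinearMap.inr ℂ ℂ ℂ)
  have h3 := h1.add h2
  have e : iotaMap D = fun p => (ContinuousLinearMap.inl ℂ ℂ ℂ) (id (zCoord 0 p.1)) +
      (ContinuousLinearMap.inr ℂ ℂ ℂ) (D.extendByZero (fun _ => 1) 0 p.1) := by
    funext p
    rw [iotaMap_eq]
    simp
  rw [e]
  exact h3

theorem iotaMap_injective : Function.Injective (iotaMap D) := by
  rintro ⟨_, p, _, rfl⟩ ⟨_, q, _, rfl⟩ h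
  have h1 : p.1 0 = q.1 0 := congrArg (fun w : ℂ × ℂ => w.1.re) h
  have ht : p.2.1 = q.2.1 := congrArg (fun w : ℂ × ℂ => w.1.im) h
  have hx : p.1 = q.1 := funext fun i => by rw [Subsingleton.elim i 0, h1]
  refine Subtype.ext (Prod.ext hx (Prod.ext ht ?_))
  change D.proj p.2.1 p.2.2 = D.proj q.2.1 q.2.2
  by_cases hpos : 0 < p.2.1
  · have hpos' : 0 < q.2.1 := ht ▸ hpos
    have h2 : (iotaMap D ⟨_, p, trivial, rfl⟩).2 = (iotaMap D ⟨_, q, trivial, rfl⟩).2 :=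
      congrArg Prod.snd h
    simp only [iotaMap, retr, if_pos hpos, if_pos hpos', D.inner_proj_shifted _ hpos,
      D.inner_proj_shifted _ hpos'] at h2
    have h3 := congrArg Complex.re h2
    have h4 := congrArg Complex.im h2
    simp only at h3 h4
    rw [proj, proj, if_pos hpos, if_pos hpos', Fin.sum_univ_two, Fin.sum_univ_two, h3, h4, ht]
  · rw [proj, proj, if_neg hpos, if_neg (ht ▸ hpos)]

/-- The image of `ι` contains the product of the upper half plane and `ℂ`. -/
theorem exists_iotaMap_eq {z w : ℂ} (hz : 0 < z.im) : ∃ p : D.Gam 1, iotaMap D p = (z, w) := by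
  set f : L2R := w.re • D.shifted 0 z.im + w.im • D.shifted 1 z.im
  have h0 : inner ℝ f (D.shifted 0 z.im) = w.re := by
    simp [f, inner_add_left, real_inner_smul_left, D.inner_shifted_shifted, D.norm_shifted]
  have h1 : inner ℝ f (D.shifted 1 z.im) = w.im := by
    simp [f, inner_add_left, real_inner_smul_left, D.inner_shifted_shifted, D.norm_shifted]
  refine ⟨⟨_, ((fun _ => z.re), z.im, f), trivial, rfl⟩, ?_⟩
  simp only [iotaMap, retr, if_pos hz, D.inner_proj_shifted _ hz, h0, h1]

/-- The second derivative `2 log z + 3` of `z² log z` is unbounded near `0`, so this function is not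
the restriction to the upper half plane of a holomorphic function near `0`. -/
theorem not_exists_extension_sq_mul_log {r : ℝ} (hr : 0 < r) {g : ℂ → ℂ}
    (hg : DifferentiableOn ℂ g (Metric.ball 0 r))
    (h : ∀ z ∈ Metric.ball (0 : ℂ) r, 0 < z.im → g z = z ^ 2 * Complex.log z) : False := by
  have hd : DifferentiableOn ℂ (deriv (deriv g)) (Metric.ball 0 r) :=
    (hg.deriv Metric.isOpen_ball).deriv Metric.isOpen_ball
  have hopen : IsOpen (Metric.ball (0 : ℂ) r ∩ {z | 0 < z.im}) :=
    Metric.isOpen_ball.inter isOpen_upper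
  have h1 : ∀ z ∈ Metric.ball (0 : ℂ) r ∩ {z | 0 < z.im},
      deriv g z = 2 * (z * Complex.log z) + z := fun z hz => by
    rw [← (hasDerivAt_sq_mul_log hz.2).deriv]
    refine EventuallyEq.deriv_eq ?_
    filter_upwards [hopen.mem_nhds hz] with y hy
    exact h y hy.1 hy.2
  have h2 : ∀ z ∈ Metric.ball (0 : ℂ) r ∩ {z | 0 < z.im},
      deriv (deriv g) z = 2 * Complex.log z + 3 := fun z hz => by
    have hs : z ∈ Complex.slitPlane := Complex.mem_slitPlane_iff.2 (Or.inr (ne_of_gt hz.2))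
    have hz0 : z ≠ 0 := Complex.slitPlane_ne_zero hs
    have h3 : HasDerivAt (fun z => 2 * (z * Complex.log z) + z) (2 * Complex.log z + 3) z := by
      refine ((((hasDerivAt_id z).mul (Complex.hasDerivAt_log hs)).const_mul 2).add
        (hasDerivAt_id z)).congr_deriv ?_
      simp only [id]
      field_simp
      ring
    rw [← h3.deriv]
    refine EventuallyEq.deriv_eq ?_
    filter_upwards [hopen.mem_nhds hz] with y hy
    exact h1 y hy
  have hcurve : Tendsto (fun s : ℝ => (s : ℂ) * Complex.I) (𝓝[>] 0) (𝓝 0) := by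
    have : Continuous fun s : ℝ => (s : ℂ) * Complex.I := by fun_prop
    simpa using (this.tendsto 0).mono_left nhdsWithin_le_nhds
  have hball := Metric.ball_mem_nhds (0 : ℂ) hr
  have hlim : Tendsto (fun s : ℝ => (deriv (deriv g) (s * Complex.I)).re) (𝓝[>] 0)
      (𝓝 (deriv (deriv g) 0).re) :=
    (Complex.continuous_re.tendsto _).comp
      (((hd.differentiableAt hball).continuousAt.tendsto).comp hcurve)
  have hlog : Tendsto (fun s : ℝ => 2 * Real.log s + 3) (𝓝[>] 0) atBot :=
    tendsto_atBot_add_const_right _ _ (Real.tendsto_log_nhdsGT_zero.const_mul_atBot two_pos)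
  refine not_tendsto_nhds_of_tendsto_atBot hlog _ (hlim.congr' ?_)
  filter_upwards [self_mem_nhdsWithin, hcurve.eventually hball] with s hs hsb
  have hs' : (0 : ℝ) < s := hs
  rw [h2 _ ⟨hsb, by simpa using hs'⟩]
  simp [Complex.log_re, abs_of_pos hs']

theorem exists_not_extendable :
    ∃ φ : D.Gam 1 → ℂ,
      IsScHolomorphic (D.scale 1) Set.univ (D.retr 1) (D.cplx 1) φ ∧
      (∀ p : D.Gam 1, φ p =
        if 0 < (iotaMap D p).1.im then
          (iotaMap D p).1 ^ 2 * (iotaMap D p).2 ^ 2 * Complex.log (iotaMap D p).1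
        else 0) ∧
      ∀ W : Set (ℂ × ℂ), IsOpen W → (0 : ℂ × ℂ) ∈ W →
        ¬ ∃ F : ℂ × ℂ → ℂ, DifferentiableOn ℂ F W ∧
          ∀ p : D.Gam 1, iotaMap D p ∈ W → F (iotaMap D p) = φ p := by
  have hφ : ∀ p : D.Gam 1, D.extendByZero (fun z => z ^ 2 * Complex.log z) 1 p.1 =
      if 0 < (iotaMap D p).1.im then
        (iotaMap D p).1 ^ 2 * (iotaMap D p).2 ^ 2 * Complex.log (iotaMap D p).1
      else 0 := fun p => by
    rw [iotaMap_eq, zCoord_im]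
    by_cases ht : 0 < p.1.2.1
    · simp only [extendByZero, if_pos ht]
      ring
    · simp only [extendByZero, if_neg ht]
  refine ⟨_, D.isScHolomorphic_extendByZero 1 isBoundedCoefficient_sq_mul_log, hφ,
    fun W hW h0 => ?_⟩
  rintro ⟨F, hF, hFφ⟩
  obtain ⟨r, hr, hrW⟩ := Metric.isOpen_iff.1 hW 0 h0
  set w : ℂ := ((r / 2 : ℝ) : ℂ)
  have hw : ‖w‖ < r := by
    rw [Complex.norm_real, Real.norm_of_nonneg (by positivity)]
    linarith
  have hw0 : w ≠ 0 := Complex.ofReal_ne_zero.2 (by positivity)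
  have hmem : ∀ z ∈ Metric.ball (0 : ℂ) r, (z, w) ∈ W := fun z hz => hrW (by
    rw [mem_ball_zero_iff] at hz ⊢
    exact max_lt hz hw)
  refine not_exists_extension_sq_mul_log hr (g := fun z => F (z, w) / w ^ 2) ?_ fun z hz him => ?_
  · refine DifferentiableOn.div_const ?_ _
    exact hF.comp (differentiableOn_id.prodMk (differentiableOn_const w)) hmem
  · obtain ⟨p, hp⟩ := D.exists_iotaMap_eq (w := w) him
    have h1 := hFφ p (hp ▸ hmem z hz)
    rw [hφ p, hp, if_pos him] at h1
    change F (z, w) / w ^ 2 = _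
    rw [h1]
    field_simp

end GammaData

/-! ### Weighted `ℓ²` scales -/

section WeightedScale

variable {ι : Type}

/-- The Hilbert space of square-summable complex families. -/
abbrev Ell2 (ι : Type) : Type := lp (fun _ : ι => ℂ) 2

open Classical in
/-- The element of `ℓ²` with the given coordinates (`0` if they are not square-summable). -/
noncomputable def toEll2 (f : ι → ℂ) : Ell2 ι := if h : Memℓp f 2 then ⟨f, h⟩ else 0

theorem toEll2_apply {f : ι → ℂ} (h : Memℓp f 2) (i : ι) : toEll2 f i = f i := by
  rw [toEll2, dif_pos h]

theorem memℓp_of_le_mul {f : ι → ℂ} {c : ℝ} {y : Ell2 ι} (h : ∀ i, ‖f i‖ ≤ c * ‖y i‖) :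
    Memℓp f 2 := by
  refine (lp.memℓp (c • y)).mono' fun i => (h i).trans ?_
  rw [lp.coeFn_smul, Pi.smul_apply, norm_smul]
  exact mul_le_mul_of_nonneg_right (le_abs_self c) (norm_nonneg _)

theorem norm_le_of_coord_le {x y : Ell2 ι} {c : ℝ} (hc : 0 ≤ c) (h : ∀ i, ‖x i‖ ≤ c * ‖y i‖) :
    ‖x‖ ≤ c * ‖y‖ := by
  have : ‖x‖ ≤ ‖c • y‖ := lp.norm_mono two_ne_zero fun i => (h i).trans (by
    rw [lp.coeFn_smul, Pi.smul_apply, norm_smul, Real.norm_of_nonneg hc])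
  rwa [norm_smul, Real.norm_of_nonneg hc] at this

theorem norm_coord_le (x : Ell2 ι) (i : ι) : ‖x i‖ ≤ ‖x‖ := lp.norm_apply_le_norm two_ne_zero x i

theorem Ell2.ext {x y : Ell2 ι} (h : ∀ i, x i = y i) : x = y := lp.ext (funext h)

/-- The coordinate maps of `ℓ²`. -/
noncomputable def coord (i : ι) : Ell2 ι →L[ℝ] ℂ := lp.evalCLM ℝ (fun _ : ι => ℂ) 2 i

@[simp] theorem coord_apply (i : ι) (x : Ell2 ι) : coord i x = x i := rfl

/-- The diagonal operator with bounded coefficients `c`. -/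
noncomputable def diagonal (c : ι → ℝ) {C : ℝ} (hc : ∀ i, |c i| ≤ C) : Ell2 ι →L[ℝ] Ell2 ι :=
  have hb : ∀ (y : Ell2 ι) i, ‖c i • y i‖ ≤ C * ‖y i‖ := fun y i => by
    rw [norm_smul]; exact mul_le_mul_of_nonneg_right (hc i) (norm_nonneg _)
  have hm : ∀ y : Ell2 ι, Memℓp (fun i => c i • y i) 2 := fun y => memℓp_of_le_mul (hb y)
  LinearMap.mkContinuous
    { toFun := fun y => ⟨fun i => c i • y i, hm y⟩
      map_add' := fun x y => Ell2.ext fun i => smul_add (c i) (x i) (y i)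
      map_smul' := fun a x => Ell2.ext fun i => smul_comm (c i) a (x i) } |C|
    fun y => norm_le_of_coord_le (abs_nonneg C) fun i =>
      (hb y i).trans (mul_le_mul_of_nonneg_right (le_abs_self C) (norm_nonneg _))

@[simp] theorem diagonal_apply (c : ι → ℝ) {C : ℝ} (hc : ∀ i, |c i| ≤ C) (y : Ell2 ι) (i : ι) :
    diagonal c hc y i = c i • y i := rfl

open Classical in
/-- Diagonal operators with coefficients tending to zero are compact. -/
theorem isCompactOperator_diagonal {c : ι → ℝ} {C : ℝ} (hc : ∀ i, |c i| ≤ C)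
    (h : Tendsto c cofinite (𝓝 0)) : IsCompactOperator (diagonal c hc) := by
  let T : ι → Ell2 ι →L[ℝ] Ell2 ι := fun i =>
    c i • (lp.singleContinuousLinearMap ℝ (fun _ : ι => ℂ) 2 i ∘L coord i)
  have hT : ∀ i, IsCompactOperator (T i) := fun i =>
    ((isCompactOperator_of_locallyCompactSpace_dom (coord i)).clm_comp
      (lp.singleContinuousLinearMap ℝ (fun _ : ι => ℂ) 2 i)).smul (c i)
  have hTs : ∀ (s : Finset ι) (y : Ell2 ι) (j : ι),
      (∑ i ∈ s, T i) y j = if j ∈ s then c j • y j else 0 := fun s y j => by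
    rw [sum_apply, lp.coeFn_sum, Finset.sum_apply]
    have : ∀ i ∈ s, (T i y) j = Pi.single (M := fun _ => ℂ) i (c i • y i) j := fun i _ => by
      change c i • (Pi.single (M := fun _ => ℂ) i (y i) j) = _
      by_cases hij : j = i
      · subst hij; simp
      · simp [Pi.single_eq_of_ne hij]
    rw [Finset.sum_congr rfl this, Finset.sum_pi_single]
  refine isCompactOperator_of_tendsto (F := fun s : Finset ι => ∑ i ∈ s, T i) (l := atTop) ?_
    (Eventually.of_forall fun s => ?_)
  · rw [Metric.tendsto_atTop]
    intro ε hε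
    have hfin : {i | ¬ |c i| < ε / 2}.Finite := by
      have := h.norm
      rw [norm_zero] at this
      exact this.eventually (gt_mem_nhds (half_pos hε))
    refine ⟨hfin.toFinset, fun s hs => ?_⟩
    rw [dist_eq_norm]
    refine lt_of_le_of_lt (ContinuousLinearMap.opNorm_le_bound _ (half_pos hε).le fun y => ?_)
      (half_lt_self hε)
    refine norm_le_of_coord_le (half_pos hε).le fun j => ?_
    rw [sub_apply, lp.coeFn_sub, Pi.sub_apply, hTs, diagonal_apply]
    by_cases hj : j ∈ s
    · rw [if_pos hj, sub_self, norm_zero]; positivity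
    · rw [if_neg hj, zero_sub, norm_neg, norm_smul]
      refine mul_le_mul_of_nonneg_right ?_ (norm_nonneg _)
      by_contra hlt
      exact hj (hs (hfin.mem_toFinset.2 fun h' => hlt h'.le))
  · induction s using Finset.induction_on with
    | empty => simpa using isCompactOperator_zero
    | insert i s hi ih =>
      rw [Finset.sum_insert hi]
      exact (hT i).add ih

/-- Weights `W_m(i)`, increasing in `m`, with `W_0 = 1` and `W_m / W_{m+1} → 0`. -/
structure Weights (ι : Type) where
  w : ℕ → ι → ℝ
  pos : ∀ m i, 0 < w m i
  zero : ∀ i, w 0 i = 1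
  mono : ∀ m i, w m i ≤ w (m + 1) i
  tendsto : ∀ m, Tendsto (fun i => w m i / w (m + 1) i) cofinite (𝓝 0)

namespace Weights

variable (W : Weights ι)

theorem one_le (m : ℕ) (i : ι) : 1 ≤ W.w m i := by
  induction m with
  | zero => exact (W.zero i).ge
  | succ m ih => exact ih.trans (W.mono m i)

/-- The family `(W_m(i) x_i)` as an element of `ℓ²`, for `x ∈ E_m`. -/
noncomputable def up (m : ℕ) (x : Ell2 ι) : Ell2 ι := toEll2 fun i => W.w m i • x i

/-- The scale of the weighted spaces `{x : ∑ W_m(i)² |x_i|² < ∞}`. -/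
noncomputable def scale : ScScale (Ell2 ι) where
  lev m :=
    { carrier := {x | Memℓp (fun i => W.w m i • x i) 2}
      add_mem' := fun {x y} hx hy => by
        have := Memℓp.add hx hy
        refine (congrArg (fun f => Memℓp f 2) (funext fun i => ?_)).mpr this
        exact smul_add (W.w m i) (x i) (y i)
      zero_mem' := by
        refine (congrArg (fun f => Memℓp f 2) (funext fun i => ?_)).mpr
          (zero_memℓp (E := fun _ : ι => ℂ) (p := 2))
        exact smul_zero _
      smul_mem' := fun c x hx => by
        have := Memℓp.const_smul (𝕜 := ℝ) hx c
        refine (congrArg (fun f => Memℓp f 2) (funext fun i => ?_)).mpr this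
        exact smul_comm (W.w m i) c (x i) }
  nrm m x := ‖W.up m x‖

variable {W}

theorem up_apply {m : ℕ} {x : Ell2 ι} (hx : x ∈ W.scale.lev m) (i : ι) :
    W.up m x i = W.w m i • x i := toEll2_apply hx i

theorem up_add {m : ℕ} {x y : Ell2 ι} (hx : x ∈ W.scale.lev m) (hy : y ∈ W.scale.lev m) :
    W.up m (x + y) = W.up m x + W.up m y := Ell2.ext fun i => by
  rw [up_apply (add_mem hx hy), lp.coeFn_add, Pi.add_apply, lp.coeFn_add, Pi.add_apply,
    up_apply hx, up_apply hy, smul_add]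

theorem up_smul {m : ℕ} {x : Ell2 ι} (hx : x ∈ W.scale.lev m) (c : ℝ) :
    W.up m (c • x) = c • W.up m x := Ell2.ext fun i => by
  rw [up_apply (Submodule.smul_mem _ c hx), lp.coeFn_smul, Pi.smul_apply, lp.coeFn_smul,
    Pi.smul_apply, up_apply hx, smul_comm]

theorem up_sub {m : ℕ} {x y : Ell2 ι} (hx : x ∈ W.scale.lev m) (hy : y ∈ W.scale.lev m) :
    W.up m (x - y) = W.up m x - W.up m y := by
  rw [sub_eq_add_neg, up_add hx (neg_mem hy), ← neg_one_smul ℝ y, up_smul hy, neg_one_smul,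
    sub_eq_add_neg]

variable (W) in
/-- The isometry `ℓ² → E_m` inverse to `up`. -/
noncomputable def down (m : ℕ) : Ell2 ι →L[ℝ] Ell2 ι :=
  diagonal (fun i => (W.w m i)⁻¹) (C := 1) fun i => by
    rw [abs_of_pos (inv_pos.2 (W.pos m i))]
    exact inv_le_one_of_one_le₀ (W.one_le m i)

theorem down_apply (m : ℕ) (y : Ell2 ι) (i : ι) : W.down m y i = (W.w m i)⁻¹ • y i := rfl

theorem smul_down (m : ℕ) (y : Ell2 ι) : (fun i => W.w m i • W.down m y i) = y := funext fun i => by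
  rw [down_apply, smul_smul, mul_inv_cancel₀ (W.pos m i).ne', one_smul]

theorem down_mem (m : ℕ) (y : Ell2 ι) : W.down m y ∈ W.scale.lev m := by
  change Memℓp (fun i => W.w m i • W.down m y i) 2
  rw [smul_down]
  exact lp.memℓp y

theorem up_down (m : ℕ) (y : Ell2 ι) : W.up m (W.down m y) = y := Ell2.ext fun i => by
  rw [up_apply (down_mem m y)]
  exact congrFun (smul_down m y) i

theorem down_up {m : ℕ} {x : Ell2 ι} (hx : x ∈ W.scale.lev m) : W.down m (W.up m x) = x :=
  Ell2.ext fun i => by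
    rw [down_apply, up_apply hx, smul_smul, inv_mul_cancel₀ (W.pos m i).ne', one_smul]

theorem norm_up (m : ℕ) (x : Ell2 ι) : W.scale.nrm m x = ‖W.up m x‖ := rfl

theorem scale_lev_zero : W.scale.lev 0 = ⊤ := eq_top_iff.2 fun x _ => by
  change Memℓp (fun i => W.w 0 i • x i) 2
  simp only [W.zero, one_smul]
  exact lp.memℓp x

theorem scale_nrm_zero (x : Ell2 ι) : W.scale.nrm 0 x = ‖x‖ := by
  rw [norm_up]
  congr 1
  refine Ell2.ext fun i => ?_
  rw [up_apply (scale_lev_zero (W := W) ▸ trivial), W.zero, one_smul]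

/-- Coordinates of the points of `E_m` decay like `1 / W_m`. -/
theorem weight_mul_norm_le {m : ℕ} {x : Ell2 ι} (hx : x ∈ W.scale.lev m) (i : ι) :
    W.w m i * ‖x i‖ ≤ W.scale.nrm m x := by
  have := norm_coord_le (W.up m x) i
  rwa [up_apply hx, norm_smul, Real.norm_of_nonneg (W.pos m i).le] at this

theorem single_mem [DecidableEq ι] (m : ℕ) (i : ι) (a : ℂ) :
    (lp.single 2 i a : Ell2 ι) ∈ W.scale.lev m := by
  have : (lp.single 2 i a : Ell2 ι) = W.down m (W.w m i • lp.single 2 i a) := Ell2.ext fun j => by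
    rw [down_apply, lp.coeFn_smul, Pi.smul_apply, lp.single_apply]
    by_cases h : j = i
    · subst h
      rw [smul_smul, inv_mul_cancel₀ (W.pos m j).ne', one_smul]
    · rw [Pi.single_eq_of_ne h, smul_zero, smul_zero]
  rw [this]
  exact down_mem m _

theorem nrm_single [DecidableEq ι] (m : ℕ) (i : ι) (a : ℂ) :
    W.scale.nrm m (lp.single 2 i a : Ell2 ι) = W.w m i * ‖a‖ := by
  have : W.up m (lp.single 2 i a : Ell2 ι) = W.w m i • lp.single 2 i a := Ell2.ext fun j => by
    rw [up_apply (single_mem m i a), lp.coeFn_smul, Pi.smul_apply, lp.single_apply]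
    by_cases h : j = i
    · rw [h]
    · rw [Pi.single_eq_of_ne h, smul_zero, smul_zero]
  rw [norm_up, this, norm_smul, lp.norm_single (by norm_num), Real.norm_of_nonneg (W.pos m i).le]

theorem lev_succ_le (m : ℕ) : W.scale.lev (m + 1) ≤ W.scale.lev m := fun x hx => by
  change Memℓp (fun i => W.w m i • x i) 2
  refine memℓp_of_le_mul (c := 1) (y := W.up (m + 1) x) fun i => ?_
  rw [up_apply hx, norm_smul, norm_smul, one_mul, Real.norm_of_nonneg (W.pos _ i).le,
    Real.norm_of_nonneg (W.pos _ i).le]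
  exact mul_le_mul_of_nonneg_right (W.mono m i) (norm_nonneg _)

theorem nrm_le_succ (m : ℕ) {x : Ell2 ι} (hx : x ∈ W.scale.lev (m + 1)) :
    W.scale.nrm m x ≤ W.scale.nrm (m + 1) x := by
  rw [norm_up, norm_up, ← one_mul ‖W.up (m + 1) x‖]
  refine norm_le_of_coord_le zero_le_one fun i => ?_
  rw [up_apply hx, up_apply (lev_succ_le m hx), norm_smul, norm_smul, one_mul,
    Real.norm_of_nonneg (W.pos _ i).le, Real.norm_of_nonneg (W.pos _ i).le]
  exact mul_le_mul_of_nonneg_right (W.mono m i) (norm_nonneg _)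

theorem eq_zero_of_nrm {m : ℕ} {x : Ell2 ι} (hx : x ∈ W.scale.lev m) (h : W.scale.nrm m x = 0) :
    x = 0 := by
  rw [← down_up hx, norm_eq_zero.1 h, map_zero]

open Classical in
theorem scale_dense (m : ℕ) (x : Ell2 ι) (hx : x ∈ W.scale.lev m) (ε : ℝ) (hε : 0 < ε) :
    ∃ y, (∀ i, y ∈ W.scale.lev i) ∧ W.scale.nrm m (x - y) < ε := by
  have h := lp.hasSum_single (by simp : (2 : ENNReal) ≠ ⊤) (W.up m x)
  obtain ⟨s, hs⟩ := (Metric.tendsto_atTop.1 h) ε hε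
  have hs := hs s le_rfl
  have hy : ∀ j, (∑ i ∈ s, lp.single 2 i (x i) : Ell2 ι) ∈ W.scale.lev j := fun j =>
    Submodule.sum_mem _ fun i _ => single_mem j i (x i)
  refine ⟨∑ i ∈ s, lp.single 2 i (x i), hy, ?_⟩
  rw [norm_up, up_sub hx (hy m), ← dist_eq_norm, dist_comm]
  convert hs using 2
  refine Ell2.ext fun j => ?_
  rw [up_apply (hy m), lp.coeFn_sum, lp.coeFn_sum, Finset.sum_apply, Finset.sum_apply]
  simp only [lp.single_apply, Finset.sum_pi_single]
  split_ifs with hj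
  · rw [up_apply hx]
  · rw [smul_zero]

theorem isTame : W.scale.IsTame where
  lev_succ_le := lev_succ_le
  nrm_nonneg m x _ := norm_nonneg _
  nrm_le_succ m := ⟨1, fun x hx => by rw [one_mul]; exact nrm_le_succ m hx⟩
  eq_zero m x hx h := eq_zero_of_nrm hx h
  nrm_add_le m x hx y hy := by rw [norm_up, up_add hx hy]; exact norm_add_le _ _
  nrm_smul m c x hx := by rw [norm_up, up_smul hx, norm_smul]; rfl
  dense := scale_dense

theorem isScBanach : W.scale.IsScBanach where
  lev_zero := scale_lev_zero
  lev_succ_le := lev_succ_le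
  nrm_nonneg m x _ := norm_nonneg _
  nrm_eq_zero_iff m x hx := ⟨eq_zero_of_nrm hx, fun h => h ▸ isTame.nrm_zero m⟩
  nrm_add_le := isTame.nrm_add_le
  nrm_smul := isTame.nrm_smul
  complete m a ha hC := by
    have hcauchy : CauchySeq fun i => W.up m (a i) := Metric.cauchySeq_iff.2 fun ε hε => by
      obtain ⟨N, hN⟩ := hC ε hε
      refine ⟨N, fun i hi j hj => ?_⟩
      rw [dist_eq_norm, ← up_sub (ha i) (ha j)]
      exact hN i hi j hj
    obtain ⟨y, hy⟩ := cauchySeq_tendsto_of_complete hcauchy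
    refine ⟨W.down m y, down_mem m y, ?_⟩
    refine (tendsto_iff_norm_sub_tendsto_zero.1 hy).congr fun i => ?_
    rw [norm_up, up_sub (ha i) (down_mem m y), up_down]
  compact m a ha := by
    rintro ⟨K, hK⟩
    have hbound : ∀ i, |W.w m i / W.w (m + 1) i| ≤ 1 := fun i => by
      rw [abs_of_pos (div_pos (W.pos _ i) (W.pos _ i))]
      exact (div_le_one (W.pos _ i)).2 (W.mono m i)
    obtain ⟨Q, hQ, hsub⟩ := (isCompactOperator_diagonal hbound (W.tendsto m)
      ).image_closedBall_subset_compact (f := (diagonal _ hbound).toLinearMap) K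
    have hdiag : ∀ i, diagonal _ hbound (W.up (m + 1) (a i)) = W.up m (a i) := fun i =>
      Ell2.ext fun j => by
        rw [diagonal_apply, up_apply (ha i), up_apply (lev_succ_le m (ha i)), smul_smul,
          div_mul_cancel₀ _ (W.pos _ j).ne']
    have hmem : ∀ i, W.up m (a i) ∈ Q := fun i => hsub
      ⟨W.up (m + 1) (a i), mem_closedBall_zero_iff.2 (hK i), hdiag i⟩
    obtain ⟨y, -, g, hg, hy⟩ := hQ.tendsto_subseq hmem
    refine ⟨W.down m y, down_mem m y, g, hg, ?_⟩
    refine (tendsto_iff_norm_sub_tendsto_zero.1 hy).congr fun i => ?_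
    rw [norm_up, up_sub (lev_succ_le m (ha _)) (down_mem m y), up_down]
    rfl
  dense := scale_dense

/-- The functional `x ↦ ⟨y, W_m x⟩` on `E_m`. -/
noncomputable def dualVec (W : Weights ι) (m : ℕ) (y : Ell2 ι) : W.scale.lev m →ₗ[ℝ] ℝ where
  toFun x := inner ℝ y (W.up m x)
  map_add' x x' := by rw [Submodule.coe_add, up_add x.2 x'.2, inner_add_right]
  map_smul' c x := by
    rw [Submodule.coe_smul, up_smul x.2, real_inner_smul_right]; rfl

theorem dualVec_mem (m : ℕ) (y : Ell2 ι) : W.dualVec m y ∈ W.scale.dualLev m :=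
  ⟨‖y‖, fun x => abs_real_inner_le_norm y (W.up m x)⟩

/-- The levels are Hilbert spaces, so they are reflexive by the Riesz representation theorem. -/
theorem isReflexive : W.scale.IsReflexive := by
  rintro m Λ hadd hsmul ⟨M, hM⟩
  have hsurj : ∀ l ∈ W.scale.dualLev m, ∃ y, W.dualVec m y = l := by
    rintro l ⟨K, hK⟩
    let l' : Ell2 ι →L[ℝ] ℝ := LinearMap.mkContinuous
      { toFun := fun y => l ⟨W.down m y, down_mem m y⟩
        map_add' := fun y y' => by
          rw [← map_add]; congr 1; exact Subtype.ext (map_add _ _ _)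
        map_smul' := fun c y => by
          rw [RingHom.id_apply, ← map_smul]; congr 1; exact Subtype.ext (map_smul _ _ _) } K
      fun y => by
        have := hK ⟨W.down m y, down_mem m y⟩
        rwa [norm_up, up_down] at this
    refine ⟨(InnerProductSpace.toDual ℝ (Ell2 ι)).symm l', LinearMap.ext fun x => ?_⟩
    change inner ℝ _ (W.up m x) = _
    rw [InnerProductSpace.toDual_symm_apply]
    change l ⟨W.down m (W.up m x), _⟩ = _
    congr 1
    exact Subtype.ext (down_up x.2)
  have hvadd : ∀ y y', W.dualVec m (y + y') = W.dualVec m y + W.dualVec m y' := fun y y' =>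
    LinearMap.ext fun x => inner_add_left y y' (W.up m x)
  have hvsmul : ∀ (c : ℝ) y, W.dualVec m (c • y) = c • W.dualVec m y := fun c y =>
    LinearMap.ext fun x => real_inner_smul_left y (W.up m x) c
  let Λ' : Ell2 ι →L[ℝ] ℝ := LinearMap.mkContinuous
    { toFun := fun y => Λ (W.dualVec m y)
      map_add' := fun y y' => by
        rw [hvadd, hadd _ (dualVec_mem m y) _ (dualVec_mem m y')]
      map_smul' := fun c y => by rw [hvsmul, hsmul c _ (dualVec_mem m y)]; rfl } M
    fun y => hM _ (dualVec_mem m y) ‖y‖ (norm_nonneg y) fun x =>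
      abs_real_inner_le_norm y (W.up m x)
  set z := (InnerProductSpace.toDual ℝ (Ell2 ι)).symm Λ'
  refine ⟨⟨W.down m z, down_mem m z⟩, fun l hl => ?_⟩
  obtain ⟨y, rfl⟩ := hsurj l hl
  have h1 : Λ' y = inner ℝ z y := (InnerProductSpace.toDual_symm_apply).symm
  change Λ' y = inner ℝ y (W.up m (W.down m z))
  rw [h1, up_down, real_inner_comm]

attribute [irreducible] scale up

end Weights

end WeightedScale

/-! ### A cut-off of the exponential function -/

section Twist

/-- A smooth function `ℂ → ℂ` without zeros, equal to `exp` near `0` and to `1` near infinity. -/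
noncomputable def twist (z : ℂ) : ℂ :=
  Complex.exp ((⟨1, 2, one_pos, one_lt_two⟩ : ContDiffBump (0 : ℂ)) z • z)

theorem contDiff_twist : ContDiff ℝ ∞ twist :=
  Complex.contDiff_exp.comp ((ContDiffBump.contDiff _).smul contDiff_id)

theorem twist_ne_zero (z : ℂ) : twist z ≠ 0 := Complex.exp_ne_zero _

theorem twist_of_norm_lt {z : ℂ} (h : ‖z‖ < 1) : twist z = Complex.exp z := by
  rw [twist, ContDiffBump.one_of_mem_closedBall, one_smul]
  simpa using h.le

theorem twist_of_le_norm {z : ℂ} (h : 2 ≤ ‖z‖) : twist z = 1 := by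
  rw [twist, ContDiffBump.zero_of_le_dist, zero_smul, Complex.exp_zero]
  simpa using h

theorem fderiv_twist_of_norm_lt {z : ℂ} (hz : ‖z‖ < 1) (h : ℂ) :
    fderiv ℝ twist z h = Complex.exp z * h := by
  have he : twist =ᶠ[𝓝 z] Complex.exp := by
    filter_upwards [continuous_norm.continuousAt.eventually (gt_mem_nhds hz)] with w hw
    exact twist_of_norm_lt hw
  rw [he.fderiv_eq, ((Complex.hasDerivAt_exp z).hasFDerivAt.restrictScalars ℝ).fderiv]
  simp [mul_comm]

theorem hasCompactSupport_fderiv_twist : HasCompactSupport (fderiv ℝ twist) := by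
  have h : HasCompactSupport fun z => twist z - 1 :=
    HasCompactSupport.intro (isCompact_closedBall (0 : ℂ) 2) fun z hz => by
      rw [twist_of_le_norm, sub_self]
      rw [mem_closedBall_zero_iff, not_le] at hz
      exact hz.le
  have := h.fderiv (𝕜 := ℝ)
  rwa [show fderiv ℝ (fun z => twist z - 1) = fderiv ℝ twist from
    funext fun z => fderiv_sub_const 1] at this

theorem continuous_fderiv_twist : Continuous (fderiv ℝ twist) :=
  contDiff_twist.continuous_fderiv (by simp)

/-- The function `2 i ∂ (log twist) / ∂ z̄`. -/
noncomputable def twistDbar (z : ℂ) : ℂ :=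
  Complex.I * (fderiv ℝ twist z 1 + Complex.I * fderiv ℝ twist z Complex.I) / twist z

theorem contDiff_twistDbar : ContDiff ℝ ∞ twistDbar := by
  have h := contDiff_twist.fderiv_right (m := ∞) (by simp)
  exact (contDiff_const.mul ((h.clm_apply contDiff_const).add
    (contDiff_const.mul (h.clm_apply contDiff_const)))).mul (contDiff_twist.inv twist_ne_zero)

theorem twistDbar_of_norm_lt {z : ℂ} (hz : ‖z‖ < 1) : twistDbar z = 0 := by
  rw [twistDbar, fderiv_twist_of_norm_lt hz, fderiv_twist_of_norm_lt hz]
  linear_combination (Complex.I * Complex.exp z / twist z) * Complex.I_sq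

/-- The conjugate-linear part of a real-linear map `ℂ → ℂ`. -/
theorem map_I_mul_sub (L : ℂ →L[ℝ] ℂ) (h : ℂ) :
    L (Complex.I * h) - Complex.I * L h =
      -Complex.I * (L 1 + Complex.I * L Complex.I) * (starRingEnd ℂ) h := by
  have e : ∀ w : ℂ, L w = w.re * L 1 + w.im * L Complex.I := fun w => by
    conv_lhs => rw [← Complex.re_add_im w]
    rw [show (w.re : ℂ) + w.im * Complex.I = w.re • (1 : ℂ) + w.im • Complex.I by
      simp [Complex.real_smul], map_add, map_smul, map_smul, Complex.real_smul, Complex.real_smul]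
  have hc : (starRingEnd ℂ) h = h.re - h.im * Complex.I := by
    apply Complex.ext <;> simp
  rw [e (Complex.I * h), e h, hc, Complex.I_mul_re, Complex.I_mul_im]
  push_cast
  linear_combination ((h.re : ℂ) * L Complex.I - h.im * L 1 - Complex.I * h.im * L Complex.I)
    * Complex.I_sq

/-- The Cauchy–Riemann defect of `twist` is compensated by `twistDbar`. -/
theorem fderiv_twist_I_mul (z h : ℂ) :
    fderiv ℝ twist z (Complex.I * h) - Complex.I * fderiv ℝ twist z h
      + twist z * twistDbar z * (starRingEnd ℂ) h = 0 := by
  rw [map_I_mul_sub, twistDbar]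
  have := twist_ne_zero z
  field_simp
  ring

theorem exists_twist_bound : ∃ C : ℝ, 0 < C ∧ ∀ z,
    ‖twist z‖ ≤ C ∧ ‖fderiv ℝ twist z‖ ≤ C ∧ ‖twistDbar z‖ ≤ C := by
  obtain ⟨C₁, h₁⟩ := hasCompactSupport_fderiv_twist.exists_bound_of_continuous
    continuous_fderiv_twist
  have hc : HasCompactSupport twistDbar := hasCompactSupport_fderiv_twist.mono' fun z hz => by
    refine subset_closure fun h => hz ?_
    rw [twistDbar, h]
    simp
  obtain ⟨C₂, h₂⟩ := hc.exists_bound_of_continuous contDiff_twistDbar.continuous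
  obtain ⟨C₃, h₃⟩ := (isCompact_closedBall (0 : ℂ) 2).exists_bound_of_continuousOn
    contDiff_twist.continuous.continuousOn
  refine ⟨|C₁| + |C₂| + |C₃| + 1, by positivity, fun z => ⟨?_, ?_, ?_⟩⟩
  · rcases le_total 2 ‖z‖ with hz | hz
    · rw [twist_of_le_norm hz, norm_one]
      linarith [abs_nonneg C₁, abs_nonneg C₂, abs_nonneg C₃]
    · have := h₃ z (mem_closedBall_zero_iff.2 hz)
      linarith [abs_nonneg C₁, abs_nonneg C₂, le_abs_self C₃]
  · linarith [h₁ z, abs_nonneg C₂, abs_nonneg C₃, le_abs_self C₁]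
  · linarith [h₂ z, abs_nonneg C₁, abs_nonneg C₃, le_abs_self C₂]

end Twist

/-! ### The twisted complex structure on a weighted `ℓ²` scale -/

section Model

/-- The points of the model space are pairs of sequences `z n = p (inl n)`, `u n = p (inr n)`. -/
abbrev Model : Type := Ell2 (ℕ ⊕ ℕ)

/-- The exponents of the weights: `0, 1, 10, 11, …` for `z` and `0, 9, 10, 11, …` for `u`.
With the dilation factor `D n = 2 ^ (8 n)`, the exponent `9` makes `∑ D n u n` absolutely convergent
on `E_1`, and the exponent `10` makes `D n z n` tend to `0` on `E_2`. The exponent `1` of `z` on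
`E_1` is so small that the second derivative of `twistSum` is unbounded. -/
def modelExp (m : ℕ) : ℕ ⊕ ℕ → ℕ
  | .inl _ => if m ≤ 1 then m else m + 8
  | .inr _ => if m = 0 then 0 else m + 8

/-- The index `n` of the coordinates `z n` and `u n`. -/
def modelIdx : ℕ ⊕ ℕ → ℕ := Sum.elim id id

theorem modelExp_lt (m : ℕ) (i : ℕ ⊕ ℕ) : modelExp m i < modelExp (m + 1) i := by
  rcases i with n | n <;> rcases m with _ | _ | m <;> simp [modelExp]

/-- The weights `2 ^ (n e)`, with the exponents `e` of `modelExp`. -/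
noncomputable def modelWeights : Weights (ℕ ⊕ ℕ) where
  w m i := ((2 : ℝ) ^ modelIdx i) ^ modelExp m i
  pos m i := by positivity
  zero i := by rcases i with n | n <;> simp [modelExp]
  mono m i := pow_le_pow_right₀ (one_le_pow₀ one_le_two) (modelExp_lt m i).le
  tendsto m := by
    have hidx : Tendsto modelIdx cofinite atTop := by
      rw [← Nat.cofinite_eq_atTop]
      refine Tendsto.cofinite_of_finite_preimage_singleton fun n => ?_
      refine ((Set.finite_singleton (Sum.inr n)).insert (Sum.inl n)).subset fun i hi => ?_
      rcases i with k | k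
      · exact Or.inl (congrArg Sum.inl hi)
      · exact Or.inr (congrArg Sum.inr hi)
    refine squeeze_zero (fun i => by positivity) (fun i => ?_)
      ((tendsto_pow_atTop_nhds_zero_of_lt_one (r := (2 : ℝ)⁻¹) (by norm_num)
        (by norm_num)).comp hidx)
    have h1 : (1 : ℝ) ≤ 2 ^ modelIdx i := one_le_pow₀ one_le_two
    rw [div_le_iff₀ (by positivity), Function.comp_apply, inv_pow]
    have h2 : ((2 : ℝ) ^ modelIdx i) ^ (modelExp m i + 1) ≤
        ((2 : ℝ) ^ modelIdx i) ^ modelExp (m + 1) i := pow_le_pow_right₀ h1 (modelExp_lt m i)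
    rw [pow_succ] at h2
    rw [le_inv_mul_iff₀ (by positivity), mul_comm]
    exact h2

theorem modelWeights_inl_one (n : ℕ) : modelWeights.w 1 (.inl n) = 2 ^ n := by
  simp [modelWeights, modelExp, modelIdx]

theorem modelWeights_inr_one (n : ℕ) : modelWeights.w 1 (.inr n) = (2 ^ n) ^ 9 := by
  simp [modelWeights, modelExp, modelIdx]

theorem modelWeights_inl_two (n : ℕ) : modelWeights.w 2 (.inl n) = (2 ^ n) ^ 10 := by
  simp [modelWeights, modelExp, modelIdx]

theorem modelWeights_inr_two (n : ℕ) : modelWeights.w 2 (.inr n) = (2 ^ n) ^ 10 := by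
  simp [modelWeights, modelExp, modelIdx]

attribute [irreducible] modelWeights

/-- The dilation factor `D n = 2 ^ (8 n)`. -/
noncomputable def dil (n : ℕ) : ℝ := (2 ^ n) ^ 8

theorem summable_two_pow_inv : Summable fun n : ℕ => ((2 : ℝ) ^ n)⁻¹ := by
  simpa using summable_geometric_two

/-- A series of continuous functions, dominated on every ball by a multiple of `∑ 2⁻ⁿ`. -/
theorem continuous_tsum_of_le {X G : Type*} [NormedAddCommGroup X] [NormedAddCommGroup G]
    [CompleteSpace G] {F : ℕ → X → G} (hF : ∀ n, Continuous (F n)) {C : ℝ} (hC : 0 ≤ C)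
    (hb : ∀ n x, ‖F n x‖ ≤ (2 ^ n)⁻¹ * (C * (1 + ‖x‖))) : Continuous fun x => ∑' n, F n x := by
  refine continuous_iff_continuousAt.2 fun x => ?_
  have h : ContinuousOn (fun y => ∑' n, F n y) (Metric.ball 0 (‖x‖ + 1)) := by
    refine continuousOn_tsum (fun n => (hF n).continuousOn)
      (summable_two_pow_inv.mul_right (C * (1 + (‖x‖ + 1)))) fun n y hy => (hb n y).trans ?_
    have := (mem_ball_zero_iff.1 hy).le
    exact mul_le_mul_of_nonneg_left (by gcongr) (by positivity)
  exact h.continuousAt (Metric.isOpen_ball.mem_nhds (by simp))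

theorem hasSum_clm_apply {X G : Type*} [NormedAddCommGroup X] [NormedSpace ℝ X]
    [NormedAddCommGroup G] [NormedSpace ℝ G] {T : ℕ → X →L[ℝ] G} {A : X →L[ℝ] G}
    (h : HasSum T A) (x : X) : HasSum (fun n => T n x) (A x) :=
  (ContinuousLinearMap.apply ℝ G x).hasSum h

theorem norm_down_le (m : ℕ) (P : Model) : ‖modelWeights.down m P‖ ≤ ‖P‖ := by
  rw [← one_mul ‖P‖]
  refine norm_le_of_coord_le zero_le_one fun i => ?_
  rw [Weights.down_apply, norm_smul, norm_inv, Real.norm_of_nonneg (modelWeights.pos m i).le]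
  exact mul_le_mul_of_nonneg_right (inv_le_one_of_one_le₀ (modelWeights.one_le m i))
    (norm_nonneg _)

/-- On `E_1` the products `D n u n` are bounded by a multiple of `2⁻ⁿ`. -/
theorem norm_dil_mul_down_le (n : ℕ) (P : Model) :
    ‖(dil n : ℂ) * modelWeights.down 1 P (.inr n)‖ ≤ (2 ^ n)⁻¹ * ‖P‖ := by
  rw [Weights.down_apply, modelWeights_inr_one, norm_mul, norm_smul, Complex.norm_real,
    ← mul_assoc, ← norm_mul, dil, pow_succ _ 8, mul_inv, ← mul_assoc,
    mul_inv_cancel₀ (by positivity), one_mul, Real.norm_of_nonneg (by positivity)]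
  exact mul_le_mul_of_nonneg_left (norm_coord_le P _) (by positivity)

/-- The coefficient `g n (p) = D n u n twistDbar (D n z n)` of the twisted complex structure. -/
noncomputable def twistCoeff (n : ℕ) (p : Model) : ℂ :=
  dil n * coord (.inr n) p * twistDbar (dil n • coord (.inl n) p)

theorem contDiff_twistCoeff (n : ℕ) : ContDiff ℝ ∞ (twistCoeff n) := by
  have h : ∀ i, ContDiff ℝ ∞ (fun p : Model => coord i p) := fun i => (coord i).contDiff
  have h' : ContDiff ℝ ∞ fun p : Model => dil n • coord (.inl n) p := (h _).const_smul (dil n)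
  exact (contDiff_const.mul (h (.inr n))).mul (contDiff_twistDbar.comp h')

/-- The operator `h ↦ g n (p) · conj (h (inl n))`, with values in the line of the coordinate
`inr n`. -/
noncomputable def twistTerm (n : ℕ) (p : Model) : Model →L[ℝ] Model :=
  lp.singleContinuousLinearMap ℝ (fun _ : ℕ ⊕ ℕ => ℂ) 2 (.inr n) ∘L
    (twistCoeff n p • (Complex.conjCLE.toContinuousLinearMap ∘L coord (.inl n)))

theorem twistTerm_apply (n : ℕ) (p h : Model) :
    twistTerm n p h = lp.single 2 (.inr n) (twistCoeff n p * (starRingEnd ℂ) (h (.inl n))) := rfl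

theorem norm_twistTerm_le (n : ℕ) (p : Model) : ‖twistTerm n p‖ ≤ ‖twistCoeff n p‖ := by
  refine ContinuousLinearMap.opNorm_le_bound _ (norm_nonneg _) fun h => ?_
  rw [twistTerm_apply, lp.norm_single (by norm_num), norm_mul, RCLike.norm_conj]
  exact mul_le_mul_of_nonneg_left (norm_coord_le h _) (norm_nonneg _)

theorem continuous_twistTerm (n : ℕ) : Continuous (twistTerm n) := by
  exact continuous_const.clm_comp ((contDiff_twistCoeff n).continuous.smul continuous_const)

theorem exists_norm_twistTerm_down_le : ∃ C : ℝ, 0 ≤ C ∧ ∀ n P,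
    ‖twistTerm n (modelWeights.down 1 P)‖ ≤ (2 ^ n)⁻¹ * (C * (1 + ‖P‖)) := by
  obtain ⟨C, hC, h⟩ := exists_twist_bound
  refine ⟨C, hC.le, fun n P => (norm_twistTerm_le n _).trans ?_⟩
  rw [twistCoeff, norm_mul]
  refine (mul_le_mul (norm_dil_mul_down_le n P) (h _).2.2 (norm_nonneg _) (by positivity)).trans ?_
  have : (0 : ℝ) ≤ (2 ^ n)⁻¹ * C := by positivity
  nlinarith

/-- The nilpotent part `p ↦ ∑ n, twistTerm n p` of the twisted complex structure
(meaningful for `p ∈ E_1`). -/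
noncomputable def twistOp (p : Model) : Model →L[ℝ] Model := ∑' n, twistTerm n p

theorem continuous_twistOp_down : Continuous fun P => twistOp (modelWeights.down 1 P) := by
  obtain ⟨C, hC, h⟩ := exists_norm_twistTerm_down_le
  exact continuous_tsum_of_le (fun n => (continuous_twistTerm n).comp
    (modelWeights.down 1).continuous) hC h

theorem summable_twistTerm {p : Model} (hp : p ∈ modelWeights.scale.lev 1) :
    Summable fun n => twistTerm n p := by
  obtain ⟨C, hC, h⟩ := exists_norm_twistTerm_down_le
  refine Summable.of_norm_bounded (summable_two_pow_inv.mul_right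
    (C * (1 + ‖modelWeights.up 1 p‖))) fun n => ?_
  simpa only [Weights.down_up hp] using h n (modelWeights.up 1 p)

theorem hasSum_twistOp_coord {p : Model} (hp : p ∈ modelWeights.scale.lev 1) (h : Model)
    (i : ℕ ⊕ ℕ) : HasSum (fun n => twistTerm n p h i) (twistOp p h i) := by
  have h1 := (summable_twistTerm hp).hasSum
  rw [← twistOp] at h1
  have h2 := (coord i).hasSum (hasSum_clm_apply h1 h)
  simpa only [coord_apply] using h2

theorem twistOp_inl {p : Model} (hp : p ∈ modelWeights.scale.lev 1) (h : Model) (n : ℕ) :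
    twistOp p h (.inl n) = 0 := by
  refine (hasSum_twistOp_coord hp h (.inl n)).unique ?_
  have : (fun k => twistTerm k p h (.inl n)) = fun _ => 0 := funext fun k => by
    rw [twistTerm_apply, lp.single_apply]
    exact Pi.single_eq_of_ne (by simp) _
  rw [this]
  exact hasSum_zero

theorem twistOp_inr {p : Model} (hp : p ∈ modelWeights.scale.lev 1) (h : Model) (n : ℕ) :
    twistOp p h (.inr n) = twistCoeff n p * (starRingEnd ℂ) (h (.inl n)) := by
  refine (hasSum_twistOp_coord hp h (.inr n)).unique ?_
  have e : twistTerm n p h (.inr n) = twistCoeff n p * (starRingEnd ℂ) (h (.inl n)) := by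
    rw [twistTerm_apply, lp.single_apply]
    exact Pi.single_eq_same _ _
  rw [← e]
  refine hasSum_single n fun k hk => ?_
  rw [twistTerm_apply, lp.single_apply]
  exact Pi.single_eq_of_ne (by simpa using hk.symm) _

/-- Multiplication by `i` as a real-linear operator. -/
noncomputable def mulI : Model →L[ℝ] Model :=
  (Complex.I • ContinuousLinearMap.id ℂ Model).restrictScalars ℝ

theorem mulI_apply (h : Model) (i : ℕ ⊕ ℕ) : mulI h i = Complex.I * h i := rfl

/-- The twisted complex structure. Its value at `p` is, on the coordinates of index `n`,
`(h_z, h_u) ↦ (i h_z, i h_u + g n (p) conj h_z)`. -/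
noncomputable def twistJ (p h : Model) : Model := mulI h + twistOp p h

theorem twistJ_inl {p : Model} (hp : p ∈ modelWeights.scale.lev 1) (h : Model) (n : ℕ) :
    twistJ p h (.inl n) = Complex.I * h (.inl n) := by
  rw [twistJ, lp.coeFn_add, Pi.add_apply, twistOp_inl hp, add_zero, mulI_apply]

theorem twistJ_inr {p : Model} (hp : p ∈ modelWeights.scale.lev 1) (h : Model) (n : ℕ) :
    twistJ p h (.inr n) =
      Complex.I * h (.inr n) + twistCoeff n p * (starRingEnd ℂ) (h (.inl n)) := by
  rw [twistJ, lp.coeFn_add, Pi.add_apply, twistOp_inr hp, mulI_apply]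

theorem twistJ_twistJ {p : Model} (hp : p ∈ modelWeights.scale.lev 1) (h : Model) :
    twistJ p (twistJ p h) = -h := Ell2.ext fun i => by
  rw [lp.coeFn_neg, Pi.neg_apply]
  rcases i with n | n
  · rw [twistJ_inl hp, twistJ_inl hp]
    linear_combination h (.inl n) * Complex.I_sq
  · rw [twistJ_inr hp, twistJ_inr hp, twistJ_inl hp, map_mul, Complex.conj_I]
    linear_combination h (.inr n) * Complex.I_sq

end Model

/-! ### The complex M-polyfold with the twisted structure -/

section ComplexModel

theorem isScOperator_id {E : Type*} [AddCommGroup E] [Module ℝ E] (S : ScScale E) :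
    IsScOperator S S LinearMap.id := fun _ => ⟨1, fun _ hx => ⟨hx, (one_mul _).ge⟩⟩

theorem mem_tangent_lev {E : Type*} [AddCommGroup E] [Module ℝ E] {S : ScScale E} {m : ℕ}
    {q : E × E} : q ∈ S.tangent.lev m ↔ q.1 ∈ S.lev (m + 1) ∧ q.2 ∈ S.lev m := Iff.rfl

theorem tangent_nrm_zero {E : Type*} [AddCommGroup E] [Module ℝ E] (S : ScScale E) (q : E × E) :
    S.tangent.nrm 0 q = max (S.nrm 1 q.1) (S.nrm 0 q.2) := rfl

theorem mem_lev_zero (x : Model) : x ∈ modelWeights.scale.lev 0 :=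
  Weights.scale_lev_zero (W := modelWeights) ▸ Submodule.mem_top

theorem univ_eq_lev_zero : (Set.univ : Set Model) = modelWeights.scale.lev 0 := by
  rw [Weights.scale_lev_zero]; rfl

theorem hasScDerivAt_id (p : Model) :
    HasScDerivAt modelWeights.scale modelWeights.scale id Set.univ p LinearMap.id := by
  refine ⟨⟨1, fun h _ => ⟨mem_lev_zero _, (one_mul _).ge⟩⟩,
    fun ε hε => ⟨1, one_pos, fun h hh _ _ => ?_⟩⟩
  rw [show id (p + h) - id p - LinearMap.id h = (0 : Model) by simp, Weights.isTame.nrm_zero]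
  exact mul_nonneg hε.le (Weights.isTame.nrm_nonneg 1 h hh)

theorem tangentAt_id (p w : Model) : w ∈ tangentAt modelWeights.scale Set.univ id p :=
  ⟨LinearMap.id, hasScDerivAt_id p, w, rfl⟩

theorem isPartialQuadrant_univ : IsPartialQuadrant modelWeights.scale (Set.univ : Set Model) := by
  refine ⟨0, Model, _, _, modelWeights.scale, Weights.isScBanach,
    (LinearEquiv.uniqueProd (R := ℝ) (M := Model) (M₂ := Fin 0 → ℝ)).symm, fun m => ⟨1, fun x hx =>
      ⟨⟨trivial, hx⟩, ?_⟩⟩, fun m => ⟨1, fun x hx => ⟨hx.2, ?_⟩⟩, ?_⟩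
  · rw [one_mul]
    refine max_le ?_ le_rfl
    change ‖(_ : Fin 0 → ℝ)‖ ≤ _
    exact (norm_of_subsingleton _).trans_le (Weights.isTame.nrm_nonneg m x hx)
  · rw [one_mul]
    exact le_max_right _ _
  · ext q
    simp only [Set.image_univ, Set.mem_range, Set.mem_ofPred_eq, IsEmpty.forall_iff, iff_true]
    exact (LinearEquiv.surjective _) q

theorem not_finiteDimensional_model : ¬ FiniteDimensional ℝ Model := by
  intro h
  refine Module.Finite.not_linearIndependent_of_infinite (R := ℝ)
    (fun n : ℕ => (lp.single 2 (.inl n) 1 : Model)) (linearIndependent_iff'.2 fun s g hg n hn => ?_)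
  have h1 := congrArg (fun x => coord (.inl n) x) hg
  simp only [map_sum, map_smul, coord_apply, lp.single_apply, map_zero] at h1
  rw [Finset.sum_eq_single n (fun k _ hk => ?_) (fun h => absurd hn h), Pi.single_eq_same] at h1
  · simpa using h1
  · rw [Pi.single_eq_of_ne (by simpa using hk.symm), smul_zero]

theorem isScSmoothRetraction_id :
    IsScSmoothRetraction modelWeights.scale Set.univ Set.univ id where
  scBanach := Weights.isScBanach
  quadrant := isPartialQuadrant_univ
  relOpen := ⟨subset_rfl, fun _ _ => ⟨1, one_pos, fun _ _ _ => trivial⟩⟩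
  mapsTo _ _ := trivial
  smooth := by
    rw [univ_eq_lev_zero]
    exact IsScOperator.isScSmooth (A := LinearMap.id) Weights.isTame Weights.isTame
      (isScOperator_id _)
  retract _ _ := rfl

theorem isEvenDimensional_id : IsEvenDimensional modelWeights.scale Set.univ id := by
  intro p _ _ A hA
  refine Or.inl fun h => not_finiteDimensional_model ?_
  have hA' : A = LinearMap.id := LinearMap.ext fun v =>
    hA.unique Weights.isTame Weights.isTame (hasScDerivAt_id p) (fun y _ => mem_lev_zero y) trivial
      ⟨1, one_pos, fun _ _ _ => trivial⟩ v (mem_lev_zero v)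
  rw [hA', LinearMap.range_id] at h
  exact Module.Finite.equiv (Submodule.topEquiv (R := ℝ) (M := Model))

theorem norm_mulI (x : Model) : ‖mulI x‖ = ‖x‖ := by
  change ‖Complex.I • x‖ = _
  rw [norm_smul, Complex.norm_I, one_mul]

theorem mulI_mem {m : ℕ} {x : Model} (hx : x ∈ modelWeights.scale.lev m) :
    mulI x ∈ modelWeights.scale.lev m := by
  have : mulI x = modelWeights.down m (mulI (modelWeights.up m x)) := Ell2.ext fun i => by
    rw [Weights.down_apply, mulI_apply, mulI_apply, Weights.up_apply hx, mul_smul_comm, smul_smul,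
      inv_mul_cancel₀ (modelWeights.pos m i).ne', one_smul]
  rw [this]
  exact Weights.down_mem m _

theorem isScOperator_mulI :
    IsScOperator modelWeights.scale modelWeights.scale mulI.toLinearMap := by
  refine fun m => ⟨1, fun x hx => ⟨mulI_mem hx, ?_⟩⟩
  have : modelWeights.up m (mulI x) = mulI (modelWeights.up m x) := Ell2.ext fun i => by
    rw [Weights.up_apply (mulI_mem hx), mulI_apply, mulI_apply, Weights.up_apply hx,
      mul_smul_comm]
  change modelWeights.scale.nrm m (mulI x) ≤ 1 * modelWeights.scale.nrm m x
  rw [Weights.norm_up, Weights.norm_up, this, norm_mulI, one_mul]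

/-- A linear map from a finite-dimensional space into `E_∞` is bounded into every level. -/
theorem exists_nrm_le_of_finiteDimensional {V : Type} [NormedAddCommGroup V] [NormedSpace ℝ V]
    [FiniteDimensional ℝ V] (L : V →ₗ[ℝ] Model) (m : ℕ)
    (hL : ∀ v, L v ∈ modelWeights.scale.lev m) :
    ∃ K : ℝ, 0 ≤ K ∧ ∀ v, modelWeights.scale.nrm m (L v) ≤ K * ‖v‖ := by
  let L' : V →ₗ[ℝ] Model :=
    { toFun := fun v => modelWeights.up m (L v)
      map_add' := fun v w => by rw [map_add, Weights.up_add (hL v) (hL w)]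
      map_smul' := fun c v => by rw [map_smul, Weights.up_smul (hL v)]; rfl }
  exact ⟨‖L'.toContinuousLinearMap‖, norm_nonneg _, fun v =>
    (Weights.norm_up m (L v)).trans_le (L'.toContinuousLinearMap.le_opNorm v)⟩

/-- Near a point of `E_2` only finitely many of the coefficients of the twisted structure do not
vanish. -/
theorem exists_twistCoeff_eq_zero (M : ℝ) : ∃ N, ∀ n, N ≤ n → ∀ p ∈ modelWeights.scale.lev 2,
    modelWeights.scale.nrm 2 p ≤ M → twistCoeff n p = 0 := by
  obtain ⟨N, hN⟩ := pow_unbounded_of_one_lt M one_lt_two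
  refine ⟨N, fun n hn p hp hpM => ?_⟩
  have h1 : M < 2 ^ n := hN.trans_le (pow_le_pow_right₀ one_le_two hn)
  have h2 := (Weights.weight_mul_norm_le hp (.inl n)).trans hpM
  rw [modelWeights_inl_two] at h2
  have h3 : ‖dil n • coord (.inl n) p‖ < 1 := by
    rw [norm_smul, dil, Real.norm_of_nonneg (by positivity), coord_apply]
    by_contra! hle
    have h4 : (1 : ℝ) ≤ 2 ^ n := one_le_pow₀ one_le_two
    have h5 : ((2 : ℝ) ^ n) ^ 10 * ‖p (.inl n)‖
        = ((2 : ℝ) ^ n) ^ 2 * (((2 : ℝ) ^ n) ^ 8 * ‖p (.inl n)‖) := by ring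
    nlinarith
  rw [twistCoeff, twistDbar_of_norm_lt h3, mul_zero]

theorem contDiff_twistCoeff_mul_conj (n : ℕ) : ContDiff ℝ ∞ fun q : Model × Model =>
    twistCoeff n q.1 * (starRingEnd ℂ) (coord (.inl n) q.2) := by
  have h1 : ContDiff ℝ ∞ fun q : Model × Model => twistCoeff n q.1 :=
    (contDiff_twistCoeff n).comp contDiff_fst
  have h2 : ContDiff ℝ ∞ fun p : Model => coord (.inl n) p :=
    (coord (Sum.inl n)).contDiff
  have h3 : ContDiff ℝ ∞ fun q : Model × Model => coord (.inl n) q.2 := h2.comp contDiff_snd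
  have h4 : ContDiff ℝ ∞ fun q : Model × Model => (starRingEnd ℂ) (coord (.inl n) q.2) :=
    Complex.conjCLE.contDiff.comp h3
  exact h1.mul h4

theorem continuous_twistJ_down : Continuous fun z : Model × Model =>
    mulI z.2 + twistOp (modelWeights.down 1 z.1) z.2 := by
  have h1 : Continuous fun z : Model × Model => twistOp (modelWeights.down 1 z.1) :=
    continuous_twistOp_down.comp continuous_fst
  have h2 : Continuous fun z : Model × Model => mulI z.2 := mulI.continuous.comp continuous_snd
  exact h2.add (h1.clm_apply continuous_snd)

/-- The tangent map of the twisted structure factors smoothly through finitely many coordinates near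
the points of `E_2 × E_1`. -/
theorem factorsSmoothlyAt_twistJ {q : Model × Model}
    (hq : q ∈ modelWeights.scale.tangent.lev 1) :
    FactorsSmoothlyAt modelWeights.scale.tangent modelWeights.scale.tangent 1
      (fun q => (q.1, twistJ q.1 q.2)) (LinearMap.id.prodMap mulI.toLinearMap) q := by
  obtain ⟨N, hN⟩ := exists_twistCoeff_eq_zero (modelWeights.scale.nrm 2 q.1 + 1)
  let L₀ : (Fin N → ℂ) →ₗ[ℝ] Model := ∑ n : Fin N,
    (lp.singleContinuousLinearMap ℝ (fun _ : ℕ ⊕ ℕ => ℂ) 2 (.inr n)).toLinearMap ∘ₗ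
      LinearMap.proj n
  have hL₀ : ∀ v, L₀ v = ∑ n : Fin N, lp.single 2 (.inr n) (v n) := fun v => by
    simp only [L₀, LinearMap.sum_apply]
    rfl
  have hmem : ∀ m v, L₀ v ∈ modelWeights.scale.lev m := fun m v => by
    rw [hL₀]
    exact Submodule.sum_mem _ fun n _ => Weights.single_mem m _ _
  refine ⟨Model × Model, Fin N → ℂ, _, inferInstance, _, inferInstance, LinearMap.id,
    fun q n => twistCoeff n q.1 * (starRingEnd ℂ) (coord (.inl n) q.2), LinearMap.inr ℝ _ _ ∘ₗ L₀,
    ?_, ⟨1, zero_le_one, fun h hh => ?_⟩, fun m => ?_, 1, one_pos, fun y hy hyq => ?_⟩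
  · refine contDiff_pi.2 fun n => contDiff_twistCoeff_mul_conj n
  · have h1 := Weights.nrm_le_succ 0 (mem_tangent_lev.1 hh).1
    rw [Weights.scale_nrm_zero] at h1
    rw [one_mul, tangent_nrm_zero, Weights.scale_nrm_zero, LinearMap.id_apply, Prod.norm_def]
    exact max_le_max h1 le_rfl
  · obtain ⟨K, hK, h⟩ := exists_nrm_le_of_finiteDimensional L₀ m (hmem m)
    refine ⟨K, hK, fun v => ⟨⟨zero_mem _, hmem m v⟩, max_le ?_ (h v)⟩⟩
    change modelWeights.scale.nrm (m + 1) 0 ≤ _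
    rw [Weights.isTame.nrm_zero]
    positivity
  · have h1 : modelWeights.scale.nrm 2 y.1 ≤ modelWeights.scale.nrm 2 q.1 + 1 := by
      have h2 : modelWeights.scale.nrm 2 (y.1 - q.1) < 1 := (le_max_left _ _).trans_lt hyq
      have h3 := Weights.isTame.nrm_add_le 2 _ hq.1 _ (sub_mem hy.1 hq.1)
      rw [add_sub_cancel] at h3
      linarith
    refine Prod.ext ?_ ?_
    · change y.1 = y.1 + 0
      rw [add_zero]
    · change mulI y.2 + twistOp y.1 y.2 = mulI y.2 + L₀ _
      rw [hL₀, twistOp, tsum_eq_sum (s := Finset.range N) fun n hn => ?_, sum_apply,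
        Finset.sum_range]
      · rfl
      · rw [Finset.mem_range, not_lt] at hn
        rw [← norm_le_zero_iff]
        refine (norm_twistTerm_le n y.1).trans ?_
        rw [hN n hn y.1 hy.1 h1, norm_zero]

theorem isScSmooth_twistJ : IsScSmooth modelWeights.scale.tangent modelWeights.scale.tangent
    (fun q => (q.1, twistJ q.1 q.2)) (tangentSet modelWeights.scale Set.univ) := by
  rw [univ_eq_lev_zero, tangentSet_lev_zero Weights.isTame.toIsNested]
  refine isScSmooth_of_factors Weights.isTame.tangent Weights.isTame.tangent
    (IsScOperator.prodMap (Weights.isTame.toIsNested.shift 1) Weights.isTame.toIsNested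
      (isScOperator_id _) isScOperator_mulI) (fun q hq => ?_)
    fun q hq => factorsSmoothlyAt_twistJ hq
  have hq1 := (mem_tangent_lev.1 hq).1
  refine ⟨⟨hq1, mem_lev_zero _⟩, fun ε hε => ?_⟩
  obtain ⟨d, hd, H⟩ :=
    Metric.continuous_iff.1 continuous_twistJ_down (modelWeights.up 1 q.1, q.2) ε hε
  refine ⟨min d ε, lt_min hd hε, fun y hy hyq => ?_⟩
  have hy1 := (mem_tangent_lev.1 hy).1
  rw [tangent_nrm_zero, Weights.scale_nrm_zero] at hyq ⊢
  have h1 : ‖modelWeights.up 1 y.1 - modelWeights.up 1 q.1‖ < min d ε := by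
    rw [← Weights.up_sub hy1 hq1, ← Weights.norm_up]
    exact (le_max_left _ _).trans_lt hyq
  have h2 : ‖y.2 - q.2‖ < min d ε := (le_max_right _ _).trans_lt hyq
  have h3 := H (modelWeights.up 1 y.1, y.2) (by
    rw [dist_eq_norm, Prod.norm_def]
    exact max_lt (h1.trans_le (min_le_left _ _)) (h2.trans_le (min_le_left _ _)))
  rw [dist_eq_norm, Weights.down_up hy1, Weights.down_up hq1] at h3
  exact max_lt (((le_max_left _ _).trans_lt hyq).trans_le (min_le_right _ _)) h3

theorem isAlmostComplexStructure_twistJ :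
    IsAlmostComplexStructure modelWeights.scale Set.univ id twistJ where
  mem p _ _ w _ := tangentAt_id p _
  add p _ _ w _ w' _ := by
    simp only [twistJ, map_add]
    abel
  smul p _ _ c w _ := by simp only [twistJ, map_smul, smul_add]
  sq p _ hp w _ := twistJ_twistJ hp w
  smooth := ⟨fun _ => LinearMap.id, fun x _ _ => hasScDerivAt_id x, isScSmooth_twistJ⟩

end ComplexModel

/-! ### Integrability of the twisted structure -/

section Integrability

/-- A relation between the derivatives of two vector fields that holds on `E_∞` holds on `E_1`. -/
theorem eq_on_lev_one_of_eq_on_smooth {f₁ f₂ : Model → Model} {U : Set Model} {p : Model}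
    {A₁ A₂ : Model →ₗ[ℝ] Model}
    (hA₁ : HasScDerivAt (modelWeights.scale.shift 1) modelWeights.scale f₁ U p A₁)
    (hA₂ : HasScDerivAt (modelWeights.scale.shift 1) modelWeights.scale f₂ U p A₂)
    (Φ Ψ Θ : Model →L[ℝ] ℂ)
    (h : ∀ v, (∀ i, v ∈ modelWeights.scale.lev i) → Φ (A₂ v) = Ψ (A₁ v) + Θ v) :
    ∀ v ∈ modelWeights.scale.lev 1, Φ (A₂ v) = Ψ (A₁ v) + Θ v := by
  have hb : ∀ {A : Model →ₗ[ℝ] Model} {f : Model → Model},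
      HasScDerivAt (modelWeights.scale.shift 1) modelWeights.scale f U p A →
      ∃ K, ∀ h ∈ modelWeights.scale.lev 1, ‖A h‖ ≤ K * modelWeights.scale.nrm 1 h := by
    rintro A f ⟨⟨K, hK⟩, -⟩
    refine ⟨K, fun h hh => ?_⟩
    have := (hK h hh).2
    rwa [Weights.scale_nrm_zero] at this
  obtain ⟨K₁, hK₁⟩ := hb hA₁
  obtain ⟨K₂, hK₂⟩ := hb hA₂
  refine eq_on_lev_of_eq_on_smooth (S := modelWeights.scale) (T := constScale ℂ) Weights.isTame
    (isTame_constScale ℂ) (A := Φ.toLinearMap ∘ₗ A₂) (B := Ψ.toLinearMap ∘ₗ A₁ + Θ.toLinearMap)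
    (K := ‖Φ‖ * K₂) (fun v hv => ⟨trivial, ?_⟩) (K' := ‖Ψ‖ * K₁ + ‖Θ‖)
    (fun v hv => ⟨trivial, ?_⟩) h
  · rw [mul_assoc]
    exact (Φ.le_opNorm _).trans (mul_le_mul_of_nonneg_left (hK₂ v hv) (norm_nonneg _))
  · rw [add_mul, mul_assoc]
    have h1 := Weights.nrm_le_succ 0 hv
    rw [Weights.scale_nrm_zero] at h1
    refine (norm_add_le _ _).trans (add_le_add ?_ ?_)
    · exact (Ψ.le_opNorm _).trans (mul_le_mul_of_nonneg_left (hK₁ v hv) (norm_nonneg _))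
    · exact (Θ.le_opNorm _).trans (mul_le_mul_of_nonneg_left h1 (norm_nonneg _))

theorem twistJ_section_coord {O' : Set Model} {μ₁ μ₂ : Model → Model}
    (hμ : IsOneZeroSection modelWeights.scale Set.univ id twistJ O' μ₁ μ₂) {p : Model}
    (hp : p ∈ O') (hp1 : p ∈ modelWeights.scale.lev 1) (n : ℕ) :
    μ₂ p (.inl n) = -(Complex.I * μ₁ p (.inl n)) ∧
      μ₂ p (.inr n) = -(Complex.I * μ₁ p (.inr n))
        - twistCoeff n p * (starRingEnd ℂ) (μ₁ p (.inl n)) := by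
  have h := (hμ.2.2 p hp hp1).2.2.1
  have h1 := congrArg (fun x : Model => x (.inl n)) h
  have h2 := congrArg (fun x : Model => x (.inr n)) h
  simp only [twistJ_inl hp1, twistJ_inr hp1, lp.coeFn_neg, Pi.neg_apply] at h1 h2
  exact ⟨by rw [h1, neg_neg], by linear_combination h2⟩

/-- Conjugation of a coordinate. -/
noncomputable def conjCoord (i : ℕ ⊕ ℕ) : Model →L[ℝ] ℂ :=
  Complex.conjCLE.toContinuousLinearMap ∘L coord i

theorem conjCoord_apply (i : ℕ ⊕ ℕ) (x : Model) : conjCoord i x = (starRingEnd ℂ) (x i) := rfl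

theorem exists_clm_neg_I_mul_coord (i : ℕ ⊕ ℕ) :
    ∃ Z : Model →L[ℝ] ℂ, ∀ x, Z x = -(Complex.I * x i) :=
  ⟨-(Complex.I • coord i), fun _ => rfl⟩

/-- The differentiated equations of a section of `T^{1,0}`. -/
theorem twistJ_section_deriv {O' : Set Model}
    (hO : IsRelOpen modelWeights.scale (id '' (Set.univ : Set Model)) O') {μ₁ μ₂ : Model → Model}
    (hμ : IsOneZeroSection modelWeights.scale Set.univ id twistJ O' μ₁ μ₂) {p : Model}
    (hp : p ∈ O') (hp2 : p ∈ modelWeights.scale.lev 2) {A₁ A₂ : Model →ₗ[ℝ] Model}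
    (hA₁ : HasScDerivAt (modelWeights.scale.shift 1) modelWeights.scale (μ₁ ∘ id)
      (Set.univ ∩ id ⁻¹' O') p A₁)
    (hA₂ : HasScDerivAt (modelWeights.scale.shift 1) modelWeights.scale (μ₂ ∘ id)
      (Set.univ ∩ id ⁻¹' O') p A₂) (n : ℕ) :
    ∀ v ∈ modelWeights.scale.lev 1, A₂ v (.inl n) = -(Complex.I * A₁ v (.inl n)) ∧
      A₂ v (.inr n) = -(Complex.I * A₁ v (.inr n))
        - twistCoeff n p * (starRingEnd ℂ) (A₁ v (.inl n))
        - fderiv ℝ (twistCoeff n) p v * (starRingEnd ℂ) (μ₁ p (.inl n)) := by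
  have hline : ∀ v, (∀ i, v ∈ modelWeights.scale.lev i) → ∀ᶠ t : ℝ in 𝓝 0,
      p + t • v ∈ O' ∧ p + t • v ∈ modelWeights.scale.lev 1 := by
    intro v hv
    obtain ⟨d, hd, H⟩ := hO.2 p hp
    have h1 : ContinuousAt (fun t : ℝ => ‖t • v‖) 0 := by fun_prop
    filter_upwards [h1.eventually (gt_mem_nhds (show ‖(0 : ℝ) • v‖ < d by simpa using hd))]
      with t ht
    refine ⟨H _ ⟨_, trivial, rfl⟩ ?_, add_mem (Weights.lev_succ_le 1 hp2)
      (Submodule.smul_mem _ _ (hv 1))⟩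
    rwa [add_sub_cancel_left, Weights.scale_nrm_zero]
  have hderiv : ∀ {f : Model → Model} {A : Model →ₗ[ℝ] Model},
      HasScDerivAt (modelWeights.scale.shift 1) modelWeights.scale (f ∘ id)
        (Set.univ ∩ id ⁻¹' O') p A → ∀ v, (∀ i, v ∈ modelWeights.scale.lev i) →
      ∀ π : Model →L[ℝ] ℂ, HasDerivAt (fun t : ℝ => π (f (p + t • v))) (π (A v)) 0 :=
    fun {f A} hA v hv π => hA.hasDerivAt_line (Weights.isTame.shift 1) π.toLinearMap
      (norm_nonneg π) (fun w _ => by rw [Weights.scale_nrm_zero]; exact π.le_opNorm w)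
      (fun y _ => mem_lev_zero _) ⟨trivial, hp⟩ (hv 2) ((hline v hv).mono fun t ht =>
        ⟨trivial, ht.1⟩)
  obtain ⟨Z, hZ⟩ := exists_clm_neg_I_mul_coord (.inl n)
  obtain ⟨W, hW⟩ := exists_clm_neg_I_mul_coord (.inr n)
  have hz : ∀ v ∈ modelWeights.scale.lev 1, coord (.inl n) (A₂ v) =
      Z (A₁ v) + (0 : Model →L[ℝ] ℂ) v := by
    refine eq_on_lev_one_of_eq_on_smooth hA₁ hA₂ _ _ _ fun v hv => ?_
    refine (hderiv hA₂ v hv (coord (.inl n))).unique ?_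
    rw [zero_apply, add_zero]
    refine (hderiv hA₁ v hv Z).congr_of_eventuallyEq ?_
    filter_upwards [hline v hv] with t ht
    rw [hZ, coord_apply]
    exact (twistJ_section_coord hμ ht.1 ht.2 n).1
  have hu : ∀ v ∈ modelWeights.scale.lev 1, coord (.inr n) (A₂ v) =
      (W - twistCoeff n p • conjCoord (.inl n)) (A₁ v) +
        (-(conjCoord (.inl n) (μ₁ p) • fderiv ℝ (twistCoeff n) p)) v := by
    refine eq_on_lev_one_of_eq_on_smooth hA₁ hA₂ _ _ _ fun v hv => ?_
    refine (hderiv hA₂ v hv (coord (.inr n))).unique ?_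
    have hg : HasDerivAt (fun t : ℝ => twistCoeff n (p + t • v))
        (fderiv ℝ (twistCoeff n) p v) 0 := by
      have h1 : HasDerivAt (fun t : ℝ => p + t • v) v 0 := by
        simpa using ((hasDerivAt_id (0 : ℝ)).smul_const v).const_add p
      have h2 : HasFDerivAt (twistCoeff n) (fderiv ℝ (twistCoeff n) p) (p + (0 : ℝ) • v) := by
        rw [zero_smul, add_zero]
        exact ((contDiff_twistCoeff n).differentiable (by simp) p).hasFDerivAt
      exact h2.comp_hasDerivAt 0 h1
    have h1 := (hderiv hA₁ v hv W).sub (hg.mul (hderiv hA₁ v hv (conjCoord (.inl n))))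
    rw [zero_smul, add_zero] at h1
    refine (h1.congr_of_eventuallyEq ?_).congr_deriv ?_
    · filter_upwards [hline v hv] with t ht
      rw [Pi.sub_apply, Pi.mul_apply, hW, coord_apply, conjCoord_apply]
      exact (twistJ_section_coord hμ ht.1 ht.2 n).2
    · simp only [sub_apply, neg_apply, smul_apply, smul_eq_mul]
      ring
  intro v hv
  have h1 := hz v hv
  have h2 := hu v hv
  simp only [zero_apply, add_zero, sub_apply, neg_apply, smul_apply, smul_eq_mul, coord_apply,
    conjCoord_apply, hZ, hW] at h1 h2
  exact ⟨h1, by rw [h2]; ring⟩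

theorem fderiv_twistCoeff (n : ℕ) (p v : Model) : fderiv ℝ (twistCoeff n) p v =
    dil n * twistDbar (dil n • p (.inl n)) * v (.inr n) +
      dil n * p (.inr n) * fderiv ℝ twistDbar (dil n • p (.inl n)) (dil n • v (.inl n)) := by
  have h1 : HasFDerivAt (fun p : Model => dil n • coord (.inl n) p) (dil n • coord (.inl n)) p :=
    (coord (Sum.inl n)).hasFDerivAt.const_smul (dil n)
  have h2 : HasFDerivAt twistDbar (fderiv ℝ twistDbar (dil n • coord (.inl n) p))
      (dil n • coord (.inl n) p) :=
    (contDiff_twistDbar.differentiable (by simp) _).hasFDerivAt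
  have h3 : HasFDerivAt (fun p : Model => (dil n : ℂ) * coord (.inr n) p)
      ((dil n : ℂ) • coord (.inr n)) p := (coord (Sum.inr n)).hasFDerivAt.const_mul _
  have h4 := h3.mul (h2.comp p h1)
  have e : twistCoeff n = (fun p : Model => (dil n : ℂ) * coord (.inr n) p) *
    (twistDbar ∘ fun p : Model => dil n • coord (.inl n) p) := rfl
  rw [e, h4.fderiv]
  simp only [add_apply, smul_apply, smul_eq_mul, ContinuousLinearMap.comp_apply, coord_apply,
    Function.comp_apply]
  ring

/-- Along a vector of `T^{1,0}`, the derivative of the coefficient of the twisted structure is a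
multiple of the conjugate of its first coordinate; this is the integrability condition. -/
theorem exists_fderiv_twistCoeff_eq (n : ℕ) (p : Model) : ∃ c : ℂ, ∀ v w : Model,
    w (.inl n) = -(Complex.I * v (.inl n)) →
    w (.inr n) = -(Complex.I * v (.inr n)) - twistCoeff n p * (starRingEnd ℂ) (v (.inl n)) →
    fderiv ℝ (twistCoeff n) p v - Complex.I * fderiv ℝ (twistCoeff n) p w =
      c * (starRingEnd ℂ) (v (.inl n)) := by
  set L := fderiv ℝ twistDbar (dil n • p (.inl n)) with hL
  refine ⟨dil n * twistDbar (dil n • p (.inl n)) * Complex.I * twistCoeff n p +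
    dil n * p (.inr n) * (L 1 + Complex.I * L Complex.I) * dil n, fun v w h1 h2 => ?_⟩
  have h3 := map_I_mul_sub L (dil n • v (.inl n))
  have h4 : dil n • w (.inl n) = -(Complex.I * (dil n • v (.inl n))) := by
    rw [h1, smul_neg, mul_smul_comm]
  have h5 : (starRingEnd ℂ) (dil n • v (.inl n)) = dil n * (starRingEnd ℂ) (v (.inl n)) := by
    rw [Complex.real_smul, map_mul, Complex.conj_ofReal]
  rw [fderiv_twistCoeff, fderiv_twistCoeff, ← hL, h4, map_neg, h2]
  rw [h5] at h3
  linear_combination (dil n * p (.inr n) * Complex.I) * h3 +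
    (dil n * twistDbar (dil n • p (.inl n)) * v (.inr n) +
      dil n * p (.inr n) * L (dil n • v (.inl n)) - dil n * p (.inr n) *
      (L 1 + Complex.I * L Complex.I) * (dil n * (starRingEnd ℂ) (v (.inl n)))) * Complex.I_sq

theorem isIntegrable_twistJ : IsIntegrable modelWeights.scale Set.univ id twistJ := by
  intro O' hO μ₁ μ₂ ν₁ ν₂ hμ hν p hp hp2 A₁ A₂ B₁ B₂ hA₁ hA₂ hB₁ hB₂
  have hp1 := Weights.lev_succ_le 1 hp2
  have hmem : ∀ {f : Model → Model}, IsScSmooth (modelWeights.scale.shift 1) modelWeights.scale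
      (f ∘ id) (Set.univ ∩ id ⁻¹' O') → f p ∈ modelWeights.scale.lev 1 := fun hf =>
    (hf 0 1 p ⟨trivial, hp⟩ hp2).1
  have hμ₁ := hmem hμ.1
  have hμ₂ := hmem hμ.2.1
  have hν₁ := hmem hν.1
  have hν₂ := hmem hν.2.1
  have key : twistJ p ((A₁ (ν₁ p) - B₁ (μ₁ p)) - (A₂ (ν₂ p) - B₂ (μ₂ p))) =
      -((A₁ (ν₂ p) - B₂ (μ₁ p)) + (A₂ (ν₁ p) - B₁ (μ₂ p))) := by
    refine Ell2.ext fun i => ?_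
    rcases i with n | n
    · have hA := twistJ_section_deriv hO hμ hp hp2 hA₁ hA₂ n
      have hB := twistJ_section_deriv hO hν hp hp2 hB₁ hB₂ n
      rw [twistJ_inl hp1]
      simp only [lp.coeFn_neg, lp.coeFn_add, lp.coeFn_sub, Pi.neg_apply, Pi.add_apply,
        Pi.sub_apply]
      rw [(hA _ hν₁).1, (hA _ hν₂).1, (hB _ hμ₁).1, (hB _ hμ₂).1]
      linear_combination (A₁ (ν₂ p) (.inl n) - B₁ (μ₂ p) (.inl n)) * Complex.I_sq
    · have hA := twistJ_section_deriv hO hμ hp hp2 hA₁ hA₂ n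
      have hB := twistJ_section_deriv hO hν hp hp2 hB₁ hB₂ n
      obtain ⟨c, hc⟩ := exists_fderiv_twistCoeff_eq n p
      obtain ⟨hm, hm'⟩ := twistJ_section_coord hμ hp hp1 n
      obtain ⟨hk, hk'⟩ := twistJ_section_coord hν hp hp1 n
      have qμ := hc _ _ hm hm'
      have qν := hc _ _ hk hk'
      rw [twistJ_inr hp1]
      simp only [lp.coeFn_neg, lp.coeFn_add, lp.coeFn_sub, Pi.neg_apply, Pi.add_apply,
        Pi.sub_apply]
      rw [(hA _ hν₂).1, (hB _ hμ₂).1, (hA _ hν₁).2, (hA _ hν₂).2, (hB _ hμ₁).2, (hB _ hμ₂).2]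
      simp only [map_sub, map_neg, map_mul, Complex.conj_I]
      linear_combination (A₁ (ν₂ p) (.inr n) - B₁ (μ₂ p) (.inr n)) * Complex.I_sq
        - (starRingEnd ℂ) (μ₁ p (.inl n)) * qν + (starRingEnd ℂ) (ν₁ p (.inl n)) * qμ
  refine ⟨tangentAt_id p _, tangentAt_id p _, key, ?_⟩
  rw [← neg_eq_iff_eq_neg.2 key]
  have h := twistJ_twistJ hp1 ((A₁ (ν₁ p) - B₁ (μ₁ p)) - (A₂ (ν₂ p) - B₂ (μ₂ p)))
  have hneg : ∀ x, twistJ p (-x) = -twistJ p x := fun x => by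
    simp only [twistJ, map_neg]
    abel
  rw [hneg, h, neg_neg]

theorem isComplexMPolyfold_twistJ :
    IsComplexMPolyfold modelWeights.scale Set.univ Set.univ id twistJ where
  retraction := isScSmoothRetraction_id
  reflexive := Weights.isReflexive
  even := isEvenDimensional_id
  almostComplex := isAlmostComplexStructure_twistJ
  integrable := isIntegrable_twistJ

end Integrability

/-! ### An sc-holomorphic function that is not sc² -/

section TwistSum

/-- The summand `2⁻ⁿ twist (D n z n) u n`. -/
noncomputable def sumTerm (n : ℕ) (p : Model) : ℂ :=
  ((2 : ℝ) ^ n)⁻¹ • (twist (dil n • coord (.inl n) p) * coord (.inr n) p)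

/-- The derivative of `sumTerm n`. -/
noncomputable def sumTermDeriv (n : ℕ) (p : Model) : Model →L[ℝ] ℂ :=
  ((2 : ℝ) ^ n)⁻¹ • ((dil n * coord (.inr n) p) •
    (fderiv ℝ twist (dil n • coord (.inl n) p) ∘L coord (.inl n)) +
      twist (dil n • coord (.inl n) p) • coord (.inr n))

theorem sumTermDeriv_apply (n : ℕ) (p h : Model) : sumTermDeriv n p h =
    ((2 : ℝ) ^ n)⁻¹ • (dil n * p (.inr n) * fderiv ℝ twist (dil n • p (.inl n)) (h (.inl n)) +
      twist (dil n • p (.inl n)) * h (.inr n)) := rfl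

theorem continuous_dil_coord (n : ℕ) : Continuous fun p : Model => dil n • coord (.inl n) p :=
  (coord (Sum.inl n)).continuous.const_smul (dil n)

theorem continuous_sumTerm (n : ℕ) : Continuous (sumTerm n) := by
  have h : Continuous fun p : Model => twist (dil n • coord (.inl n) p) :=
    contDiff_twist.continuous.comp (continuous_dil_coord n)
  have h' : Continuous fun p : Model => twist (dil n • coord (.inl n) p) * coord (.inr n) p :=
    h.mul (coord (Sum.inr n)).continuous
  exact h'.const_smul ((2 : ℝ) ^ n)⁻¹

theorem continuous_sumTermDeriv (n : ℕ) : Continuous (sumTermDeriv n) := by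
  have h1 : Continuous fun p : Model => fderiv ℝ twist (dil n • coord (.inl n) p) ∘L
      (coord (.inl n) : Model →L[ℝ] ℂ) :=
    (continuous_fderiv_twist.comp (continuous_dil_coord n)).clm_comp continuous_const
  have h2 : Continuous fun p : Model => (dil n : ℂ) * coord (.inr n) p :=
    continuous_const.mul (coord (Sum.inr n)).continuous
  have h3 : Continuous fun p : Model => twist (dil n • coord (.inl n) p) :=
    contDiff_twist.continuous.comp (continuous_dil_coord n)
  exact ((h2.smul h1).add (h3.smul continuous_const)).const_smul ((2 : ℝ) ^ n)⁻¹

theorem hasFDerivAt_sumTerm (n : ℕ) (p : Model) :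
    HasFDerivAt (sumTerm n) (sumTermDeriv n p) p := by
  have h1 : HasFDerivAt (fun p : Model => dil n • coord (.inl n) p) (dil n • coord (.inl n)) p :=
    (coord (Sum.inl n)).hasFDerivAt.const_smul (dil n)
  have h2 : HasFDerivAt twist (fderiv ℝ twist (dil n • coord (.inl n) p))
      (dil n • coord (.inl n) p) :=
    (contDiff_twist.differentiable (by simp) _).hasFDerivAt
  have h3 : HasFDerivAt (fun p : Model => coord (.inr n) p) (coord (.inr n)) p :=
    (coord (Sum.inr n)).hasFDerivAt
  have h4 := ((h2.comp p h1).mul h3).const_smul ((2 : ℝ) ^ n)⁻¹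
  refine h4.congr_fderiv (ContinuousLinearMap.ext fun v => ?_)
  rw [sumTermDeriv_apply]
  simp only [add_apply, smul_apply, smul_eq_mul, ContinuousLinearMap.comp_apply, coord_apply,
    Function.comp_apply, map_smul]
  simp only [Complex.real_smul]
  ring

theorem exists_norm_sumTerm_le : ∃ C : ℝ, 0 ≤ C ∧
    (∀ n p, ‖sumTerm n p‖ ≤ (2 ^ n)⁻¹ * (C * (1 + ‖p‖))) ∧
    ∀ n P, ‖sumTermDeriv n (modelWeights.down 1 P)‖ ≤ (2 ^ n)⁻¹ * (C * (1 + ‖P‖)) := by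
  obtain ⟨C, hC, h⟩ := exists_twist_bound
  refine ⟨C, hC.le, fun n p => ?_, fun n P => ?_⟩
  · rw [sumTerm, norm_smul, norm_mul, Real.norm_of_nonneg (by positivity)]
    refine mul_le_mul_of_nonneg_left (mul_le_mul (h _).1 ?_ (norm_nonneg _) hC.le) (by positivity)
    exact (norm_coord_le p _).trans (by linarith)
  · refine ContinuousLinearMap.opNorm_le_bound _ (by positivity) fun v => ?_
    rw [sumTermDeriv_apply, norm_smul, norm_inv, norm_pow, Real.norm_ofNat,
      mul_assoc ((2 : ℝ) ^ n)⁻¹]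
    refine mul_le_mul_of_nonneg_left ?_ (by positivity)
    refine (norm_add_le _ _).trans ?_
    rw [norm_mul, norm_mul (twist _)]
    have h1 : ‖(dil n : ℂ) * modelWeights.down 1 P (.inr n)‖ ≤ ‖P‖ :=
      (norm_dil_mul_down_le n P).trans (mul_le_of_le_one_left (norm_nonneg _)
        (inv_le_one_of_one_le₀ (one_le_pow₀ one_le_two)))
    have h2 : ‖fderiv ℝ twist (dil n • modelWeights.down 1 P (.inl n)) (v (.inl n))‖
        ≤ C * ‖v‖ := (ContinuousLinearMap.le_opNorm _ _).trans
      (mul_le_mul (h _).2.1 (norm_coord_le v _) (norm_nonneg _) hC.le)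
    have h3 := mul_le_mul h1 h2 (norm_nonneg _) (norm_nonneg _)
    have h4 := mul_le_mul (h (dil n • modelWeights.down 1 P (.inl n))).1
      (norm_coord_le v (.inr n)) (norm_nonneg _) hC.le
    linarith

/-- The function `∑ 2⁻ⁿ twist (D n z n) u n`. -/
noncomputable def twistSum (p : Model) : ℂ := ∑' n, sumTerm n p

/-- The derivative of `twistSum` at the points of `E_1`. -/
noncomputable def twistSumDeriv (p : Model) : Model →L[ℝ] ℂ := ∑' n, sumTermDeriv n p

theorem continuous_twistSum : Continuous twistSum := by
  obtain ⟨C, hC, h, -⟩ := exists_norm_sumTerm_le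
  exact continuous_tsum_of_le continuous_sumTerm hC h

theorem continuous_twistSumDeriv_down :
    Continuous fun P => twistSumDeriv (modelWeights.down 1 P) := by
  obtain ⟨C, hC, -, h⟩ := exists_norm_sumTerm_le
  exact continuous_tsum_of_le (fun n => (continuous_sumTermDeriv n).comp
    (modelWeights.down 1).continuous) hC h

theorem summable_sumTermDeriv {p : Model} (hp : p ∈ modelWeights.scale.lev 1) :
    Summable fun n => sumTermDeriv n p := by
  obtain ⟨C, hC, -, h⟩ := exists_norm_sumTerm_le
  refine Summable.of_norm_bounded (summable_two_pow_inv.mul_right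
    (C * (1 + ‖modelWeights.up 1 p‖))) fun n => ?_
  simpa only [Weights.down_up hp] using h n (modelWeights.up 1 p)

theorem hasSum_twistSumDeriv {p : Model} (hp : p ∈ modelWeights.scale.lev 1) (h : Model) :
    HasSum (fun n => sumTermDeriv n p h) (twistSumDeriv p h) := by
  have h1 := (summable_sumTermDeriv hp).hasSum
  rw [← twistSumDeriv] at h1
  exact hasSum_clm_apply h1 h

theorem norm_comp_down_le (A : Model →L[ℝ] ℂ) : ‖A ∘L modelWeights.down 1‖ ≤ ‖A‖ :=
  ContinuousLinearMap.opNorm_le_bound _ (norm_nonneg _) fun v => (A.le_opNorm _).trans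
    (mul_le_mul_of_nonneg_left (norm_down_le 1 v) (norm_nonneg _))

/-- In the norm of `E_1` the series can be differentiated term by term. -/
theorem hasFDerivAt_twistSum_down (P : Model) :
    HasFDerivAt (fun P => twistSum (modelWeights.down 1 P))
      (twistSumDeriv (modelWeights.down 1 P) ∘L modelWeights.down 1) P := by
  obtain ⟨C, hC, h, h'⟩ := exists_norm_sumTerm_le
  have hterm : ∀ n Q, HasFDerivAt (fun P => sumTerm n (modelWeights.down 1 P))
      (sumTermDeriv n (modelWeights.down 1 Q) ∘L modelWeights.down 1) Q := fun n Q =>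
    (hasFDerivAt_sumTerm n _).comp Q (modelWeights.down 1).hasFDerivAt
  have hsum := hasFDerivAt_tsum_of_isPreconnected
    (summable_two_pow_inv.mul_right (C * (1 + (‖P‖ + 1)))) Metric.isOpen_ball
    (convex_ball (0 : Model) (‖P‖ + 1)).isPreconnected (fun n Q _ => hterm n Q) (fun n Q hQ => ?_)
    (x₀ := P) (by simp) (Summable.of_norm_bounded
      (summable_two_pow_inv.mul_right (C * (1 + ‖modelWeights.down 1 P‖))) fun n => h n _)
    (x := P) (by simp)
  · refine hsum.congr_fderiv (ContinuousLinearMap.ext fun v => ?_)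
    rw [ContinuousLinearMap.comp_apply]
    refine HasSum.unique ?_ (hasSum_twistSumDeriv (Weights.down_mem 1 P) _)
    refine hasSum_clm_apply (Summable.hasSum ?_) v
    refine Summable.of_norm_bounded (summable_two_pow_inv.mul_right (C * (1 + ‖P‖))) fun n => ?_
    exact (norm_comp_down_le _).trans (h' n P)
  · refine (norm_comp_down_le _).trans ((h' n Q).trans ?_)
    have := (mem_ball_zero_iff.1 hQ).le
    exact mul_le_mul_of_nonneg_left (by gcongr) (by positivity)

end TwistSum

section Counterexample

theorem hasScDerivAt_twistSum {p : Model} (hp : p ∈ modelWeights.scale.lev 1) :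
    HasScDerivAt modelWeights.scale (constScale ℂ) twistSum Set.univ p
      (twistSumDeriv p).toLinearMap := by
  refine ⟨⟨‖twistSumDeriv p‖, fun h _ => ⟨trivial, ?_⟩⟩, fun ε hε => ?_⟩
  · rw [Weights.scale_nrm_zero]
    exact (twistSumDeriv p).le_opNorm h
  · have h1 := hasFDerivAt_twistSum_down (modelWeights.up 1 p)
    rw [hasFDerivAt_iff_isLittleO_nhds_zero, Asymptotics.isLittleO_iff] at h1
    obtain ⟨d, hd, H⟩ := Metric.eventually_nhds_iff.1 (h1 hε)
    refine ⟨d, hd, fun h hh _ hhd => ?_⟩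
    have h2 := H (y := modelWeights.up 1 h) (by rwa [dist_zero_right, ← Weights.norm_up])
    rwa [ContinuousLinearMap.comp_apply, map_add, Weights.down_up hp, Weights.down_up hh,
      ← Weights.norm_up] at h2

theorem isSc_one_twistSum : IsSc 1 modelWeights.scale (constScale ℂ) twistSum Set.univ := by
  refine isSc_one_of_level_zero Weights.isTame.toIsNested
    (Df := fun p => (twistSumDeriv p).toLinearMap) (fun x _ _ ε hε => ?_)
    (fun x _ hx => hasScDerivAt_twistSum hx) fun q hq ε hε => ?_
  · obtain ⟨d, hd, H⟩ := Metric.continuous_iff.1 continuous_twistSum x ε hε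
    refine ⟨d, hd, fun y _ _ hyx => ?_⟩
    rw [Weights.scale_nrm_zero, ← dist_eq_norm] at hyx
    rw [← dist_eq_norm]
    exact H y hyx
  · have hc : Continuous fun z : Model × Model =>
        twistSumDeriv (modelWeights.down 1 z.1) z.2 := by
      have h1 : Continuous fun z : Model × Model => twistSumDeriv (modelWeights.down 1 z.1) :=
        continuous_twistSumDeriv_down.comp continuous_fst
      exact h1.clm_apply continuous_snd
    obtain ⟨d, hd, H⟩ := Metric.continuous_iff.1 hc (modelWeights.up 1 q.1, q.2) ε hε
    refine ⟨d, hd, fun y hy h1 h2 => ?_⟩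
    rw [Weights.scale_nrm_zero] at h2
    rw [Weights.norm_up, Weights.up_sub hy.2.1 hq.2.1] at h1
    have h3 := H (modelWeights.up 1 y.1, y.2) (by
      rw [dist_eq_norm, Prod.norm_def]
      exact max_lt h1 h2)
    rwa [dist_eq_norm, Weights.down_up hy.2.1, Weights.down_up hq.2.1] at h3

/-- The derivative of `twistSum` is complex linear for the twisted structure: the twist compensates
the failure of `twist` to be holomorphic. -/
theorem twistSumDeriv_twistJ {p : Model} (hp : p ∈ modelWeights.scale.lev 1) (h : Model) :
    twistSumDeriv p (twistJ p h) = Complex.I * twistSumDeriv p h := by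
  refine (hasSum_twistSumDeriv hp _).unique ?_
  have e : (fun n => sumTermDeriv n p (twistJ p h)) =
      fun n => Complex.I * sumTermDeriv n p h := funext fun n => by
    rw [sumTermDeriv_apply, sumTermDeriv_apply, twistJ_inl hp, twistJ_inr hp, twistCoeff,
      coord_apply, coord_apply]
    simp only [Complex.real_smul]
    linear_combination (((2 : ℝ) ^ n)⁻¹ : ℝ) * (dil n * p (.inr n)) *
      fderiv_twist_I_mul (dil n * p (.inl n)) (h (.inl n))
  rw [e]
  exact (hasSum_twistSumDeriv hp h).mul_left _

theorem pull_twistSum :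
    pull Set.univ id (fun p : ↥(id '' (Set.univ : Set Model)) => twistSum p.1) = twistSum :=
  funext fun _ => pull_apply twistSum trivial

theorem isScHolomorphic_twistSum : IsScHolomorphic modelWeights.scale Set.univ id twistJ
    (fun p : ↥(id '' (Set.univ : Set Model)) => twistSum p.1) := by
  refine ⟨?_, fun p _ hp => ⟨(twistSumDeriv p).toLinearMap, ?_, fun w _ => ?_⟩⟩
  · rw [IsScOnRetract, pull_twistSum]
    exact isSc_one_twistSum
  · rw [pull_twistSum]
    exact hasScDerivAt_twistSum hp
  · exact twistSumDeriv_twistJ hp w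

theorem exists_coord_eq_two_pow_inv {e : ℕ → ℕ ⊕ ℕ} (he : Function.Injective e) :
    ∃ X : Model, (∀ n, X (e n) = (((2 : ℝ) ^ n)⁻¹ : ℝ)) ∧ ∀ i, (∀ n, e n ≠ i) → X i = 0 := by
  have hs : Summable fun n => (lp.single 2 (e n) ((((2 : ℝ) ^ n)⁻¹ : ℝ) : ℂ) : Model) := by
    refine Summable.of_norm_bounded summable_two_pow_inv fun n => ?_
    rw [lp.norm_single (by norm_num), Complex.norm_real, Real.norm_of_nonneg (by positivity)]
  have hX : ∀ i, HasSum (fun n => (lp.single 2 (e n) ((((2 : ℝ) ^ n)⁻¹ : ℝ) : ℂ) : Model) i)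
      ((∑' n, lp.single 2 (e n) ((((2 : ℝ) ^ n)⁻¹ : ℝ) : ℂ) : Model) i) := fun i => by
    simpa only [coord_apply] using (coord i).hasSum hs.hasSum
  refine ⟨_, fun n => (hX (e n)).unique ?_, fun i hi => (hX i).unique ?_⟩
  · have h : (lp.single 2 (e n) ((((2 : ℝ) ^ n)⁻¹ : ℝ) : ℂ) : Model) (e n) =
        (((2 : ℝ) ^ n)⁻¹ : ℝ) := by
      rw [lp.single_apply, Pi.single_eq_same]
    rw [← h]
    refine hasSum_single n fun k hk => ?_
    rw [lp.single_apply, Pi.single_eq_of_ne fun h => hk (he h).symm]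
  · have h : (fun n => (lp.single 2 (e n) ((((2 : ℝ) ^ n)⁻¹ : ℝ) : ℂ) : Model) i) = fun _ => 0 :=
      funext fun n => by rw [lp.single_apply, Pi.single_eq_of_ne (hi n).symm]
    rw [h]
    exact hasSum_zero

/-- The derivative of `p ↦ D(twistSum)(p) h` in the direction of the coordinate `z n`, at points
with `z n = 0`. -/
theorem hasDerivAt_twistSumDeriv_line {p : Model} (hp : p ∈ modelWeights.scale.lev 1) (h : Model)
    (n : ℕ) (hz : p (.inl n) = 0) (hu : h (.inr n) = 0) :
    HasDerivAt (fun t : ℝ => twistSumDeriv (p + t • lp.single 2 (.inl n) 1) h)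
      (((2 : ℝ) ^ n)⁻¹ • (dil n * p (.inr n) * dil n * h (.inl n))) 0 := by
  have hcoord : ∀ (t : ℝ) i, (p + t • lp.single 2 (.inl n) 1 : Model) i =
      p i + t • Pi.single (M := fun _ => ℂ) (.inl n) 1 i := fun t i => by
    rw [lp.coeFn_add, Pi.add_apply, lp.coeFn_smul, Pi.smul_apply, lp.single_apply]
  have hz' : ∀ t : ℝ, (p + t • lp.single 2 (.inl n) 1 : Model) (.inl n) = t := fun t => by
    rw [hcoord, hz, Pi.single_eq_same, zero_add, Complex.real_smul, mul_one]
  have hu' : ∀ (t : ℝ) k, (p + t • lp.single 2 (.inl n) 1 : Model) (.inr k) = p (.inr k) :=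
    fun t k => by rw [hcoord, Pi.single_eq_of_ne (by simp), smul_zero, add_zero]
  -- only the summand of index `n` depends on `t`
  have hsplit : ∀ t : ℝ, twistSumDeriv (p + t • lp.single 2 (.inl n) 1) h =
      twistSumDeriv p h - sumTermDeriv n p h +
        sumTermDeriv n (p + t • lp.single 2 (.inl n) 1) h := fun t => by
    have hpt : p + t • lp.single 2 (.inl n) 1 ∈ modelWeights.scale.lev 1 :=
      add_mem hp (Submodule.smul_mem _ _ (Weights.single_mem 1 _ _))
    have h1 := (hasSum_twistSumDeriv hpt h).sub (hasSum_twistSumDeriv hp h)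
    have h2 := h1.unique (hasSum_single n fun k hk => ?_)
    · linear_combination h2
    · rw [sumTermDeriv_apply, sumTermDeriv_apply, hu', hcoord,
        Pi.single_eq_of_ne (by simpa using hk), smul_zero, add_zero, sub_self]
  have hterm : (fun t : ℝ => sumTermDeriv n (p + t • lp.single 2 (.inl n) 1) h) =ᶠ[𝓝 0]
      fun t : ℝ => ((2 : ℝ) ^ n)⁻¹ • (dil n * p (.inr n) *
        (Complex.exp (dil n * t) * h (.inl n))) := by
    have hcont : ContinuousAt (fun t : ℝ => ‖dil n • (t : ℂ)‖) 0 := by fun_prop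
    filter_upwards [hcont.eventually (gt_mem_nhds (by simp :
      ‖dil n • ((0 : ℝ) : ℂ)‖ < 1))] with t ht
    rw [sumTermDeriv_apply, hz', hu', fderiv_twist_of_norm_lt ht, hu, mul_zero, add_zero,
      Complex.real_smul (x := dil n)]
  have hexp : HasDerivAt (fun t : ℝ => Complex.exp (dil n * t)) (dil n) 0 := by
    have h1 : HasDerivAt (fun t : ℝ => (dil n : ℂ) * t) (dil n) 0 := by
      simpa using (Complex.ofRealCLM.hasDerivAt (x := 0)).const_mul (dil n : ℂ)
    simpa using h1.cexp
  have h1 := (((hexp.mul_const (h (.inl n))).const_mul (dil n * p (.inr n))).const_smul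
    ((2 : ℝ) ^ n)⁻¹).congr_of_eventuallyEq hterm
  simp only [hsplit]
  refine (h1.const_add _).congr_deriv ?_
  rw [mul_assoc _ (dil n : ℂ) (h (.inl n))]

/-- If `twistSum` were sc², its second derivative at a point `(p, h)` with `p ∈ E_2` and `h ∈ E_1`
would be bounded by a multiple of the norm of `E_1 × E_0`; the coordinate directions contradict
this. -/
theorem not_isSc_two_twistSum :
    ¬ IsSc 2 modelWeights.scale (constScale ℂ) twistSum Set.univ := by
  rintro ⟨-, Df, hDf, -, DD, hDD, -⟩
  obtain ⟨X, hX, hX'⟩ := exists_coord_eq_two_pow_inv (e := Sum.inr) Sum.inr_injective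
  obtain ⟨Y, hY, hY'⟩ := exists_coord_eq_two_pow_inv (e := Sum.inl) Sum.inl_injective
  -- the coordinates are `u n = 2 ^ (-11 n)` for `p`, and `z n = 2 ^ (-2 n)` for `h`
  set p := modelWeights.down 2 X with hp
  set h := modelWeights.down 1 Y with hh
  have hp2 : p ∈ modelWeights.scale.lev 2 := Weights.down_mem 2 X
  have hp1 := Weights.lev_succ_le 1 hp2
  have hh1 : h ∈ modelWeights.scale.lev 1 := Weights.down_mem 1 Y
  have hA := hDD (p, h) ⟨trivial, hp1, mem_lev_zero h⟩ (mem_tangent_lev.2 ⟨hp2, hh1⟩)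
  obtain ⟨K, hK⟩ := hA.1
  obtain ⟨n, hn⟩ := pow_unbounded_of_one_lt |K| (one_lt_two (α := ℝ))
  have hv : ∀ m, ((lp.single 2 (.inl n) 1, 0) : Model × Model) ∈
      modelWeights.scale.tangent.lev m := fun m =>
    mem_tangent_lev.2 ⟨Weights.single_mem _ _ _, zero_mem _⟩
  have hline := hA.hasDerivAt_line Weights.isTame.tangent (LinearMap.snd ℝ ℂ ℂ) zero_le_one
    (fun w _ => by rw [one_mul]; exact le_max_right _ _) (fun _ _ => ⟨trivial, trivial⟩)
    ⟨trivial, hp1, mem_lev_zero h⟩ (hv 1) (Eventually.of_forall fun t =>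
      ⟨trivial, add_mem hp1 (Submodule.smul_mem _ t (Weights.single_mem 1 _ _)), mem_lev_zero _⟩)
  have hD : ∀ t : ℝ, Df (p + t • lp.single 2 (.inl n) 1) (h + t • (0 : Model)) =
      twistSumDeriv (p + t • lp.single 2 (.inl n) 1) h := fun t => by
    have hpt : p + t • lp.single 2 (.inl n) 1 ∈ modelWeights.scale.lev 1 :=
      add_mem hp1 (Submodule.smul_mem _ _ (Weights.single_mem 1 _ _))
    rw [smul_zero, add_zero]
    exact (hDf _ trivial hpt).unique Weights.isTame (isTame_constScale ℂ)
      (hasScDerivAt_twistSum hpt) (fun _ _ => trivial) trivial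
      ⟨1, one_pos, fun _ _ _ => trivial⟩ h (mem_lev_zero h)
  have hz : p (.inl n) = 0 := by
    rw [hp, Weights.down_apply, hX' _ fun k => by simp, smul_zero]
  have hu : h (.inr n) = 0 := by
    rw [hh, Weights.down_apply, hY' _ fun k => by simp, smul_zero]
  have hd := hasDerivAt_twistSumDeriv_line hp1 h n hz hu
  simp only [← hD] at hd
  have heq := hline.unique hd
  have hb := (hK _ (hv 0)).2
  have hpu : p (.inr n) = ((((2 : ℝ) ^ n) ^ 10)⁻¹ * ((2 : ℝ) ^ n)⁻¹ : ℝ) := by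
    rw [hp, Weights.down_apply, modelWeights_inr_two, hX, Complex.real_smul, Complex.ofReal_mul]
  have hhz : h (.inl n) = (((2 : ℝ) ^ n)⁻¹ * ((2 : ℝ) ^ n)⁻¹ : ℝ) := by
    rw [hh, Weights.down_apply, modelWeights_inl_one, hY, Complex.real_smul, Complex.ofReal_mul]
  -- the powers of `2 ^ n` are `-1` from the sum, `16` from `D n`, `-11` from `p`, `-2` from `h`;
  -- the norm of the direction has the power `1` only
  have hval : ((2 : ℝ) ^ n)⁻¹ • (dil n * p (.inr n) * dil n * h (.inl n) : ℂ) =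
      (((2 : ℝ) ^ n) ^ 2 : ℝ) := by
    rw [hpu, hhz, Complex.real_smul, dil, ← Complex.ofReal_mul, ← Complex.ofReal_mul,
      ← Complex.ofReal_mul, ← Complex.ofReal_mul]
    congr 1
    field_simp
  rw [tangent_nrm_zero modelWeights.scale, Weights.nrm_single, modelWeights_inl_one, norm_one,
    mul_one, Weights.isTame.nrm_zero, max_eq_left (by positivity)] at hb
  have h1 : ((2 : ℝ) ^ n) ^ 2 ≤ K * 2 ^ n := by
    refine le_trans ?_ hb
    have h2 : ‖LinearMap.snd ℝ ℂ ℂ (DD (p, h) (lp.single 2 (.inl n) 1, 0))‖ =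
        ((2 : ℝ) ^ n) ^ 2 := by
      rw [heq, hval, Complex.norm_real, Real.norm_of_nonneg (by positivity)]
    rw [← h2]
    exact le_max_right _ _
  have h2 : (0 : ℝ) < 2 ^ n := by positivity
  nlinarith [le_abs_self K]

/-- An sc-holomorphic function on a complex M-polyfold need not be sc². -/
theorem exists_isScHolomorphic_not_isSc_two :
    ∃ (E : Type) (_ : AddCommGroup E) (_ : Module ℝ E) (S : ScScale E) (C U : Set E)
      (r : E → E) (J : E → E → E), IsComplexMPolyfold S C U r J ∧
      ∃ f : ↥(r '' U) → ℂ, IsScHolomorphic S U r J f ∧ ¬ IsScOnRetract 2 S U r f := by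
  refine ⟨Model, _, _, modelWeights.scale, Set.univ, Set.univ, id, twistJ,
    isComplexMPolyfold_twistJ, fun p => twistSum p.1, isScHolomorphic_twistSum, ?_⟩
  rw [IsScOnRetract, pull_twistSum]
  exact not_isSc_two_twistSum

end Counterexample

end MPolyfold

theorem proposition4p5 :
    -- (i)
    (∀ (n k : ℕ) (D : MPolyfold.GammaData k),
      MPolyfold.IsEvenDimensional (D.scale n) Set.univ (D.retr n) →
      ∃ V : Submodule ℂ (D.Gam n → ℂ),
        (∀ φ : D.Gam n → ℂ, φ ∈ V ↔
          MPolyfold.IsScHolomorphic (D.scale n) Set.univ (D.retr n) (D.cplx n) φ) ∧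
        ¬ FiniteDimensional ℂ V) ∧
    -- (ii)
    (∀ D : MPolyfold.GammaData 2,
      Function.Injective (MPolyfold.iotaMap D) ∧
      MPolyfold.IsScHolomorphic (D.scale 1) Set.univ (D.retr 1) (D.cplx 1)
        (MPolyfold.iotaMap D) ∧
      ∃ φ : D.Gam 1 → ℂ,
        MPolyfold.IsScHolomorphic (D.scale 1) Set.univ (D.retr 1) (D.cplx 1) φ ∧
        (∀ p : D.Gam 1, φ p =
          if 0 < (MPolyfold.iotaMap D p).1.im then
            (MPolyfold.iotaMap D p).1 ^ 2 * (MPolyfold.iotaMap D p).2 ^ 2 *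
              Complex.log (MPolyfold.iotaMap D p).1
          else 0) ∧
        ∀ W : Set (ℂ × ℂ), IsOpen W → (0 : ℂ × ℂ) ∈ W →
          ¬ ∃ F : ℂ × ℂ → ℂ, DifferentiableOn ℂ F W ∧
            ∀ p : D.Gam 1, MPolyfold.iotaMap D p ∈ W → F (MPolyfold.iotaMap D p) = φ p) ∧
    -- (iii)
    (∃ (E : Type) (_ : AddCommGroup E) (_ : Module ℝ E) (S : MPolyfold.ScScale E) (C U : Set E)
      (r : E → E) (J : E → E → E),
      MPolyfold.IsComplexMPolyfold S C U r J ∧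
      ∃ f : ↥(r '' U) → ℂ, MPolyfold.IsScHolomorphic S U r J f ∧
        ¬ MPolyfold.IsScOnRetract 2 S U r f) :=
  ⟨fun n k D h => D.exists_holomorphicFunctions n k h,
    fun D => ⟨D.iotaMap_injective, D.isScHolomorphic_iotaMap, D.exists_not_extendable⟩,
    MPolyfold.exists_isScHolomorphic_not_isSc_two⟩
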